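/- Let $d\ge 1$ and let $K\subset\mathbb R^d$ be a bounded convex set with non-empty interior, symmetric about the origin. Let $\|\cdot\|_K$ be the norm induced by $K$ (its Minkowski functional), let $\sigma_K$ be the surface measure on $\partial K$, and for $E\subset\mathbb R^d$ put $\Delta_K(E)=\{\|x-y\|_K : x,y\in E\}$. For a finite Borel measure $\mu$ on $\mathbb R^d$ write $\widehat\mu(\xi)=\int e^{-2\pi i x\cdot\xi}\,d\mu(x)$. Let $E\subset[0,1]^d$. (i) Suppose that $E$ is Borel and that for some $\gamma>0$ and some constant $C$ we have $|\widehat\sigma_K(\xi)|\le C|\xi|^{-\gamma}$ for all $\xi\ne 0$. If $\dim_{\mathcal H}E>d-\gamma$, then $\Delta_K(E)$ has positive Lebesgue measure. (ii) Suppose that $E$ is Borel and that for some $\gamma>0$ and some constant $C$ we have $\int_{S^{d-1}}|\widehat\sigma_K(R\omega)|\,d\omega\le CR^{-\gamma}$ for all $R>0$. If $\dim_{\mathcal H}E>d-\gamma$, then $\Delta_K(\rho E)$ has positive Lebesgue measure for almost every $\rho\in SO(d)$ with respect to Haar measure. (iii) Let $\gamma:[0,\infty)\to\mathbb R$ be a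 convex function with $\gamma(0)=0$ such that, for some constant $C>0$, $|\widehat\sigma_K(\xi)|\le C\gamma(|\xi|^{-1})$ for all $\xi\ne0$. Suppose that there is a non-zero finite Borel measure $\mu$ on $\mathbb R^d$ with $\mu(\mathbb R^d\setminus E)=0$ and $$\int_{\mathbb R^d}|\widehat\mu(\xi)|^2\,\gamma(|\xi|^{-1})\,d\xi<\infty .$$ Then $\Delta_K(E)$ has positive Lebesgue measure. -/

import Mathlib

open MeasureTheory Set
open scoped ENNReal

/-- The `K`-distance set `Δ_K(E) = {‖x - y‖_K : x, y ∈ E}`, where `‖·‖_K` is the norm with unit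
ball `K`, that is, the Minkowski functional of `K`. -/
def kDistSet {d : ℕ} (K E : Set (EuclideanSpace ℝ (Fin d))) : Set ℝ :=
  {r | ∃ x ∈ E, ∃ y ∈ E, gauge K (x - y) = r}

/-- The surface measure `σ_K` on the boundary of `K`: the `(d-1)`-dimensional Hausdorff measure
(normalised to agree with Lebesgue measure on Euclidean spaces), restricted to `∂K`. -/
noncomputable def surfaceMeasure {d : ℕ} (K : Set (EuclideanSpace ℝ (Fin d))) :
    Measure (EuclideanSpace ℝ (Fin d)) :=
  (Measure.euclideanHausdorffMeasure (d - 1)).restrict (frontier K)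

/-- The Fourier transform `μ̂(ξ) = ∫ exp(-2πi x·ξ) dμ(x)` of a finite measure on `ℝ^d`. -/
noncomputable def fourierMeasure {d : ℕ} (μ : Measure (EuclideanSpace ℝ (Fin d)))
    (ξ : EuclideanSpace ℝ (Fin d)) : ℂ :=
  ∫ x, Complex.exp (-2 * Real.pi * Complex.I * ((inner ℝ x ξ : ℝ) : ℂ)) ∂μ

/-- The rotation group `SO(d)`, as a group of matrices. -/
abbrev RotationGroup (d : ℕ) : Type := Matrix.specialOrthogonalGroup (Fin d) ℝ

instance RotationGroup.instMeasurableSpace (d : ℕ) : MeasurableSpace (RotationGroup d) :=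
  borel _

instance RotationGroup.instBorelSpace (d : ℕ) : BorelSpace (RotationGroup d) := ⟨rfl⟩

instance RotationGroup.instIsTopologicalGroup (d : ℕ) : IsTopologicalGroup (RotationGroup d) where
  continuous_mul := by
    refine Continuous.subtype_mk ?_ _
    exact (continuous_subtype_val.comp continuous_fst).mul
      (continuous_subtype_val.comp continuous_snd)
  continuous_inv := by
    refine Continuous.subtype_mk ?_ _
    exact continuous_subtype_val.matrix_transpose

instance RotationGroup.instCompactSpace (d : ℕ) : CompactSpace (RotationGroup d) := by
  have hmem : ∀ A : Matrix (Fin d) (Fin d) ℝ,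
      A ∈ Matrix.specialOrthogonalGroup (Fin d) ℝ ↔ A * A.transpose = 1 ∧ A.det = 1 := fun A => by
    rw [Matrix.mem_specialOrthogonalGroup_iff, Matrix.mem_orthogonalGroup_iff]
  have hrow : ∀ A : Matrix (Fin d) (Fin d) ℝ, A * A.transpose = 1 →
      ∀ i, ∑ k, A i k * A i k = 1 := fun A hA i => by
    have h := congrFun (congrFun hA i) i
    rw [Matrix.mul_apply, Matrix.one_apply_eq] at h
    exact h
  have hcl : IsClosed {A : Matrix (Fin d) (Fin d) ℝ | A * A.transpose = 1 ∧ A.det = 1} :=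
    (isClosed_eq (continuous_id.mul continuous_id.matrix_transpose) continuous_const).inter
      (isClosed_eq continuous_id.matrix_det continuous_const)
  have hbox : IsCompact (Set.pi univ fun _ : Fin d => Set.pi univ fun _ : Fin d =>
      Icc (-1 : ℝ) 1) := isCompact_univ_pi fun _ => isCompact_univ_pi fun _ => isCompact_Icc
  have hK : IsCompact {A : Matrix (Fin d) (Fin d) ℝ | A * A.transpose = 1 ∧ A.det = 1} := by
    refine hbox.of_isClosed_subset hcl ?_
    rintro A ⟨hA, -⟩ i - j -
    have h1 : ∑ k, A i k * A i k = 1 := hrow A hA i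
    have h2 : A i j * A i j ≤ 1 := h1 ▸ Finset.single_le_sum
      (f := fun k => A i k * A i k) (fun k _ => mul_self_nonneg _) (Finset.mem_univ j)
    exact ⟨by nlinarith, by nlinarith⟩
  refine isCompact_iff_compactSpace.mp ?_
  convert hK using 1
  ext A
  exact hmem A

/-- The action of a rotation matrix on `ℝ^d` by multiplication of column vectors. -/
noncomputable def rotate {d : ℕ} (ρ : RotationGroup d) (x : EuclideanSpace ℝ (Fin d)) :
    EuclideanSpace ℝ (Fin d) :=
  WithLp.toLp 2 (Matrix.mulVec (ρ : Matrix (Fin d) (Fin d) ℝ) x.ofLp)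

/-! Let $\nu$ be the image of $\mu\times\mu$ under $(x,y)\mapsto\|x-y\|_K$, where $\mu$ is carried
by $E$. It suffices that $\nu$ is absolutely continuous on $(0,\infty)$: if $\Delta_K(E)$ were null,
$\mu\times\mu$ would live on the diagonal and $\mu$ would be a point mass.

Write $\tilde\mu$ for the reflection of $\mu$. For $t\in[a,b]$ with $a>0$, $\nu([t-r,t+r])$ is the
mass that $\mu*\tilde\mu$ gives to a shell of width about $r$ around $t\,\partial K$. Since
$\sigma_K(B(w,r))\ge c\,r^{d-1}$ at boundary points, $\sigma_K$ dilated by $t$ and mollified by a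
Gaussian at scale comparable to $r$ is at least a multiple of $r^{-1}$ on the shell. Fourier
inversion then gives $\nu([t-r,t+r])\le C\,r\int|\hat\mu(\xi)|^2|\hat\sigma_K(t\xi)|\,d\xi$
(`exists_diffMeasure_gauge_le`). A Fubini argument turns local integrability of this energy in $t$
into absolute continuity (`measure_inter_Ioo_eq_zero_of_closedBall_le`), and `volume_kDistSet_pos`
concludes. Applied to a two-point measure, the same inequality shows that $\hat\sigma_K$ is not
integrable. Hence point masses have infinite energy, and a decay exponent $\gamma$ cannot exceed
$d$.

The three parts differ in how the energy is bounded. In (i), Frostman's lemma gives $\mu$ with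
$\mu(B(x,r))\le Cr^s$ for some $s>d-\gamma$, and dyadic summation bounds
$\int|\hat\mu|^2\min(1,|\xi|^{-\gamma})$. In (ii) the energies of the rotated measures are averaged
over $SO(d)$: the average of $|\hat\sigma_K|$ over rotates is radial and controlled by the spherical
mean, so Tonelli's theorem gives finite energy for almost every rotation. In (iii) $\gamma$ is
increasing, and the dilation by $t$ must be removed without a growth condition on $\gamma$. This is
possible because $|\hat\mu|^2$ is positive definite, which makes $|\hat\mu|^2d\xi$ doubling on balls
around the origin (`exists_lintegral_ball_mul_le`).

Frostman's lemma for Borel sets is proved on the tree of dyadic cubes: net content is continuous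
along increasing unions of arbitrary sets, so analytic sets have compact subsets of nearly full
content, and on a compact set mass is split down the tree in proportion to content. -/

/-! ### Net contents on sequence spaces and capacitability of analytic sets. -/

section WordContent

open Filter Topology

variable {α : Type*}

/-- The cylinder of all sequences that begin with the letters of `w`, read from right to left. -/
def wordCylinder (w : List α) : Set (ℕ → α) := {x | PiNat.res x w.length = w}

theorem mem_wordCylinder_res (x : ℕ → α) (n : ℕ) : x ∈ wordCylinder (PiNat.res x n) := by
  simp [wordCylinder]

theorem res_suffix_res (x : ℕ → α) {m n : ℕ} (h : m ≤ n) : PiNat.res x m <:+ PiNat.res x n := by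
  induction n, h using Nat.le_induction with
  | base => exact List.suffix_rfl
  | succ n _ ih => exact ih.trans (List.suffix_cons _ _)

theorem wordCylinder_anti {v w : List α} (h : v <:+ w) : wordCylinder w ⊆ wordCylinder v := by
  intro x hx
  have h1 : PiNat.res x v.length <:+ PiNat.res x w.length := res_suffix_res x h.length_le
  rw [show PiNat.res x w.length = w from hx] at h1
  exact (List.suffix_of_suffix_length_le h1 h (by simp)).eq_of_length (by simp)

theorem suffix_of_mem_wordCylinder {v w : List α} {x : ℕ → α} (hv : x ∈ wordCylinder v)
    (hw : x ∈ wordCylinder w) (h : v.length ≤ w.length) : v <:+ w := by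
  rw [← show PiNat.res x v.length = v from hv, ← show PiNat.res x w.length = w from hw]
  exact res_suffix_res x h

theorem wordCylinder_nil : wordCylinder ([] : List α) = univ := by
  ext x; simp [wordCylinder]

theorem wordCylinder_eq_iUnion_cons (w : List α) :
    wordCylinder w = ⋃ a, wordCylinder (a :: w) := by
  ext x
  simp [wordCylinder]

theorem disjoint_wordCylinder {v w : List α} (h : v.length = w.length) (hne : v ≠ w) :
    Disjoint (wordCylinder v) (wordCylinder w) := by
  rw [Set.disjoint_left]
  intro x hv hw
  exact hne ((suffix_of_mem_wordCylinder hv hw h.le).eq_of_length h)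

theorem isOpen_wordCylinder [TopologicalSpace α] [DiscreteTopology α] (w : List α) :
    IsOpen (wordCylinder w) := by
  rw [isOpen_iff_mem_nhds]
  intro x hx
  have : PiNat.cylinder x w.length ⊆ wordCylinder w := by
    intro y hy
    rw [PiNat.cylinder_eq_res] at hy
    exact (show PiNat.res y w.length = PiNat.res x w.length from hy).trans hx
  exact mem_of_superset ((PiNat.isOpen_cylinder _ x _).mem_nhds (PiNat.self_mem_cylinder x _)) this

theorem isClosed_wordCylinder [TopologicalSpace α] [DiscreteTopology α] (w : List α) :
    IsClosed (wordCylinder w) := by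
  rw [← isOpen_compl_iff, isOpen_iff_mem_nhds]
  intro x hx
  refine mem_of_superset ((isOpen_wordCylinder (PiNat.res x w.length)).mem_nhds
    (mem_wordCylinder_res x _)) ?_
  exact (disjoint_wordCylinder (by simp) hx).subset_compl_right

/-- The total weight of a set of words, where a word of length `n` has weight `q ^ n`. -/
noncomputable def wordCost (q : ℝ≥0∞) (V : Set (List α)) : ℝ≥0∞ :=
  ∑' w, V.indicator (fun w : List α => q ^ w.length) w

/-- The net content of a set of sequences: the infimum of the weights of its covers by
cylinders. -/
noncomputable def wordContent (q : ℝ≥0∞) (A : Set (ℕ → α)) : ℝ≥0∞ :=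
  ⨅ (V : Set (List α)) (_ : A ⊆ ⋃ w ∈ V, wordCylinder w), wordCost q V

theorem wordContent_le {q : ℝ≥0∞} {A : Set (ℕ → α)} {V : Set (List α)}
    (h : A ⊆ ⋃ w ∈ V, wordCylinder w) : wordContent q A ≤ wordCost q V :=
  iInf₂_le V h

theorem exists_wordCost_lt {q : ℝ≥0∞} {A : Set (ℕ → α)} {c : ℝ≥0∞} (h : wordContent q A < c) :
    ∃ V : Set (List α), A ⊆ ⋃ w ∈ V, wordCylinder w ∧ wordCost q V < c := by
  simpa [wordContent, iInf_lt_iff] using h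

theorem wordCost_singleton (q : ℝ≥0∞) (w : List α) : wordCost q {w} = q ^ w.length := by
  rw [wordCost, tsum_eq_single w]
  · simp
  · intro v hv; simp [hv]

theorem wordContent_le_pow {q : ℝ≥0∞} {A : Set (ℕ → α)} {w : List α} (h : A ⊆ wordCylinder w) :
    wordContent q A ≤ q ^ w.length := by
  rw [← wordCost_singleton]
  exact wordContent_le (by simpa using h)

theorem wordContent_le_one (q : ℝ≥0∞) (A : Set (ℕ → α)) : wordContent q A ≤ 1 := by
  simpa using wordContent_le_pow (q := q) (w := []) (A := A) (by simp [wordCylinder_nil])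

theorem wordContent_ne_top (q : ℝ≥0∞) (A : Set (ℕ → α)) : wordContent q A ≠ ∞ :=
  ((wordContent_le_one q A).trans_lt ENNReal.one_lt_top).ne

theorem wordContent_empty (q : ℝ≥0∞) : wordContent q (∅ : Set (ℕ → α)) = 0 := by
  refine le_antisymm ?_ bot_le
  refine (wordContent_le (V := ∅) (by simp)).trans ?_
  simp [wordCost]

theorem wordCost_union_le (q : ℝ≥0∞) (V V' : Set (List α)) :
    wordCost q (V ∪ V') ≤ wordCost q V + wordCost q V' := by
  rw [wordCost, wordCost, wordCost, ← ENNReal.tsum_add]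
  refine ENNReal.tsum_le_tsum fun w => ?_
  by_cases h : w ∈ V <;> by_cases h' : w ∈ V' <;> simp [h, h']

theorem wordContent_union_le (q : ℝ≥0∞) (A B : Set (ℕ → α)) :
    wordContent q (A ∪ B) ≤ wordContent q A + wordContent q B := by
  refine ENNReal.le_of_forall_pos_le_add fun ε hε _ => ?_
  have hε2 : (ε / 2 : ℝ≥0∞) ≠ 0 := by simpa using hε.ne'
  obtain ⟨V, hV, hVc⟩ := exists_wordCost_lt
    (ENNReal.lt_add_right (wordContent_ne_top q A) hε2)
  obtain ⟨V', hV', hVc'⟩ := exists_wordCost_lt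
    (ENNReal.lt_add_right (wordContent_ne_top q B) hε2)
  calc wordContent q (A ∪ B) ≤ wordCost q (V ∪ V') := by
        apply wordContent_le
        rw [biUnion_union]
        exact union_subset_union hV hV'
    _ ≤ wordCost q V + wordCost q V' := wordCost_union_le _ _ _
    _ ≤ (wordContent q A + ε / 2) + (wordContent q B + ε / 2) := add_le_add hVc.le hVc'.le
    _ = wordContent q A + wordContent q B + ε := by
        rw [add_add_add_comm, ENNReal.add_halves]

theorem wordContent_biUnion_finset_le {ι : Type*} (q : ℝ≥0∞) (s : Finset ι)
    (A : ι → Set (ℕ → α)) :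
    wordContent q (⋃ i ∈ s, A i) ≤ ∑ i ∈ s, wordContent q (A i) := by
  classical
  induction s using Finset.induction_on with
  | empty => simp [wordContent_empty]
  | insert i s hi ih =>
    rw [Finset.set_biUnion_insert, Finset.sum_insert hi]
    exact (wordContent_union_le _ _ _).trans (by gcongr)

/-- The words of `V` that have no proper ancestor in `V`. -/
def minimalWords (V : Set (List α)) : Set (List α) := {w | w ∈ V ∧ ∀ v ∈ V, v <:+ w → v = w}

theorem exists_minimalWords {V : Set (List α)} {w : List α} (hw : w ∈ V) :
    ∃ v ∈ minimalWords V, v <:+ w := by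
  induction h : w.length using Nat.strong_induction_on generalizing w with
  | _ n ih =>
    by_cases hm : w ∈ minimalWords V
    · exact ⟨w, hm, List.suffix_rfl⟩
    · simp only [minimalWords, mem_ofPred_eq, not_and, not_forall] at hm
      obtain ⟨v, hv, hvw, hne⟩ := hm hw
      have hlt : v.length < n := by
        refine h ▸ lt_of_le_of_ne hvw.length_le fun he => hne (hvw.eq_of_length he)
      obtain ⟨u, hu, huv⟩ := ih _ hlt hv rfl
      exact ⟨u, hu, huv.trans hvw⟩

/-- Strong subadditivity of the net content, at the level of covers. -/
theorem wordCost_minimalWords_add_le {q : ℝ≥0∞} {A : Set (ℕ → α)} {V V' : Set (List α)}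
    (hV : A ⊆ ⋃ w ∈ V, wordCylinder w) (hV' : A ⊆ ⋃ w ∈ V', wordCylinder w) :
    wordCost q (minimalWords (V ∪ V')) + wordContent q A ≤ wordCost q V + wordCost q V' := by
  set J := minimalWords (V ∪ V') with hJ
  -- Two cylinders through the same point are nested. So a point of `A` lies in a word common to `V`
  -- and `V'`, or the longer of its two words is not minimal. The cost of this cover together with
  -- that of `J` counts each word no more often than `V` and `V'` do.
  have hcov : A ⊆ ⋃ w ∈ ((V ∪ V') \ J) ∪ (V ∩ V'), wordCylinder w := by
    intro x hx
    obtain ⟨v, hv, hxv⟩ := mem_iUnion₂.1 (hV hx)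
    obtain ⟨v', hv', hxv'⟩ := mem_iUnion₂.1 (hV' hx)
    by_cases hvv : v = v'
    · exact mem_iUnion₂.2 ⟨v, Or.inr ⟨hv, hvv ▸ hv'⟩, hxv⟩
    rcases le_total v.length v'.length with hl | hl
    · have hs := suffix_of_mem_wordCylinder hxv hxv' hl
      exact mem_iUnion₂.2 ⟨v', Or.inl ⟨Or.inr hv', fun h => hvv (h.2 v (Or.inl hv) hs)⟩, hxv'⟩
    · have hs := suffix_of_mem_wordCylinder hxv' hxv hl
      exact mem_iUnion₂.2
        ⟨v, Or.inl ⟨Or.inl hv, fun h => hvv (h.2 v' (Or.inr hv') hs).symm⟩, hxv⟩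
  refine (add_le_add_right (wordContent_le hcov) _).trans ?_
  rw [wordCost, wordCost, wordCost, wordCost, ← ENNReal.tsum_add, ← ENNReal.tsum_add]
  refine ENNReal.tsum_le_tsum fun w => ?_
  have hsub : w ∈ J → w ∈ V ∪ V' := fun h => h.1
  by_cases h : w ∈ V <;> by_cases h' : w ∈ V' <;> by_cases hj : w ∈ J <;>
    simp [h, h', hj] at hsub ⊢

/-- The net content is continuous along increasing sequences of arbitrary sets. -/
theorem wordContent_iUnion_le {q : ℝ≥0∞} {A : ℕ → Set (ℕ → α)} (hA : Monotone A) {σ : ℝ≥0∞}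
    (hσ : ∀ n, wordContent q (A n) ≤ σ) : wordContent q (⋃ n, A n) ≤ σ := by
  refine ENNReal.le_of_forall_pos_le_add fun ε hε _ => ?_
  obtain ⟨δ, hδ, hδsum⟩ := ENNReal.exists_pos_sum_of_countable' (ε := ε) (by simpa using hε.ne') ℕ
  choose V hVcov hVcost using fun n =>
    exists_wordCost_lt (ENNReal.lt_add_right (wordContent_ne_top q (A n)) (hδ n).ne')
  -- The near-optimal covers are merged one at a time, and only the largest cylinders are kept.
  let W : ℕ → Set (List α) := fun n =>
    Nat.rec (motive := fun _ => Set (List α)) (V 0) (fun n U => minimalWords (U ∪ V (n + 1))) n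
  have hW0 : W 0 = V 0 := rfl
  have hWs : ∀ n, W (n + 1) = minimalWords (W n ∪ V (n + 1)) := fun n => rfl
  have hcov : ∀ n, A n ⊆ ⋃ w ∈ W n, wordCylinder w := by
    rintro (_ | n) x hx
    · exact hVcov 0 hx
    · obtain ⟨v, hv, hxv⟩ := mem_iUnion₂.1 (hVcov _ hx)
      obtain ⟨u, hu, huv⟩ := exists_minimalWords (V := W n ∪ V (n + 1)) (Or.inr hv)
      exact mem_iUnion₂.2 ⟨u, hu, wordCylinder_anti huv hxv⟩
  have hcost : ∀ n, wordCost q (W n) ≤ wordContent q (A n) + ∑ i ∈ Finset.range (n + 1), δ i := by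
    intro n
    induction n with
    | zero => simpa [hW0] using (hVcost 0).le
    | succ n ih =>
      -- Both `W n` and `V (n + 1)` cover `A n`. The content of `A n` is finite and cancels, so each
      -- merge adds only the error `δ (n + 1)`.
      have h1 := wordCost_minimalWords_add_le (q := q) (hcov n)
        ((hA n.le_succ).trans (hVcov (n + 1)))
      rw [← ENNReal.add_le_add_iff_right (wordContent_ne_top q (A n)), hWs]
      refine h1.trans ((add_le_add ih (hVcost (n + 1)).le).trans (le_of_eq ?_))
      rw [Finset.sum_range_succ _ (n + 1)]
      ring
  have hcost' : ∀ n, wordCost q (W n) ≤ σ + ε := fun n =>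
    (hcost n).trans (add_le_add (hσ n) ((ENNReal.sum_le_tsum _).trans hδsum.le))
  let U : Set (List α) := {w | ∀ᶠ n in atTop, w ∈ W n}
  have hUcov : (⋃ n, A n) ⊆ ⋃ w ∈ U, wordCylinder w := by
    intro x hx
    obtain ⟨n, hn⟩ := mem_iUnion.1 hx
    have hres : ∀ m w, w ∈ W m → x ∈ wordCylinder w → PiNat.res x w.length ∈ W m :=
      fun m w hw hxw => by rwa [show PiNat.res x w.length = w from hxw]
    -- The shortest prefix of `x` that ever enters some `W m` stays from then on: only a proper
    -- ancestor could displace it, and that would be a shorter prefix.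
    have hex : {k | ∃ m, PiNat.res x k ∈ W m}.Nonempty := by
      obtain ⟨w, hw, hxw⟩ := mem_iUnion₂.1 (hcov n hn)
      exact ⟨_, n, hres n w hw hxw⟩
    obtain ⟨m, hm⟩ := Nat.sInf_mem hex
    refine mem_iUnion₂.2 ⟨PiNat.res x (sInf {k | ∃ m, PiNat.res x k ∈ W m}), ?_,
      mem_wordCylinder_res _ _⟩
    refine eventually_atTop.2 ⟨m, fun j hj => ?_⟩
    induction j, hj using Nat.le_induction with
    | base => exact hm
    | succ j _ ih =>
      obtain ⟨v, hv, hvs⟩ := exists_minimalWords (V := W j ∪ V (j + 1)) (Or.inl ih)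
      have hxv : x ∈ wordCylinder v := wordCylinder_anti hvs (mem_wordCylinder_res _ _)
      have hle : v.length ≤ sInf {k | ∃ m, PiNat.res x k ∈ W m} := by simpa using hvs.length_le
      have hge : sInf {k | ∃ m, PiNat.res x k ∈ W m} ≤ v.length :=
        Nat.sInf_le ⟨j + 1, hres (j + 1) v hv hxv⟩
      rw [← hle.antisymm hge]
      exact hres (j + 1) v hv hxv
  refine (wordContent_le hUcov).trans ?_
  rw [wordCost]
  rw [ENNReal.tsum_eq_iSup_sum]
  refine iSup_le fun s => ?_
  classical
  have hev : ∀ᶠ n in atTop, ∀ w ∈ s, w ∈ U → w ∈ W n :=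
    (Finset.eventually_all s).2 fun w _ => by
      by_cases hw : w ∈ U
      · filter_upwards [hw] with n hn _ using hn
      · exact Eventually.of_forall fun n h => absurd h hw
  obtain ⟨n, hn⟩ := hev.exists
  refine le_trans ?_ ((ENNReal.sum_le_tsum s).trans (hcost' n))
  refine Finset.sum_le_sum fun w hw => ?_
  by_cases hwU : w ∈ U
  · simp [hwU, hn w hw hwU]
  · simp [hwU]


/-- An open neighbourhood of a product of initial segments contains all the sequences that satisfy
finitely many of its constraints. -/
theorem exists_initial_constraints_subset {N : ℕ → ℕ} {O : Set (ℕ → ℕ)} (hO : IsOpen O)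
    (h : {x : ℕ → ℕ | ∀ i, x i ≤ N i} ⊆ O) : ∃ k, {x : ℕ → ℕ | ∀ i < k, x i ≤ N i} ⊆ O := by
  by_contra! hcon
  simp only [Set.not_subset] at hcon
  choose x hx hxO using hcon
  have hC : IsCompact {x : ℕ → ℕ | ∀ i, x i ≤ N i} := by
    have : {x : ℕ → ℕ | ∀ i, x i ≤ N i} = Set.pi univ fun i => Iic (N i) := by
      ext x; simp [Pi.le_def]
    rw [this]
    exact isCompact_univ_pi fun i => (finite_Iic _).isCompact
  -- Truncation at `N` moves the counterexamples into a compact set and leaves coordinate `i` of the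
  -- `k`-th one unchanged once `k > i`. The truncated and the original subsequences thus have the
  -- same limit.
  obtain ⟨y, hy, φ, hφ, hlim⟩ := hC.tendsto_subseq (x := fun k i => min (x k i) (N i))
    fun k i => min_le_right _ _
  have hlim' : Tendsto (fun k => x (φ k)) atTop (𝓝 y) := by
    rw [tendsto_pi_nhds] at hlim ⊢
    intro i
    refine (hlim i).congr' ?_
    filter_upwards [eventually_gt_atTop i] with k hk
    exact min_eq_left (hx (φ k) i (hk.trans_le (hφ.id_le k)))
  obtain ⟨k, hk⟩ := (hlim'.eventually (hO.mem_nhds (h hy))).exists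
  exact hxO _ hk

/-- Analytic sets are capacitable for the net content. -/
theorem exists_isCompact_subset_le_wordContent [TopologicalSpace α] [DiscreteTopology α]
    {q η : ℝ≥0∞} {A : Set (ℕ → α)} (hA : AnalyticSet A) (hη : η < wordContent q A) :
    ∃ F ⊆ A, IsCompact F ∧ η ≤ wordContent q F := by
  rw [AnalyticSet] at hA
  obtain rfl | ⟨f, hf, rfl⟩ := hA
  · simp [wordContent_empty] at hη
  -- Bounding one more coordinate by `m` exhausts the set as `m` grows, so continuity along
  -- increasing unions keeps the content above `η` for some `m`.
  have hstep : ∀ (k : ℕ) (S : {S : Set (ℕ → ℕ) // η < wordContent q (f '' S)}),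
      ∃ m, η < wordContent q (f '' (S.1 ∩ {x | x k ≤ m})) := by
    intro k S
    by_contra! hcon
    refine absurd S.2 (not_lt.2 ?_)
    have : f '' S.1 = ⋃ m, f '' (S.1 ∩ {x | x k ≤ m}) := by
      rw [← image_iUnion, ← inter_iUnion]
      congr 1
      rw [eq_comm, inter_eq_left]
      exact fun x _ => mem_iUnion.2 ⟨x k, le_refl (x k)⟩
    rw [this]
    refine wordContent_iUnion_le ?_ hcon
    intro m m' hm
    exact image_mono (inter_subset_inter_right _ fun x (hx : x k ≤ m) => hx.trans hm)
  choose g hg using hstep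
  let S : ℕ → {S : Set (ℕ → ℕ) // η < wordContent q (f '' S)} := fun n =>
    Nat.rec (motive := fun _ => {S : Set (ℕ → ℕ) // η < wordContent q (f '' S)})
      ⟨univ, by rwa [image_univ]⟩ (fun k S => ⟨_, hg k S⟩) n
  let N : ℕ → ℕ := fun k => g k (S k)
  have hS : ∀ k, (S k).1 = {x | ∀ i < k, x i ≤ N i} := by
    intro k
    induction k with
    | zero => ext x; simp [S]
    | succ k ih =>
      have : (S (k + 1)).1 = (S k).1 ∩ {x | x k ≤ N k} := rfl
      rw [this, ih]
      ext x
      simp only [mem_inter_iff, mem_ofPred_eq, Nat.lt_succ_iff_lt_or_eq]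
      constructor
      · rintro ⟨h1, h2⟩ i (hi | rfl)
        · exact h1 i hi
        · exact h2
      · exact fun h => ⟨fun i hi => h i (Or.inl hi), h k (Or.inr rfl)⟩
  have hC : IsCompact {x : ℕ → ℕ | ∀ i, x i ≤ N i} := by
    have : {x : ℕ → ℕ | ∀ i, x i ≤ N i} = Set.pi univ fun i => Iic (N i) := by
      ext x; simp [Pi.le_def]
    rw [this]
    exact isCompact_univ_pi fun i => (finite_Iic _).isCompact
  refine ⟨f '' {x | ∀ i, x i ≤ N i}, image_subset_range _ _, hC.image hf, ?_⟩
  by_contra! hlt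
  obtain ⟨V, hV, hVc⟩ := exists_wordCost_lt hlt
  -- A cover of the compact image has open preimage, so it already covers the image under finitely
  -- many constraints, whose content exceeds `η`.
  have hO : IsOpen (f ⁻¹' ⋃ w ∈ V, wordCylinder w) :=
    (isOpen_biUnion fun w _ => isOpen_wordCylinder w).preimage hf
  obtain ⟨k, hk⟩ := exists_initial_constraints_subset hO (image_subset_iff.1 hV)
  have h1 := (S k).2
  rw [hS] at h1
  exact absurd (h1.trans_le (wordContent_le (image_subset_iff.2 hk))) (not_lt.2 hVc.le)

/-- The mass distribution on words that splits the mass of each word in proportion to the net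
contents of the parts of `F` in its children. -/
noncomputable def wordMass [Fintype α] (q : ℝ≥0∞) (F : Set (ℕ → α)) : List α → ℝ≥0∞
  | [] => 1
  | a :: w => wordMass q F w * (wordContent q (F ∩ wordCylinder (a :: w)) /
      ∑ b, wordContent q (F ∩ wordCylinder (b :: w)))

/-- The sequence that begins with `w` and continues with a constant letter. -/
noncomputable def extendWord [Nonempty α] (w : List α) : ℕ → α := fun n =>
  w.reverse.getD n (Classical.arbitrary α)

theorem extendWord_mem [Nonempty α] (w : List α) : extendWord w ∈ wordCylinder w := by
  have key : ∀ n ≤ w.length, PiNat.res (extendWord w) n = w.drop (w.length - n) := by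
    intro n hn
    induction n with
    | zero => simp
    | succ n ih =>
      have hlt : w.length - (n + 1) < w.length := by omega
      rw [PiNat.res_succ, ih (by omega), List.drop_eq_getElem_cons hlt]
      congr 1
      · simp only [extendWord]
        rw [List.getD_eq_getElem _ _ (by simp; omega), List.getElem_reverse]
        congr 1
        omega
      · congr 1
        omega
  simpa [wordCylinder] using key w.length le_rfl

/-! ### Mass distribution on the tree of words. -/

section Mass

variable [Fintype α] {q : ℝ≥0∞} {F : Set (ℕ → α)}

theorem wordContent_inter_cylinder_le_sum (q : ℝ≥0∞) (F : Set (ℕ → α)) (w : List α) :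
    wordContent q (F ∩ wordCylinder w) ≤ ∑ b, wordContent q (F ∩ wordCylinder (b :: w)) := by
  have : F ∩ wordCylinder w = ⋃ b ∈ Finset.univ, F ∩ wordCylinder (b :: w) := by
    rw [wordCylinder_eq_iUnion_cons, inter_iUnion]
    simp
  rw [this]
  exact wordContent_biUnion_finset_le _ _ _

/-- Subadditivity: the contents of the children add up to at least the content of the parent, so
proportional splitting preserves the ratio bound. -/
theorem wordMass_le (hF : wordContent q F ≠ 0) (w : List α) :
    wordMass q F w ≤ wordContent q (F ∩ wordCylinder w) / wordContent q F := by
  induction w with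
  | nil => simp [wordMass, wordCylinder_nil, ENNReal.div_self hF (wordContent_ne_top q F)]
  | cons a w ih =>
    rw [wordMass]
    set T := ∑ b, wordContent q (F ∩ wordCylinder (b :: w)) with hT
    have hle := wordContent_inter_cylinder_le_sum q F w
    calc wordMass q F w * (wordContent q (F ∩ wordCylinder (a :: w)) / T)
        ≤ (T / wordContent q F) * (wordContent q (F ∩ wordCylinder (a :: w)) / T) := by
          gcongr
          exact ih.trans (ENNReal.div_le_div_right hle _)
      _ = (T / T) * (wordContent q (F ∩ wordCylinder (a :: w)) / wordContent q F) := by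
          simp only [div_eq_mul_inv]; ring
      _ ≤ 1 * (wordContent q (F ∩ wordCylinder (a :: w)) / wordContent q F) := by
          gcongr
          exact ENNReal.div_self_le_one
      _ = _ := one_mul _

theorem sum_wordMass_cons (hF : wordContent q F ≠ 0) (w : List α) :
    ∑ a, wordMass q F (a :: w) = wordMass q F w := by
  simp only [wordMass, ← Finset.mul_sum, div_eq_mul_inv, ← Finset.sum_mul]
  set T := ∑ b, wordContent q (F ∩ wordCylinder (b :: w)) with hT
  -- If all children have zero content, the quotients are `0 / 0 = 0`. No mass is lost, as the
  -- parent then has mass zero.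
  by_cases h0 : T = 0
  · have h1 : wordContent q (F ∩ wordCylinder w) = 0 :=
      le_antisymm ((wordContent_inter_cylinder_le_sum q F w).trans h0.le) bot_le
    have h2 : wordMass q F w = 0 := by
      simpa [h1] using wordMass_le hF w
    simp [h2]
  · rw [ENNReal.mul_inv_cancel h0, mul_one]
    exact (ENNReal.sum_lt_top.2 fun b _ => (wordContent_ne_top _ _).lt_top).ne

variable [Nonempty α]

variable [MeasurableSpace α]

/-- The discrete measure with mass `wordMass q F v` in each cylinder of length `n`. -/
noncomputable def wordMeasure (q : ℝ≥0∞) (F : Set (ℕ → α)) (n : ℕ) : Measure (ℕ → α) :=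
  ∑ v : List.Vector α n, wordMass q F v.toList • Measure.dirac (extendWord v.toList)

/-- Induction from depth `n` upwards: at full depth exactly one Dirac mass lies in the cylinder, and
above it the masses of the children add up. -/
theorem wordMeasure_cylinder [TopologicalSpace α] [DiscreteTopology α] [BorelSpace (ℕ → α)]
    (hF : wordContent q F ≠ 0) (n : ℕ) (w : List α)
    (hw : w.length ≤ n) : wordMeasure q F n (wordCylinder w) = wordMass q F w := by
  have hmeas : ∀ w : List α, MeasurableSet (wordCylinder w) := fun w =>
    (isOpen_wordCylinder w).measurableSet
  induction h : n - w.length generalizing w with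
  | zero =>
    have hn : w.length = n := by omega
    rw [wordMeasure, Measure.finsetSum_apply, Finset.sum_eq_single ⟨w, hn⟩]
    · simp [Measure.dirac_apply' _ (hmeas w), extendWord_mem]
    · intro v _ hv
      have hdis : extendWord v.toList ∉ wordCylinder w :=
        (disjoint_wordCylinder (v := v.toList) (w := w) (by simp [hn])
          fun he => hv (Subtype.ext he)).notMem_of_mem_left (extendWord_mem _)
      simp [Measure.dirac_apply' _ (hmeas w), hdis]
    · exact fun h => absurd (Finset.mem_univ _) h
  | succ k ih =>
    rw [wordCylinder_eq_iUnion_cons, measure_iUnion _ fun a => hmeas _, tsum_fintype,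
      ← sum_wordMass_cons hF]
    · refine Finset.sum_congr rfl fun a _ => ih _ ?_ ?_ <;> simp <;> omega
    · intro a b hab
      exact disjoint_wordCylinder (by simp) (by simpa using hab)

/-- **Frostman's lemma** on a space of sequences: a closed set of positive net content carries
a probability measure that is controlled by the net content on cylinders. -/
theorem exists_measure_wordCylinder_le [TopologicalSpace α] [DiscreteTopology α]
    [BorelSpace (ℕ → α)] (hFcl : IsClosed F) (hF : wordContent q F ≠ 0) :
    ∃ μ : Measure (ℕ → α), IsProbabilityMeasure μ ∧ μ Fᶜ = 0 ∧
      ∀ w, μ (wordCylinder w) ≤ q ^ w.length / wordContent q F := by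
  have hprob : ∀ n, IsProbabilityMeasure (wordMeasure q F n) := fun n =>
    ⟨by simpa [wordCylinder_nil, wordMass] using wordMeasure_cylinder hF n [] (by simp)⟩
  let ν : ℕ → ProbabilityMeasure (ℕ → α) := fun n => ⟨wordMeasure q F n, hprob n⟩
  -- With finitely many letters the sequence space is compact, and so is its space of probability
  -- measures; an ultrafilter limit replaces a convergent subsequence. Cylinders are clopen, so
  -- their masses pass to the limit.
  let L : Ultrafilter ℕ := Filter.hyperfilter ℕ
  let μ : ProbabilityMeasure (ℕ → α) := (L.map ν).lim
  have hlim : Tendsto ν L (𝓝 μ) := (L.map ν).le_nhds_lim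
  have hcyl : ∀ w, (μ : Measure (ℕ → α)) (wordCylinder w) = wordMass q F w := by
    intro w
    have h1 := ProbabilityMeasure.tendsto_measure_of_null_frontier_of_tendsto' hlim
      (E := wordCylinder w)
      (by simp [IsClopen.frontier_eq ⟨isClosed_wordCylinder w, isOpen_wordCylinder w⟩])
    refine tendsto_nhds_unique h1 (tendsto_const_nhds.congr' ?_)
    have : ∀ᶠ n in (L : Filter ℕ), w.length ≤ n :=
      (Nat.hyperfilter_le_atTop) (eventually_ge_atTop w.length)
    filter_upwards [this] with n hn
    exact (wordMeasure_cylinder hF n w hn).symm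
  refine ⟨μ, inferInstance, ?_, fun w => ?_⟩
  -- The complement of `F` is a countable union of cylinders that miss `F`, each of mass zero by
  -- `wordMass_le`.
  · have hcov : Fᶜ ⊆ ⋃ w ∈ {w : List α | F ∩ wordCylinder w = ∅}, wordCylinder w := by
      intro x hx
      have hx' : Fᶜ ∈ 𝓝 x := hFcl.isOpen_compl.mem_nhds hx
      obtain ⟨u, hu, hux⟩ :=
        (PiNat.isTopologicalBasis_cylinders (fun _ : ℕ => α)).mem_nhds_iff.1 hx'
      obtain ⟨⟨y, n, rfl⟩, hxu⟩ := And.intro hu hux.1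
      have hsub : wordCylinder (PiNat.res x n) ⊆ PiNat.cylinder y n := by
        rw [PiNat.mem_cylinder_iff_eq] at hxu
        rw [← hxu, PiNat.cylinder_eq_res]
        intro z hz
        simpa [wordCylinder] using hz
      refine mem_iUnion₂.2 ⟨PiNat.res x n, ?_, mem_wordCylinder_res _ _⟩
      change F ∩ _ = ∅
      rw [← disjoint_iff_inter_eq_empty]
      exact (disjoint_compl_right (a := F)).mono_right (hsub.trans hux.2)
    refine measure_mono_null hcov ((measure_biUnion_null_iff (to_countable _)).2 fun w hw => ?_)
    rw [hcyl]
    have := wordMass_le hF w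
    rw [show F ∩ wordCylinder w = ∅ from hw, wordContent_empty] at this
    simpa using this
  · rw [hcyl]
    exact (wordMass_le hF w).trans
      (ENNReal.div_le_div_right (wordContent_le_pow inter_subset_right) _)

end Mass

end WordContent


/-! ### Dyadic coding of the unit cube and Frostman's lemma. -/

section Frostman

open Filter Topology

variable {d : ℕ}

/-- The point of the unit cube whose coordinates have the given binary digits. -/
noncomputable def binaryPoint (x : ℕ → Fin d → Fin 2) : EuclideanSpace ℝ (Fin d) :=
  WithLp.toLp 2 fun i => Real.ofDigits fun n => x n i

theorem binaryPoint_apply (x : ℕ → Fin d → Fin 2) (i : Fin d) :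
    binaryPoint x i = Real.ofDigits fun n => x n i := rfl

theorem continuous_binaryPoint : Continuous (binaryPoint (d := d)) := by
  refine (PiLp.continuous_toLp 2 _).comp (continuous_pi fun i => ?_)
  exact Real.continuous_ofDigits.comp
    (continuous_pi fun n => (continuous_apply i).comp (continuous_apply n))

theorem exists_binaryPoint_eq {z : EuclideanSpace ℝ (Fin d)} (hz : ∀ i, z i ∈ Icc (0 : ℝ) 1) :
    ∃ x, binaryPoint x = z := by
  choose y hy using fun i => Real.ofDigits_SurjOn (b := 2) one_lt_two (hz i)
  refine ⟨fun n i => y i n, ?_⟩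
  ext i
  exact (hy i).2

/-- The numerators of the corner of the dyadic cube that belongs to a word. -/
def wordCorner : List (Fin d → Fin 2) → Fin d → ℤ
  | [], _ => 0
  | a :: w, i => 2 * wordCorner w i + ((a i : ℕ) : ℤ)

theorem wordCorner_injective {v w : List (Fin d → Fin 2)} (h : v.length = w.length)
    (hc : wordCorner v = wordCorner w) : v = w := by
  induction v generalizing w with
  | nil => exact (List.length_eq_zero_iff.1 h.symm).symm
  | cons a v ih =>
    cases w with
    | nil => simp at h
    | cons b w =>
      have key : ∀ i, wordCorner v i = wordCorner w i ∧ a i = b i := by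
        intro i
        have h1 := congrFun hc i
        simp only [wordCorner] at h1
        have ha := (a i).isLt
        have hb := (b i).isLt
        refine ⟨by omega, Fin.ext (by omega)⟩
      rw [ih (by simpa using h) (funext fun i => (key i).1), funext fun i => (key i).2]

/-- The first `n` digits form the integer corner and the remaining digits are again a binary
expansion `t`. The value `t = 1` occurs, so the coded cubes are closed. -/
theorem binaryPoint_apply_eq (x : ℕ → Fin d → Fin 2) (n : ℕ) (i : Fin d) :
    ∃ t ∈ Icc (0 : ℝ) 1, 2 ^ n * binaryPoint x i = wordCorner (PiNat.res x n) i + t := by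
  refine ⟨Real.ofDigits fun j => x (j + n) i,
    ⟨Real.ofDigits_nonneg _, Real.ofDigits_le_one _⟩, ?_⟩
  have hsum : (2 : ℝ) ^ n * ∑ j ∈ Finset.range n, Real.ofDigitsTerm (fun n => x n i) j =
      wordCorner (PiNat.res x n) i := by
    induction n with
    | zero => simp [wordCorner]
    | succ n ih =>
      rw [Finset.sum_range_succ, mul_add, pow_succ, mul_right_comm, ih]
      simp only [PiNat.res_succ, wordCorner, Real.ofDigitsTerm]
      push_cast
      field_simp
      ring
  rw [binaryPoint_apply, Real.ofDigits_eq_sum_add_ofDigits _ n, mul_add, hsum]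
  push_cast
  rw [← mul_assoc, mul_inv_cancel₀ (by positivity), one_mul]

theorem ediam_image_wordCylinder_le :
    ∃ D : NNReal, ∀ w : List (Fin d → Fin 2),
      Metric.ediam (binaryPoint '' wordCylinder w) ≤ D * (2 : ℝ≥0∞)⁻¹ ^ w.length := by
  obtain ⟨D, hDL⟩ : ∃ D : NNReal,
      LipschitzWith D (WithLp.toLp 2 : (Fin d → ℝ) → EuclideanSpace ℝ (Fin d)) :=
    ⟨_, PiLp.lipschitzWith_toLp 2 (fun _ : Fin d => ℝ)⟩
  refine ⟨D, fun w => Metric.ediam_le ?_⟩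
  rintro _ ⟨x, hx, rfl⟩ _ ⟨y, hy, rfl⟩
  have hL := hDL (fun i => Real.ofDigits fun n => x n i) (fun i => Real.ofDigits fun n => y n i)
  refine hL.trans ?_
  gcongr
  rw [edist_pi_le_iff]
  intro i
  have hxy : ∀ j < w.length, x j i = y j i := by
    have : PiNat.res x w.length = PiNat.res y w.length :=
      (show PiNat.res x w.length = w from hx).trans (show PiNat.res y w.length = w from hy).symm
    intro j hj
    rw [PiNat.res_eq_res.1 this hj]
  have h1 := Real.abs_ofDigits_sub_ofDigits_le (x := fun n => x n i) (y := fun n => y n i) hxy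
  rw [edist_dist, Real.dist_eq]
  refine (ENNReal.ofReal_le_ofReal h1).trans (le_of_eq ?_)
  rw [ENNReal.ofReal_inv_of_pos (by positivity), ENNReal.ofReal_pow (by positivity),
    ENNReal.inv_pow]
  simp

theorem pow_two_rpow_neg (s : ℝ) (n : ℕ) :
    ((2 : ℝ≥0∞) ^ (-s)) ^ n = ((2 : ℝ≥0∞)⁻¹ ^ n) ^ s := by
  rw [ENNReal.rpow_neg, ← ENNReal.inv_rpow, ← ENNReal.rpow_natCast, ← ENNReal.rpow_natCast,
    ← ENNReal.rpow_mul, ← ENNReal.rpow_mul, mul_comm]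

/-- A set whose preimage under the binary expansion has zero net content is a null set for the
Hausdorff measure. -/
theorem hausdorffMeasure_eq_zero_of_wordContent {s : ℝ} (hs : 0 < s)
    {E : Set (EuclideanSpace ℝ (Fin d))} (hE : ∀ x ∈ E, ∀ i, x i ∈ Icc (0 : ℝ) 1)
    (h : wordContent ((2 : ℝ≥0∞) ^ (-s)) (binaryPoint ⁻¹' E) = 0) :
    Measure.hausdorffMeasure s E = 0 := by
  obtain ⟨D, hD⟩ := ediam_image_wordCylinder_le (d := d)
  set q := (2 : ℝ≥0∞) ^ (-s) with hq
  let ε : ℕ → ℝ≥0∞ := fun n => (n : ℝ≥0∞)⁻¹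
  have hε0 : ∀ n, 0 < ε n := fun n => by simp [ε]
  have hεlim : Tendsto ε atTop (𝓝 0) := ENNReal.tendsto_inv_nat_nhds_zero
  choose V hVcov hVcost using fun n => exists_wordCost_lt (h.trans_lt (hε0 n))
  have hpow : ∀ w : List (Fin d → Fin 2),
      Metric.ediam (binaryPoint '' wordCylinder w) ^ s ≤ (D : ℝ≥0∞) ^ s * q ^ w.length := by
    intro w
    rw [hq, pow_two_rpow_neg, ← ENNReal.mul_rpow_of_nonneg _ _ hs.le]
    exact ENNReal.rpow_le_rpow (hD w) hs.le
  -- A single word costs no more than the whole cover, so covers of small cost automatically consist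
  -- of small cubes, as Hausdorff measure requires.
  have hcost : ∀ n (w : V n), q ^ (w : List (Fin d → Fin 2)).length ≤ ε n := by
    intro n w
    refine le_trans ?_ (hVcost n).le
    refine le_trans (le_of_eq ?_) (ENNReal.le_tsum (w : List (Fin d → Fin 2)))
    simp
  have key := Measure.hausdorffMeasure_le_liminf_tsum s E (l := atTop)
    (ι := fun n => V n) (fun n => ((D : ℝ≥0∞) ^ s * ε n) ^ (1 / s)) ?_
    (fun n w => binaryPoint '' wordCylinder (w : List (Fin d → Fin 2))) ?_ ?_
  · refine le_antisymm (key.trans ?_) bot_le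
    have h1 : ∀ n, ∑' w : V n, Metric.ediam
        (binaryPoint '' wordCylinder (w : List (Fin d → Fin 2))) ^ s ≤ (D : ℝ≥0∞) ^ s * ε n := by
      intro n
      calc _ ≤ ∑' w : V n, (D : ℝ≥0∞) ^ s * q ^ (w : List (Fin d → Fin 2)).length :=
            ENNReal.tsum_le_tsum fun w => hpow w
        _ = (D : ℝ≥0∞) ^ s * wordCost q (V n) := by
            rw [ENNReal.tsum_mul_left, wordCost, ← tsum_subtype]
        _ ≤ _ := by gcongr; exact (hVcost n).le
    have h2 : Tendsto (fun n => (D : ℝ≥0∞) ^ s * ε n) atTop (𝓝 0) := by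
      have := ENNReal.Tendsto.const_mul hεlim
        (Or.inr (ENNReal.rpow_ne_top_of_nonneg hs.le (ENNReal.coe_ne_top (r := D))))
      simpa using this
    calc _ ≤ liminf (fun n => (D : ℝ≥0∞) ^ s * ε n) atTop :=
          liminf_le_liminf (Eventually.of_forall h1)
      _ = 0 := h2.liminf_eq
  · have h2 : Tendsto (fun n => (D : ℝ≥0∞) ^ s * ε n) atTop (𝓝 0) := by
      have := ENNReal.Tendsto.const_mul hεlim
        (Or.inr (ENNReal.rpow_ne_top_of_nonneg hs.le (ENNReal.coe_ne_top (r := D))))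
      simpa using this
    have h3 := (ENNReal.continuous_rpow_const (y := 1 / s)).continuousAt.tendsto.comp h2
    rw [ENNReal.zero_rpow_of_pos (by positivity)] at h3
    exact h3
  · refine Eventually.of_forall fun n w => ?_
    rw [one_div, ENNReal.le_rpow_inv_iff hs]
    exact (hpow w).trans (by gcongr; exact hcost n w)
  · refine Eventually.of_forall fun n z hz => ?_
    obtain ⟨x, rfl⟩ := exists_binaryPoint_eq (hE z hz)
    obtain ⟨w, hw, hxw⟩ := mem_iUnion₂.1 (hVcov n hz)
    exact mem_iUnion.2 ⟨⟨w, hw⟩, mem_image_of_mem _ hxw⟩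

/-- The words of length `n` whose dyadic cubes meet a ball of radius at most `2 ^ (-n)` are
few. -/
theorem exists_finset_words_cover (z : EuclideanSpace ℝ (Fin d)) {r : ℝ} {n : ℕ}
    (hr : r * 2 ^ n ≤ 1) :
    ∃ T : Finset (List (Fin d → Fin 2)), (∀ w ∈ T, w.length = n) ∧ T.card ≤ 4 ^ d ∧
      binaryPoint ⁻¹' Metric.closedBall z r ⊆ ⋃ w ∈ T, wordCylinder w := by
  classical
  -- A corner differs from `2 ^ n * x i` by at most `1` downwards, and that number from `2 ^ n * z
  -- i` by at most `1`. The corner lies in an interval of length `3`, which holds at most four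
  -- integers.
  let box : Finset (Fin d → ℤ) :=
    Fintype.piFinset fun i => Finset.Icc ⌈2 ^ n * z i - 2⌉ ⌊2 ^ n * z i + 1⌋
  have hbox : box.card ≤ 4 ^ d := by
    rw [Fintype.card_piFinset]
    refine (Finset.prod_le_pow_card _ _ 4 fun i _ => ?_).trans (by simp)
    rw [Int.card_Icc]
    have h1 := Int.le_ceil (2 ^ n * z i - 2)
    have h2 := Int.floor_le (2 ^ n * z i + 1)
    have h3 : ((⌊2 ^ n * z i + 1⌋ + 1 - ⌈2 ^ n * z i - 2⌉ : ℤ) : ℝ) ≤ 4 := by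
      push_cast; linarith
    have h4 : ⌊2 ^ n * z i + 1⌋ + 1 - ⌈2 ^ n * z i - 2⌉ ≤ 4 := by exact_mod_cast h3
    omega
  let S : Set (List (Fin d → Fin 2)) := {w | w.length = n ∧ wordCorner w ∈ box}
  have hinj : InjOn (wordCorner (d := d)) S := fun v hv w hw h =>
    wordCorner_injective (hv.1.trans hw.1.symm) h
  have hfin : S.Finite := Set.Finite.of_finite_image
    (box.finite_toSet.subset (image_subset_iff.2 fun w hw => hw.2)) hinj
  refine ⟨hfin.toFinset, fun w hw => ((hfin.mem_toFinset).1 hw).1, ?_, ?_⟩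
  · refine le_trans ?_ hbox
    refine Finset.card_le_card_of_injOn wordCorner ?_ ?_
    · intro w hw
      exact ((hfin.mem_toFinset).1 hw).2
    · simpa using hinj
  · intro x hx
    refine mem_iUnion₂.2 ⟨PiNat.res x n, ?_, mem_wordCylinder_res _ _⟩
    refine (hfin.mem_toFinset).2 ⟨by simp, ?_⟩
    rw [Fintype.mem_piFinset]
    intro i
    obtain ⟨t, ht, hxt⟩ := binaryPoint_apply_eq x n i
    have hxz : |binaryPoint x i - z i| ≤ r := by
      have h1 := PiLp.norm_apply_le (binaryPoint x - z) i
      rw [← dist_eq_norm] at h1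
      simpa using h1.trans (Metric.mem_closedBall.1 hx)
    have h2 : |2 ^ n * binaryPoint x i - 2 ^ n * z i| ≤ 1 := by
      rw [← mul_sub, abs_mul, abs_of_pos (by positivity : (0 : ℝ) < 2 ^ n), mul_comm]
      exact (mul_le_mul_of_nonneg_right hxz (by positivity)).trans hr
    rw [abs_le] at h2
    rw [Finset.mem_Icc, Int.ceil_le, Int.le_floor]
    constructor <;> linarith [ht.1, ht.2, h2.1, h2.2]

/-- **Frostman's lemma** for Borel subsets of the unit cube. -/
theorem exists_frostman_measure {E : Set (EuclideanSpace ℝ (Fin d))} (hEm : MeasurableSet E)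
    (hE : ∀ x ∈ E, ∀ i, x i ∈ Icc (0 : ℝ) 1) {s : ℝ} (hs : 0 < s)
    (hdim : ENNReal.ofReal s < dimH E) :
    ∃ μ : Measure (EuclideanSpace ℝ (Fin d)), IsProbabilityMeasure μ ∧ μ Eᶜ = 0 ∧
      ∃ C : ℝ, 0 ≤ C ∧ ∀ x r, 0 < r → μ (Metric.closedBall x r) ≤ ENNReal.ofReal (C * r ^ s) := by
  set q := (2 : ℝ≥0∞) ^ (-s) with hq
  have hc : wordContent q (binaryPoint ⁻¹' E) ≠ 0 := by
    intro h0
    have h1 := hausdorffMeasure_eq_zero_of_wordContent hs hE h0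
    have h2 := hausdorffMeasure_of_lt_dimH (d := s.toNNReal) (s := E) hdim
    rw [Real.coe_toNNReal s hs.le, h1] at h2
    exact ENNReal.zero_ne_top h2
  have han : AnalyticSet (binaryPoint ⁻¹' E) :=
    (continuous_binaryPoint.measurable hEm).analyticSet
  obtain ⟨η, hη0, hη⟩ := exists_between (pos_iff_ne_zero.2 hc)
  obtain ⟨F, hFE, hFc, hFη⟩ := exists_isCompact_subset_le_wordContent han hη
  have hF0 : wordContent q F ≠ 0 := (hη0.trans_le hFη).ne'
  obtain ⟨ν, hν, hνF, hνw⟩ := exists_measure_wordCylinder_le hFc.isClosed hF0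
  have hmeas := continuous_binaryPoint (d := d) |>.measurable
  refine ⟨ν.map binaryPoint, Measure.isProbabilityMeasure_map hmeas.aemeasurable, ?_, ?_⟩
  · rw [Measure.map_apply hmeas hEm.compl]
    exact measure_mono_null (compl_subset_compl.2 hFE) hνF
  set c := (wordContent q F).toReal with hcdef
  have hcpos : 0 < c := ENNReal.toReal_pos hF0 (wordContent_ne_top _ _)
  -- The entry `1` serves radii above `1`, where total mass one is bound enough. For smaller radii
  -- at most `4 ^ d` cubes of side below `2 * r` meet the ball.
  refine ⟨max 1 (4 ^ d * 2 ^ s / c), by positivity, fun z r hr => ?_⟩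
  rw [Measure.map_apply hmeas Metric.isClosed_closedBall.measurableSet]
  rcases le_or_gt r 1 with hr1 | hr1
  · obtain ⟨n, hn1, hn2⟩ : ∃ n : ℕ, r * 2 ^ n ≤ 1 ∧ 1 < r * 2 ^ (n + 1) := by
      obtain ⟨n, hn1, hn2⟩ := exists_nat_pow_near (one_le_inv₀ hr |>.2 hr1) (one_lt_two)
      refine ⟨n, ?_, ?_⟩
      · calc r * 2 ^ n ≤ r * r⁻¹ := by gcongr
          _ = 1 := mul_inv_cancel₀ hr.ne'
      · rw [inv_lt_iff_one_lt_mul₀ hr] at hn2; linarith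
    obtain ⟨T, hTl, hTc, hT⟩ := exists_finset_words_cover z hn1
    have hq1 : q ^ n ≤ ENNReal.ofReal ((2 * r) ^ s) := by
      rw [hq, pow_two_rpow_neg, ← ENNReal.ofReal_rpow_of_pos (by positivity)]
      refine ENNReal.rpow_le_rpow ?_ hs.le
      rw [← ENNReal.inv_pow, ENNReal.inv_le_iff_le_mul (by simp) (by simp)]
      rw [← ENNReal.ofReal_ofNat, ← ENNReal.ofReal_pow (by positivity),
        ← ENNReal.ofReal_mul (by positivity), ← ENNReal.ofReal_one]
      apply ENNReal.ofReal_le_ofReal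
      rw [pow_succ] at hn2; linarith
    calc ν (binaryPoint ⁻¹' Metric.closedBall z r)
        ≤ ν (⋃ w ∈ T, wordCylinder w) := measure_mono hT
      _ ≤ ∑ w ∈ T, ν (wordCylinder w) := measure_biUnion_finset_le _ _
      _ ≤ ∑ w ∈ T, q ^ n / wordContent q F :=
          Finset.sum_le_sum fun w hw => by simpa [hTl w hw] using hνw w
      _ = T.card * (q ^ n / wordContent q F) := by simp
      _ ≤ (4 ^ d : ℕ) * (ENNReal.ofReal ((2 * r) ^ s) / ENNReal.ofReal c) := by
          rw [hcdef, ENNReal.ofReal_toReal (wordContent_ne_top _ _)]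
          gcongr
      _ = ENNReal.ofReal (4 ^ d * 2 ^ s / c * r ^ s) := by
          rw [← ENNReal.ofReal_div_of_pos hcpos, ← ENNReal.ofReal_natCast,
            ← ENNReal.ofReal_mul (by positivity), Real.mul_rpow (by positivity) hr.le]
          congr 1
          push_cast
          ring
      _ ≤ _ := by
          apply ENNReal.ofReal_le_ofReal
          gcongr
          exact le_max_right _ _
  · refine prob_le_one.trans ?_
    rw [← ENNReal.ofReal_one]
    apply ENNReal.ofReal_le_ofReal
    calc (1 : ℝ) ≤ 1 * r ^ s := by rw [one_mul]; exact Real.one_le_rpow hr1.le hs.le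
      _ ≤ _ := by gcongr; exact le_max_left _ _

end Frostman


/-! ### Fourier transforms of finite measures and Gaussian regularisation. -/

section FourierMeasure

open Filter Topology ComplexConjugate

variable {d : ℕ}

theorem fourierMeasure_eq_charFun (μ : Measure (EuclideanSpace ℝ (Fin d)))
    (ξ : EuclideanSpace ℝ (Fin d)) :
    fourierMeasure μ ξ = charFun μ ((-2 * Real.pi) • ξ) := by
  rw [fourierMeasure, charFun_apply]
  congr 1
  ext x
  rw [inner_smul_right]
  congr 1
  push_cast
  ring

theorem continuous_fourierMeasure (μ : Measure (EuclideanSpace ℝ (Fin d))) [IsFiniteMeasure μ] :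
    Continuous (fourierMeasure μ) := by
  refine continuous_of_dominated (bound := fun _ => 1) ?_ ?_ (integrable_const _) ?_
  · intro ξ
    apply Continuous.aestronglyMeasurable
    fun_prop
  · intro ξ
    refine ae_of_all _ fun x => le_of_eq ?_
    rw [Complex.norm_exp]
    simp
  · refine ae_of_all _ fun x => ?_
    fun_prop

theorem fourierMeasure_conv (μ ν : Measure (EuclideanSpace ℝ (Fin d))) [IsFiniteMeasure μ]
    [IsFiniteMeasure ν] (ξ : EuclideanSpace ℝ (Fin d)) :
    fourierMeasure (μ ∗ ν) ξ = fourierMeasure μ ξ * fourierMeasure ν ξ := by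
  simp only [fourierMeasure_eq_charFun, charFun_conv]

theorem fourierMeasure_map_smul (μ : Measure (EuclideanSpace ℝ (Fin d))) (t : ℝ)
    (ξ : EuclideanSpace ℝ (Fin d)) :
    fourierMeasure (μ.map (t • ·)) ξ = fourierMeasure μ (t • ξ) := by
  simp only [fourierMeasure_eq_charFun, charFun_map_smul, smul_comm t]

theorem fourierMeasure_neg (μ : Measure (EuclideanSpace ℝ (Fin d)))
    (ξ : EuclideanSpace ℝ (Fin d)) :
    fourierMeasure μ (-ξ) = conj (fourierMeasure μ ξ) := by
  simp only [fourierMeasure_eq_charFun, smul_neg, charFun_neg]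

theorem enorm_fourierMeasure_neg (μ : Measure (EuclideanSpace ℝ (Fin d)))
    (ξ : EuclideanSpace ℝ (Fin d)) :
    ‖fourierMeasure μ (-ξ)‖ₑ = ‖fourierMeasure μ ξ‖ₑ := by
  rw [fourierMeasure_neg, ← ofReal_norm, ← ofReal_norm, RCLike.norm_conj]

theorem enorm_fourierMeasure_le (μ : Measure (EuclideanSpace ℝ (Fin d))) [IsFiniteMeasure μ]
    (ξ : EuclideanSpace ℝ (Fin d)) : ‖fourierMeasure μ ξ‖ₑ ≤ μ univ := by
  rw [fourierMeasure_eq_charFun, ← ofReal_norm]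
  refine (ENNReal.ofReal_le_ofReal (norm_charFun_le _)).trans ?_
  simp

/-- The difference measure `μ ∗ ν⁻`: the law of `x - y` under `μ × ν`. -/
noncomputable def diffMeasure (μ ν : Measure (EuclideanSpace ℝ (Fin d))) :
    Measure (EuclideanSpace ℝ (Fin d)) := μ ∗ (ν.map ((-1 : ℝ) • ·))

instance (μ ν : Measure (EuclideanSpace ℝ (Fin d))) [IsFiniteMeasure μ] [IsFiniteMeasure ν] :
    IsFiniteMeasure (diffMeasure μ ν) := by
  unfold diffMeasure; infer_instance

theorem lintegral_diffMeasure (μ ν : Measure (EuclideanSpace ℝ (Fin d))) [IsFiniteMeasure μ]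
    [IsFiniteMeasure ν] {f : EuclideanSpace ℝ (Fin d) → ℝ≥0∞} (hf : Measurable f) :
    ∫⁻ z, f z ∂(diffMeasure μ ν) = ∫⁻ x, ∫⁻ y, f (x - y) ∂ν ∂μ := by
  rw [diffMeasure, Measure.lintegral_conv hf]
  refine lintegral_congr fun x => ?_
  rw [lintegral_map (by fun_prop) (by fun_prop)]
  simp [sub_eq_add_neg]

theorem fourierMeasure_diffMeasure (μ ν : Measure (EuclideanSpace ℝ (Fin d))) [IsFiniteMeasure μ]
    [IsFiniteMeasure ν] (ξ : EuclideanSpace ℝ (Fin d)) :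
    fourierMeasure (diffMeasure μ ν) ξ = fourierMeasure μ ξ * conj (fourierMeasure ν ξ) := by
  rw [diffMeasure, fourierMeasure_conv, fourierMeasure_map_smul, neg_one_smul, fourierMeasure_neg]

theorem fourierMeasure_diffMeasure_self (μ : Measure (EuclideanSpace ℝ (Fin d)))
    [IsFiniteMeasure μ] (ξ : EuclideanSpace ℝ (Fin d)) :
    fourierMeasure (diffMeasure μ μ) ξ = ((‖fourierMeasure μ ξ‖ ^ 2 : ℝ) : ℂ) := by
  rw [fourierMeasure_diffMeasure, Complex.mul_conj']
  push_cast
  rfl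

/-- The `L¹`-normalised Gaussian at scale `R⁻¹`. -/
noncomputable def gaussKernel (R : ℝ) (z : EuclideanSpace ℝ (Fin d)) : ℝ :=
  R ^ d * Real.exp (-(Real.pi * R ^ 2 * ‖z‖ ^ 2))

theorem gaussKernel_nonneg {R : ℝ} (hR : 0 < R) (z : EuclideanSpace ℝ (Fin d)) :
    0 ≤ gaussKernel R z := by
  unfold gaussKernel; positivity

theorem continuous_gaussKernel (R : ℝ) : Continuous (gaussKernel (d := d) R) := by
  unfold gaussKernel; fun_prop

theorem integral_gauss_mul_exp {R : ℝ} (hR : 0 < R) (z : EuclideanSpace ℝ (Fin d)) :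
    ∫ ξ : EuclideanSpace ℝ (Fin d), Complex.exp (-(Real.pi / R ^ 2 : ℝ) * ‖ξ‖ ^ 2) *
      Complex.exp (-2 * Real.pi * Complex.I * ((inner ℝ z ξ : ℝ) : ℂ)) = gaussKernel R z := by
  have hb : 0 < ((Real.pi / R ^ 2 : ℝ) : ℂ).re := by
    rw [Complex.ofReal_re]; positivity
  have h := GaussianFourier.integral_cexp_neg_mul_sq_norm_add hb (-2 * Real.pi * Complex.I) z
  simp only [Complex.exp_add] at h
  rw [h, gaussKernel]
  have hR0 : (R : ℂ) ≠ 0 := by exact_mod_cast hR.ne'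
  have hpi : (Real.pi : ℂ) ≠ 0 := by exact_mod_cast Real.pi_ne_zero
  push_cast
  congr 1
  · rw [div_div_cancel₀ hpi, finrank_euclideanSpace_fin]
    rw [← Complex.ofReal_pow, ← Complex.ofReal_natCast, ← Complex.ofReal_ofNat,
      ← Complex.ofReal_div, ← Complex.ofReal_cpow (by positivity), ← Complex.ofReal_pow]
    congr 1
    rw [← Real.rpow_natCast, ← Real.rpow_mul hR.le]
    rw [show ((2 : ℕ) : ℝ) * ((d : ℝ) / 2) = d by push_cast; ring, Real.rpow_natCast]
  · congr 1
    field_simp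
    rw [Complex.I_sq]
    ring

theorem integrable_gauss_mul_exp (lam : Measure (EuclideanSpace ℝ (Fin d))) [IsFiniteMeasure lam]
    {R : ℝ} (hR : 0 < R) :
    Integrable (Function.uncurry fun (ξ z : EuclideanSpace ℝ (Fin d)) =>
      Complex.exp (-(Real.pi / R ^ 2 : ℝ) * ‖ξ‖ ^ 2) *
      Complex.exp (-2 * Real.pi * Complex.I * ((inner ℝ z ξ : ℝ) : ℂ)))
      ((volume : Measure (EuclideanSpace ℝ (Fin d))).prod lam) := by
  have hb : 0 < ((Real.pi / R ^ 2 : ℝ) : ℂ).re := by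
    rw [Complex.ofReal_re]; positivity
  have h := GaussianFourier.integrable_cexp_neg_mul_sq_norm_add hb 0
    (0 : EuclideanSpace ℝ (Fin d))
  simp only [zero_mul, add_zero] at h
  refine (h.mul_prod (integrable_const (1 : ℂ) (μ := lam))).mono ?_ ?_
  · apply Continuous.aestronglyMeasurable
    fun_prop
  · refine ae_of_all _ fun p => ?_
    rw [Function.uncurry, norm_mul, norm_mul]
    gcongr
    rw [Complex.norm_exp]
    simp

theorem integral_gauss_mul_fourierMeasure (lam : Measure (EuclideanSpace ℝ (Fin d)))
    [IsFiniteMeasure lam] {R : ℝ} (hR : 0 < R) :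
    ∫ ξ : EuclideanSpace ℝ (Fin d), Complex.exp (-(Real.pi / R ^ 2 : ℝ) * ‖ξ‖ ^ 2) *
      fourierMeasure lam ξ = ((∫ z, gaussKernel R z ∂lam : ℝ) : ℂ) := by
  simp only [fourierMeasure, ← integral_const_mul]
  rw [integral_integral_swap (integrable_gauss_mul_exp lam hR)]
  simp only [integral_gauss_mul_exp hR]
  exact integral_ofReal

theorem integrable_gaussKernel (lam : Measure (EuclideanSpace ℝ (Fin d))) [IsFiniteMeasure lam]
    {R : ℝ} (hR : 0 < R) : Integrable (gaussKernel R) lam := by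
  refine Integrable.of_bound (continuous_gaussKernel R).aestronglyMeasurable (R ^ d)
    (ae_of_all _ fun z => ?_)
  rw [Real.norm_of_nonneg (gaussKernel_nonneg hR z), gaussKernel]
  refine mul_le_of_le_one_right (by positivity) (Real.exp_le_one_iff.2 ?_)
  have : 0 ≤ Real.pi * R ^ 2 * ‖z‖ ^ 2 := by positivity
  linarith

theorem lintegral_gaussKernel_eq (lam : Measure (EuclideanSpace ℝ (Fin d))) [IsFiniteMeasure lam]
    {R : ℝ} (hR : 0 < R) : ∫⁻ z, ENNReal.ofReal (gaussKernel R z) ∂lam =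
      ‖∫ ξ : EuclideanSpace ℝ (Fin d), Complex.exp (-(Real.pi / R ^ 2 : ℝ) * ‖ξ‖ ^ 2) *
      fourierMeasure lam ξ‖ₑ := by
  rw [← ofReal_integral_eq_lintegral_ofReal (integrable_gaussKernel lam hR)
    (ae_of_all _ fun z => gaussKernel_nonneg hR z), integral_gauss_mul_fourierMeasure lam hR,
    ← ofReal_norm, Complex.norm_real, Real.norm_of_nonneg]
  exact integral_nonneg fun z => gaussKernel_nonneg hR z

theorem enorm_cexp_neg_mul_sq (R : ℝ) (ξ : EuclideanSpace ℝ (Fin d)) :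
    ‖Complex.exp (-(Real.pi / R ^ 2 : ℝ) * ‖ξ‖ ^ 2)‖ₑ =
      ENNReal.ofReal (Real.exp (-(Real.pi / R ^ 2) * ‖ξ‖ ^ 2)) := by
  rw [← ofReal_norm, Complex.norm_exp]
  congr 2
  rw [← Complex.ofReal_pow, ← Complex.ofReal_neg, ← Complex.ofReal_mul, Complex.ofReal_re]

/-- Fourier inversion with a Gaussian cutoff, whose values are at most one. The bound does not
depend on the scale `R`. -/
theorem lintegral_gaussKernel_le (lam : Measure (EuclideanSpace ℝ (Fin d))) [IsFiniteMeasure lam]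
    {R : ℝ} (hR : 0 < R) : ∫⁻ z, ENNReal.ofReal (gaussKernel R z) ∂lam ≤
      ∫⁻ ξ, ‖fourierMeasure lam ξ‖ₑ := by
  rw [lintegral_gaussKernel_eq lam hR]
  refine (enorm_integral_le_lintegral_enorm _).trans (lintegral_mono fun ξ => ?_)
  rw [enorm_mul, enorm_cexp_neg_mul_sq]
  refine mul_le_of_le_one_left' ?_
  rw [← ENNReal.ofReal_one]
  apply ENNReal.ofReal_le_ofReal
  refine Real.exp_le_one_iff.2 ?_
  have : 0 ≤ Real.pi / R ^ 2 * ‖ξ‖ ^ 2 := by positivity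
  linarith

/-- The transform of `diffMeasure μ μ` is the non-negative function $|\hat\mu|^2$, so the inversion
formula is an equality of non-negative integrals. -/
theorem lintegral_gauss_mul_sq_fourierMeasure (μ : Measure (EuclideanSpace ℝ (Fin d)))
    [IsFiniteMeasure μ] {R : ℝ} (hR : 0 < R) :
    ∫⁻ ξ, ENNReal.ofReal (Real.exp (-(Real.pi / R ^ 2) * ‖ξ‖ ^ 2)) * ‖fourierMeasure μ ξ‖ₑ ^ 2 =
      ∫⁻ x, ∫⁻ y, ENNReal.ofReal (gaussKernel R (x - y)) ∂μ ∂μ := by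
  rw [← lintegral_diffMeasure μ μ (continuous_gaussKernel R).measurable.ennreal_ofReal,
    lintegral_gaussKernel_eq _ hR]
  have hreal : ∀ ξ : EuclideanSpace ℝ (Fin d),
      Complex.exp (-(Real.pi / R ^ 2 : ℝ) * ‖ξ‖ ^ 2) * fourierMeasure (diffMeasure μ μ) ξ =
      ((Real.exp (-(Real.pi / R ^ 2) * ‖ξ‖ ^ 2) * ‖fourierMeasure μ ξ‖ ^ 2 : ℝ) : ℂ) := by
    intro ξ
    rw [fourierMeasure_diffMeasure_self]
    push_cast
    rfl
  have hint := (integrable_gauss_mul_exp (diffMeasure μ μ) hR).integral_prod_left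
  simp only [Function.uncurry, integral_const_mul] at hint
  have hint' : Integrable fun ξ : EuclideanSpace ℝ (Fin d) =>
      Real.exp (-(Real.pi / R ^ 2) * ‖ξ‖ ^ 2) * ‖fourierMeasure μ ξ‖ ^ 2 := by
    have h2 : Integrable fun ξ : EuclideanSpace ℝ (Fin d) =>
      Complex.exp (-(Real.pi / R ^ 2 : ℝ) * ‖ξ‖ ^ 2) * fourierMeasure (diffMeasure μ μ) ξ := hint
    simp only [hreal] at h2
    exact h2.re
  simp only [hreal]
  rw [integral_complex_ofReal, ← ofReal_norm, Complex.norm_real,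
    Real.norm_of_nonneg (integral_nonneg fun ξ => by positivity),
    ofReal_integral_eq_lintegral_ofReal hint' (ae_of_all _ fun ξ => by positivity)]
  refine lintegral_congr fun ξ => ?_
  rw [ENNReal.ofReal_mul (by positivity), ENNReal.ofReal_pow (by positivity),
    ofReal_norm]

end FourierMeasure


/-! ### Energy estimates for Frostman measures. -/

section Energy

open Filter Topology ComplexConjugate

variable {d : ℕ}

theorem summable_succ_rpow_mul_exp (s : ℝ) :
    Summable fun k : ℕ => ((k : ℝ) + 1) ^ s * Real.exp (-(Real.pi * (k : ℝ) ^ 2)) := by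
  have h1 := (summable_nat_add_iff 1).2
    (Real.summable_pow_mul_exp_neg_nat_mul ⌈s⌉₊ one_pos)
  refine Summable.of_nonneg_of_le (fun k => by positivity) (fun k => ?_)
    (h1.mul_left (Real.exp 1))
  have hk : (1 : ℝ) ≤ (k : ℝ) + 1 := by linarith [(Nat.cast_nonneg k : (0 : ℝ) ≤ k)]
  have h2 : ((k : ℝ) + 1) ^ s ≤ ((k : ℝ) + 1) ^ ⌈s⌉₊ := by
    rw [← Real.rpow_natCast]
    exact Real.rpow_le_rpow_of_exponent_le hk (Nat.le_ceil s)
  have h3 : (k : ℝ) ≤ Real.pi * (k : ℝ) ^ 2 := by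
    have h4 : (k : ℝ) ≤ (k : ℝ) ^ 2 := by
      exact_mod_cast Nat.le_self_pow two_ne_zero k
    nlinarith [Real.pi_gt_three]
  calc ((k : ℝ) + 1) ^ s * Real.exp (-(Real.pi * (k : ℝ) ^ 2))
      ≤ ((k : ℝ) + 1) ^ ⌈s⌉₊ * Real.exp (-k) := by gcongr
    _ = Real.exp 1 * (((k + 1 : ℕ) : ℝ) ^ ⌈s⌉₊ * Real.exp (-1 * ((k + 1 : ℕ) : ℝ))) := by
        rw [mul_left_comm, ← Real.exp_add]
        push_cast
        ring_nf

/-- Sum over the shells on which `⌊R * ‖x - y‖⌋₊` equals `k`: each sits in a ball of radius `(k + 1)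
/ R`, and the Gaussian decay beats `(k + 1) ^ s`. -/
theorem lintegral_gaussKernel_sub_le {μ : Measure (EuclideanSpace ℝ (Fin d))} {s C : ℝ}
    (hC : 0 ≤ C)
    (hμ : ∀ x r, 0 < r → μ (Metric.closedBall x r) ≤ ENNReal.ofReal (C * r ^ s))
    (x : EuclideanSpace ℝ (Fin d)) {R : ℝ} (hR : 0 < R) :
    ∫⁻ y, ENNReal.ofReal (gaussKernel R (x - y)) ∂μ ≤
      ENNReal.ofReal (C * (∑' k : ℕ, ((k : ℝ) + 1) ^ s * Real.exp (-(Real.pi * (k : ℝ) ^ 2))) *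
        R ^ (d - s)) := by
  have hpt : ∀ y, ENNReal.ofReal (gaussKernel R (x - y)) ≤
      ∑' k : ℕ, (Metric.closedBall x (((k : ℝ) + 1) / R)).indicator
        (fun _ => ENNReal.ofReal (R ^ d * Real.exp (-(Real.pi * (k : ℝ) ^ 2)))) y := by
    intro y
    refine le_trans ?_ (ENNReal.le_tsum ⌊R * ‖x - y‖⌋₊)
    have h1 := Nat.floor_le (a := R * ‖x - y‖) (by positivity)
    have h2 := (Nat.lt_floor_add_one (R * ‖x - y‖)).le
    rw [indicator_of_mem]
    · apply ENNReal.ofReal_le_ofReal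
      rw [gaussKernel]
      refine mul_le_mul_of_nonneg_left (Real.exp_le_exp.2 (neg_le_neg ?_)) (by positivity)
      rw [mul_assoc, ← mul_pow]
      gcongr
    · rw [Metric.mem_closedBall, dist_comm, dist_eq_norm, le_div_iff₀ hR]
      linarith
  calc ∫⁻ y, ENNReal.ofReal (gaussKernel R (x - y)) ∂μ
      ≤ ∑' k : ℕ, ENNReal.ofReal (R ^ d * Real.exp (-(Real.pi * (k : ℝ) ^ 2))) *
          μ (Metric.closedBall x (((k : ℝ) + 1) / R)) := by
        refine (lintegral_mono hpt).trans (le_of_eq ?_)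
        rw [lintegral_tsum]
        · refine tsum_congr fun k => ?_
          rw [lintegral_indicator_const Metric.isClosed_closedBall.measurableSet]
        · exact fun k =>
            (measurable_const.indicator Metric.isClosed_closedBall.measurableSet).aemeasurable
    _ ≤ ∑' k : ℕ, ENNReal.ofReal (C * R ^ (d - s) *
          (((k : ℝ) + 1) ^ s * Real.exp (-(Real.pi * (k : ℝ) ^ 2)))) := by
        refine ENNReal.tsum_le_tsum fun k => ?_
        refine (mul_le_mul_right (hμ x _ (by positivity)) _).trans (le_of_eq ?_)
        rw [← ENNReal.ofReal_mul (by positivity)]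
        congr 1
        rw [Real.div_rpow (by positivity) hR.le, Real.rpow_sub hR, Real.rpow_natCast]
        ring
    _ = _ := by
        rw [← ENNReal.ofReal_tsum_of_nonneg (fun k => by positivity)
          ((summable_succ_rpow_mul_exp s).mul_left _), tsum_mul_left]
        congr 1
        ring

/-- On the ball of radius `R` the Gaussian cutoff is at least $e^{-\pi}$, so the physical-side
estimate for the Gaussian applies. -/
theorem lintegral_closedBall_sq_fourierMeasure_le {μ : Measure (EuclideanSpace ℝ (Fin d))}
    [IsFiniteMeasure μ] {s C : ℝ} (hC : 0 ≤ C)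
    (hμ : ∀ x r, 0 < r → μ (Metric.closedBall x r) ≤ ENNReal.ofReal (C * r ^ s)) :
    ∃ A : ℝ, 0 ≤ A ∧ ∀ R, 0 < R →
      ∫⁻ ξ in Metric.closedBall 0 R, ‖fourierMeasure μ ξ‖ₑ ^ 2 ≤
        ENNReal.ofReal (A * R ^ (d - s)) := by
  set B := C * (∑' k : ℕ, ((k : ℝ) + 1) ^ s * Real.exp (-(Real.pi * (k : ℝ) ^ 2))) with hB
  have hB0 : 0 ≤ B := mul_nonneg hC (tsum_nonneg fun k => by positivity)
  refine ⟨Real.exp Real.pi * (B * (μ univ).toReal), by positivity, fun R hR => ?_⟩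
  calc ∫⁻ ξ in Metric.closedBall 0 R, ‖fourierMeasure μ ξ‖ₑ ^ 2
      ≤ ∫⁻ ξ in Metric.closedBall 0 R, ENNReal.ofReal (Real.exp Real.pi) *
          (ENNReal.ofReal (Real.exp (-(Real.pi / R ^ 2) * ‖ξ‖ ^ 2)) *
            ‖fourierMeasure μ ξ‖ₑ ^ 2) := by
        refine setLIntegral_mono' Metric.isClosed_closedBall.measurableSet fun ξ hξ => ?_
        rw [← mul_assoc, ← ENNReal.ofReal_mul (by positivity), ← Real.exp_add]
        refine le_mul_of_one_le_left' ?_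
        rw [← ENNReal.ofReal_one]
        apply ENNReal.ofReal_le_ofReal
        rw [mem_closedBall_zero_iff] at hξ
        apply Real.one_le_exp
        have : Real.pi / R ^ 2 * ‖ξ‖ ^ 2 ≤ Real.pi / R ^ 2 * R ^ 2 := by gcongr
        rw [div_mul_cancel₀ _ (by positivity)] at this
        linarith
    _ ≤ ENNReal.ofReal (Real.exp Real.pi) *
          ∫⁻ ξ, (ENNReal.ofReal (Real.exp (-(Real.pi / R ^ 2) * ‖ξ‖ ^ 2)) *
            ‖fourierMeasure μ ξ‖ₑ ^ 2) := by
        rw [lintegral_const_mul' _ _ ENNReal.ofReal_ne_top]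
        gcongr
        exact Measure.restrict_le_self
    _ ≤ ENNReal.ofReal (Real.exp Real.pi) * ∫⁻ _, ENNReal.ofReal (B * R ^ (d - s)) ∂μ := by
        rw [lintegral_gauss_mul_sq_fourierMeasure μ hR]
        gcongr with x
        exact lintegral_gaussKernel_sub_le hC hμ x hR
    _ = _ := by
        rw [lintegral_const, ← ENNReal.ofReal_toReal (measure_ne_top μ univ),
          ← ENNReal.ofReal_mul (by positivity), ← ENNReal.ofReal_mul (by positivity),
          ENNReal.toReal_ofReal ENNReal.toReal_nonneg]
        congr 1
        ring

/-- Measures with the Frostman condition have finite energy. -/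
theorem lintegral_sq_fourierMeasure_mul_lt_top {μ : Measure (EuclideanSpace ℝ (Fin d))}
    [IsFiniteMeasure μ] {s C γ : ℝ} (hC : 0 ≤ C) (hγ : 0 < γ) (hsγ : d < s + γ)
    (hμ : ∀ x r, 0 < r → μ (Metric.closedBall x r) ≤ ENNReal.ofReal (C * r ^ s)) :
    ∫⁻ ξ, ‖fourierMeasure μ ξ‖ₑ ^ 2 * ENNReal.ofReal (min 1 (‖ξ‖ ^ (-γ))) < ∞ := by
  obtain ⟨A, hA, hball⟩ := lintegral_closedBall_sq_fourierMeasure_le hC hμ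
  -- Dyadic annuli, with the unit ball put into the term `k = 0`. The growth of the energy on balls
  -- makes the series geometric with ratio `2 ^ (d - s - γ) < 1`.
  have hpt : ∀ ξ : EuclideanSpace ℝ (Fin d),
      ‖fourierMeasure μ ξ‖ₑ ^ 2 * ENNReal.ofReal (min 1 (‖ξ‖ ^ (-γ))) ≤
      ∑' k : ℕ, ENNReal.ofReal ((2 : ℝ) ^ (-γ * k)) *
        (Metric.closedBall (0 : EuclideanSpace ℝ (Fin d)) (2 ^ (k + 1))).indicator
        (fun ξ => ‖fourierMeasure μ ξ‖ₑ ^ 2) ξ := by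
    intro ξ
    rcases lt_or_ge ‖ξ‖ 1 with h1 | h1
    · refine le_trans ?_ (ENNReal.le_tsum 0)
      rw [indicator_of_mem (by rw [mem_closedBall_zero_iff]; norm_num; linarith), mul_comm]
      gcongr
      simp
    · obtain ⟨k, hk1, hk2⟩ := exists_nat_pow_near h1 one_lt_two
      refine le_trans ?_ (ENNReal.le_tsum k)
      rw [indicator_of_mem (by rw [mem_closedBall_zero_iff]; exact hk2.le), mul_comm]
      gcongr
      refine (min_le_right _ _).trans ?_
      rw [mul_comm, Real.rpow_mul (by norm_num), Real.rpow_natCast]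
      exact Real.rpow_le_rpow_of_nonpos (by positivity) hk1 (by linarith)
  have hmeas : Measurable fun ξ => ‖fourierMeasure μ ξ‖ₑ ^ 2 :=
    ((continuous_fourierMeasure μ).measurable.enorm).pow_const 2
  have hratio : (2 : ℝ) ^ (d - s - γ) < 1 :=
    Real.rpow_lt_one_of_one_lt_of_neg one_lt_two (by linarith)
  calc _ ≤ ∑' k : ℕ, ENNReal.ofReal ((2 : ℝ) ^ (-γ * k)) *
        ∫⁻ ξ in Metric.closedBall (0 : EuclideanSpace ℝ (Fin d)) (2 ^ (k + 1)),
          ‖fourierMeasure μ ξ‖ₑ ^ 2 := by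
        refine (lintegral_mono hpt).trans (le_of_eq ?_)
        rw [lintegral_tsum]
        · refine tsum_congr fun k => ?_
          rw [lintegral_const_mul' _ _ ENNReal.ofReal_ne_top,
            lintegral_indicator Metric.isClosed_closedBall.measurableSet]
        · exact fun k =>
            ((hmeas.indicator Metric.isClosed_closedBall.measurableSet).const_mul _).aemeasurable
    _ ≤ ∑' k : ℕ, ENNReal.ofReal (A * 2 ^ (d - s) * ((2 : ℝ) ^ (d - s - γ)) ^ k) := by
        refine ENNReal.tsum_le_tsum fun k => ?_
        refine (mul_le_mul_right (hball _ (by positivity)) _).trans (le_of_eq ?_)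
        rw [← ENNReal.ofReal_mul (by positivity)]
        congr 1
        rw [← Real.rpow_natCast, ← Real.rpow_natCast, ← Real.rpow_mul (by norm_num),
          ← Real.rpow_mul (by norm_num), mul_assoc, ← Real.rpow_add (by norm_num),
          mul_left_comm, ← Real.rpow_add (by norm_num)]
        congr 2
        push_cast
        ring
    _ = ENNReal.ofReal (∑' k : ℕ, A * 2 ^ (d - s) * ((2 : ℝ) ^ (d - s - γ)) ^ k) :=
        (ENNReal.ofReal_tsum_of_nonneg (fun k => by positivity)
          ((summable_geometric_of_lt_one (by positivity) hratio).mul_left _)).symm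
    _ < ∞ := ENNReal.ofReal_lt_top

end Energy

/-! ### Doubling of the energy density by positive definiteness. -/

section Doubling

open Filter Topology ComplexConjugate

variable {d : ℕ}

theorem enorm_integral_ofReal_eq {X : Type*} [MeasurableSpace X] {ρ : Measure X} {f : X → ℂ}
    {g : X → ℝ} (hfg : ∀ x, f x = g x) (hg : ∀ x, 0 ≤ g x) (hint : Integrable f ρ) :
    ‖∫ x, f x ∂ρ‖ₑ = ∫⁻ x, ‖f x‖ₑ ∂ρ := by
  have hgi : Integrable g ρ := by simpa [hfg] using hint.re
  simp only [hfg]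
  rw [integral_complex_ofReal, ← ofReal_norm, Complex.norm_real,
    Real.norm_of_nonneg (integral_nonneg hg), ofReal_integral_eq_lintegral_ofReal hgi
      (ae_of_all _ hg)]
  refine lintegral_congr fun x => ?_
  rw [← ofReal_norm, Complex.norm_real, Real.norm_of_nonneg (hg x)]

/-- The multiplication formula; a translation on one side becomes a unimodular factor on the other.
-/
theorem integral_fourierMeasure_add (lam κ : Measure (EuclideanSpace ℝ (Fin d)))
    [IsFiniteMeasure lam] [IsFiniteMeasure κ] (a : EuclideanSpace ℝ (Fin d)) :
    ∫ ζ, fourierMeasure lam (a + ζ) ∂κ =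
      ∫ x, Complex.exp (-2 * Real.pi * Complex.I * ((inner ℝ x a : ℝ) : ℂ)) *
        fourierMeasure κ x ∂lam := by
  simp only [fourierMeasure, ← integral_const_mul]
  rw [integral_integral_swap]
  · refine integral_congr_ae (ae_of_all _ fun x => integral_congr_ae (ae_of_all _ fun ζ => ?_))
    simp only
    rw [← Complex.exp_add, inner_add_right, real_inner_comm]
    congr 1
    rw [real_inner_comm x ζ]
    push_cast
    rw [real_inner_comm x a]
    ring
  · refine Integrable.of_bound (C := 1) ?_ (ae_of_all _ fun p => ?_)
    · apply Continuous.aestronglyMeasurable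
      unfold Function.uncurry
      fun_prop
    · rw [Function.uncurry, Complex.norm_exp]
      simp

theorem integrable_fourierMeasure (lam κ : Measure (EuclideanSpace ℝ (Fin d)))
    [IsFiniteMeasure lam] [IsFiniteMeasure κ] : Integrable (fourierMeasure lam) κ := by
  refine Integrable.of_bound (C := lam.real univ)
    (continuous_fourierMeasure lam).aestronglyMeasurable (ae_of_all _ fun ξ => ?_)
  rw [fourierMeasure_eq_charFun]
  exact norm_charFun_le _

theorem enorm_fourierMeasure_diffMeasure_self (μ : Measure (EuclideanSpace ℝ (Fin d)))
    [IsFiniteMeasure μ] (ξ : EuclideanSpace ℝ (Fin d)) :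
    ‖fourierMeasure (diffMeasure μ μ) ξ‖ₑ = ‖fourierMeasure μ ξ‖ₑ ^ 2 := by
  rw [fourierMeasure_diffMeasure_self, ← ofReal_norm, Complex.norm_real,
    Real.norm_of_nonneg (by positivity), ENNReal.ofReal_pow (by positivity), ofReal_norm]

/-- Among all translates, the centred one catches the most of `|μ̂|²` against a difference
measure. -/
theorem lintegral_sq_fourierMeasure_add_le (μ β : Measure (EuclideanSpace ℝ (Fin d)))
    [IsFiniteMeasure μ] [IsFiniteMeasure β] (a : EuclideanSpace ℝ (Fin d)) :
    ∫⁻ ζ, ‖fourierMeasure μ (a + ζ)‖ₑ ^ 2 ∂(diffMeasure β β) ≤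
      ∫⁻ ζ, ‖fourierMeasure μ ζ‖ₑ ^ 2 ∂(diffMeasure β β) := by
  -- Both integrals are moved to the side of $|\hat\beta|^2\ge 0$. There the translate differs from
  -- the centred integral by a phase only, and dropping the phase can only increase the value.
  have h1 : ∫⁻ ζ, ‖fourierMeasure μ ζ‖ₑ ^ 2 ∂(diffMeasure β β) =
      ∫⁻ x, ‖fourierMeasure (diffMeasure β β) x‖ₑ ∂(diffMeasure μ μ) := by
    rw [← enorm_integral_ofReal_eq (fourierMeasure_diffMeasure_self β) (fun _ => by positivity)
      (integrable_fourierMeasure _ _)]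
    have h2 := integral_fourierMeasure_add (diffMeasure μ μ) (diffMeasure β β) 0
    simp only [zero_add, inner_zero_right, Complex.ofReal_zero, mul_zero, Complex.exp_zero,
      one_mul] at h2
    rw [← h2, enorm_integral_ofReal_eq (fourierMeasure_diffMeasure_self μ)
      (fun _ => by positivity) (integrable_fourierMeasure _ _)]
    simp only [enorm_fourierMeasure_diffMeasure_self]
  have h3 : ∫⁻ ζ, ‖fourierMeasure μ (a + ζ)‖ₑ ^ 2 ∂(diffMeasure β β) =
      ‖∫ ζ, fourierMeasure (diffMeasure μ μ) (a + ζ) ∂(diffMeasure β β)‖ₑ := by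
    rw [enorm_integral_ofReal_eq (fun ζ => fourierMeasure_diffMeasure_self μ (a + ζ))
      (fun _ => by positivity)]
    · simp only [enorm_fourierMeasure_diffMeasure_self]
    · refine Integrable.of_bound (C := (diffMeasure μ μ).real univ)
        ((continuous_fourierMeasure _).comp (continuous_const.add continuous_id)
          ).aestronglyMeasurable (ae_of_all _ fun ξ => ?_)
      rw [fourierMeasure_eq_charFun]
      exact norm_charFun_le _
  rw [h1, h3, integral_fourierMeasure_add]
  refine (enorm_integral_le_lintegral_enorm _).trans (lintegral_mono fun x => ?_)
  rw [enorm_mul, ← ofReal_norm, Complex.norm_exp]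
  simp

/-- For $\beta$ the volume on `ball 0 (2 * r)`, the density of $\beta*\tilde\beta$ is at least
$|B(0,r)|$ on `ball 0 r`, at most $|B(0,2r)|$, and vanishes off `ball 0 (4 * r)`. The factor `2 ^ d`
is the ratio of the volumes. -/
theorem lintegral_ball_sq_fourierMeasure_le (μ : Measure (EuclideanSpace ℝ (Fin d)))
    [IsFiniteMeasure μ] (a : EuclideanSpace ℝ (Fin d)) {r : ℝ} (hr : 0 < r) :
    ∫⁻ ξ in Metric.ball a r, ‖fourierMeasure μ ξ‖ₑ ^ 2 ≤
      2 ^ d * ∫⁻ ξ in Metric.ball 0 (4 * r), ‖fourierMeasure μ ξ‖ₑ ^ 2 := by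
  set β := (volume : Measure (EuclideanSpace ℝ (Fin d))).restrict (Metric.ball 0 (2 * r)) with hβ
  have hfin : IsFiniteMeasure β := ⟨by simp [hβ, measure_ball_lt_top]⟩
  have hmeas : Measurable fun ξ => ‖fourierMeasure μ ξ‖ₑ ^ 2 :=
    ((continuous_fourierMeasure μ).measurable.enorm).pow_const 2
  set g : EuclideanSpace ℝ (Fin d) → ℝ≥0∞ := fun ξ => ‖fourierMeasure μ ξ‖ₑ ^ 2 with hg
  have hv0 : volume (Metric.ball (0 : EuclideanSpace ℝ (Fin d)) r) ≠ 0 :=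
    (Metric.measure_ball_pos _ _ hr).ne'
  have hvt : volume (Metric.ball (0 : EuclideanSpace ℝ (Fin d)) r) ≠ ∞ := measure_ball_lt_top.ne
  have hlow : volume (Metric.ball (0 : EuclideanSpace ℝ (Fin d)) r) *
      ∫⁻ ξ in Metric.ball a r, g ξ ≤ ∫⁻ ζ, g (a + ζ) ∂(diffMeasure β β) := by
    rw [lintegral_diffMeasure _ _ (by fun_prop)]
    calc _ = ∫⁻ _ in Metric.ball (0 : EuclideanSpace ℝ (Fin d)) r,
          ∫⁻ ξ in Metric.ball a r, g ξ := by
          rw [lintegral_const, Measure.restrict_apply_univ, mul_comm]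
      _ ≤ ∫⁻ x in Metric.ball (0 : EuclideanSpace ℝ (Fin d)) r, ∫⁻ y, g (a + (x - y)) ∂β := by
          refine setLIntegral_mono' Metric.isOpen_ball.measurableSet fun x hx => ?_
          rw [← lintegral_indicator Metric.isOpen_ball.measurableSet,
            ← lintegral_sub_left_eq_self _ (a + x), hβ,
            ← lintegral_indicator Metric.isOpen_ball.measurableSet]
          refine lintegral_mono fun y => ?_
          by_cases hy : a + x - y ∈ Metric.ball a r
          · rw [indicator_of_mem hy, indicator_of_mem, add_sub_assoc]
            rw [mem_ball_zero_iff] at hx ⊢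
            rw [mem_ball_iff_norm] at hy
            have : y = x - (a + x - y - a) := by abel
            rw [this]
            refine (norm_sub_le _ _).trans_lt ?_
            linarith
          · rw [indicator_of_notMem hy]
            exact zero_le
      _ ≤ _ := by
          refine lintegral_mono' (Measure.restrict_mono (Metric.ball_subset_ball ?_) le_rfl) le_rfl
          linarith
  have hup : ∫⁻ ζ, g ζ ∂(diffMeasure β β) ≤
      volume (Metric.ball (0 : EuclideanSpace ℝ (Fin d)) (2 * r)) *
        ∫⁻ ξ in Metric.ball 0 (4 * r), g ξ := by
    rw [lintegral_diffMeasure _ _ hmeas]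
    calc _ ≤ ∫⁻ _ in Metric.ball (0 : EuclideanSpace ℝ (Fin d)) (2 * r),
          ∫⁻ ξ in Metric.ball 0 (4 * r), g ξ := by
          refine setLIntegral_mono' Metric.isOpen_ball.measurableSet fun x hx => ?_
          rw [← lintegral_indicator Metric.isOpen_ball.measurableSet,
            ← lintegral_sub_left_eq_self _ x,
            ← lintegral_indicator Metric.isOpen_ball.measurableSet]
          refine lintegral_mono fun y => ?_
          by_cases hy : x - y ∈ Metric.ball (0 : EuclideanSpace ℝ (Fin d)) (2 * r)
          · rw [indicator_of_mem hy, indicator_of_mem, sub_sub_cancel]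
            rw [mem_ball_zero_iff] at hx hy ⊢
            rw [← sub_sub_cancel x y]
            refine (norm_sub_le _ _).trans_lt ?_
            linarith
          · rw [indicator_of_notMem hy]
            exact zero_le
      _ = _ := by rw [lintegral_const, Measure.restrict_apply_univ, mul_comm]
  have hvol : volume (Metric.ball (0 : EuclideanSpace ℝ (Fin d)) (2 * r)) =
      2 ^ d * volume (Metric.ball (0 : EuclideanSpace ℝ (Fin d)) r) := by
    rw [Measure.addHaar_ball_mul_of_pos _ _ (by norm_num), finrank_euclideanSpace_fin,
      Measure.addHaar_ball_center, ENNReal.ofReal_pow (by norm_num), ENNReal.ofReal_ofNat]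
  have hall := hlow.trans ((lintegral_sq_fourierMeasure_add_le μ β a).trans hup)
  rw [hvol, mul_assoc, mul_left_comm] at hall
  exact (ENNReal.mul_le_mul_iff_right hv0 hvt).1 hall

/-- The measure `|μ̂|² dξ` is doubling on balls around the origin. -/
theorem exists_lintegral_ball_mul_le (L : ℝ) :
    ∃ N : NNReal, 1 ≤ N ∧ ∀ (μ : Measure (EuclideanSpace ℝ (Fin d))) [IsFiniteMeasure μ] (R : ℝ),
      0 < R → ∫⁻ ξ in Metric.ball 0 (L * R), ‖fourierMeasure μ ξ‖ₑ ^ 2 ≤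
        N * ∫⁻ ξ in Metric.ball 0 R, ‖fourierMeasure μ ξ‖ₑ ^ 2 := by
  obtain ⟨t, -, ht⟩ := (isCompact_closedBall (0 : EuclideanSpace ℝ (Fin d)) L
    ).elim_nhds_subcover (fun a => Metric.ball a (1 / 4))
    fun a _ => Metric.ball_mem_nhds a (by norm_num)
  -- The large ball is covered by `t.card` balls of radius `R / 4`, each of which costs a factor `2
  -- ^ d`; the summand `1` ensures `1 ≤ N`.
  refine ⟨t.card * 2 ^ d + 1, by simp, fun μ _ R hR => ?_⟩
  have hcov : Metric.ball (0 : EuclideanSpace ℝ (Fin d)) (L * R) ⊆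
      ⋃ a ∈ t, Metric.ball (R • a) (R / 4) := by
    intro ξ hξ
    have h1 : R⁻¹ • ξ ∈ Metric.closedBall (0 : EuclideanSpace ℝ (Fin d)) L := by
      rw [mem_ball_zero_iff] at hξ
      rw [mem_closedBall_zero_iff, norm_smul, norm_inv, Real.norm_of_nonneg hR.le,
        inv_mul_le_iff₀ hR]
      linarith
    obtain ⟨a, ha, haξ⟩ := mem_iUnion₂.1 (ht h1)
    refine mem_iUnion₂.2 ⟨a, ha, ?_⟩
    rw [mem_ball_iff_norm] at haξ ⊢
    have h2 : ξ - R • a = R • (R⁻¹ • ξ - a) := by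
      rw [smul_sub, smul_inv_smul₀ hR.ne']
    rw [h2, norm_smul, Real.norm_of_nonneg hR.le]
    have := mul_lt_mul_of_pos_left haξ hR
    linarith
  calc _ ≤ ∫⁻ ξ in ⋃ a ∈ t, Metric.ball (R • a) (R / 4), ‖fourierMeasure μ ξ‖ₑ ^ 2 :=
        lintegral_mono_set hcov
    _ ≤ ∑ a ∈ t, ∫⁻ ξ in Metric.ball (R • a) (R / 4), ‖fourierMeasure μ ξ‖ₑ ^ 2 := by
        rw [← withDensity_apply' _, ← Finset.sum_congr rfl fun a _ => withDensity_apply' _ _]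
        exact measure_biUnion_finset_le _ _
    _ ≤ ∑ a ∈ t, 2 ^ d * ∫⁻ ξ in Metric.ball 0 R, ‖fourierMeasure μ ξ‖ₑ ^ 2 := by
        refine Finset.sum_le_sum fun a _ => ?_
        have := lintegral_ball_sq_fourierMeasure_le μ (R • a) (r := R / 4) (by positivity)
        rwa [show 4 * (R / 4) = R by ring] at this
    _ ≤ _ := by
        rw [Finset.sum_const, nsmul_eq_mul, ← mul_assoc]
        gcongr
        push_cast
        exact le_self_add

/-- Radially decreasing weights may be dilated in the energy of a measure. -/
theorem exists_lintegral_sq_fourierMeasure_mul_le (hd : 1 ≤ d) {L : ℝ} (hL : 1 ≤ L) :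
    ∃ N : NNReal, ∀ (μ : Measure (EuclideanSpace ℝ (Fin d))) [IsFiniteMeasure μ]
      (G : ℝ → ℝ), Monotone G → (∀ r, 0 ≤ G r) →
      ∫⁻ ξ, ‖fourierMeasure μ ξ‖ₑ ^ 2 * ENNReal.ofReal (G (L * ‖ξ‖⁻¹)) ≤
        N * ∫⁻ ξ, ‖fourierMeasure μ ξ‖ₑ ^ 2 * ENNReal.ofReal (G ‖ξ‖⁻¹) := by
  -- The factor `2` leaves room to place a possibly closed superlevel ball inside an open one.
  obtain ⟨N, hN1, hN⟩ := exists_lintegral_ball_mul_le (d := d) (2 * L)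
  refine ⟨N, fun μ _ G hG hG0 => ?_⟩
  have hne : Nonempty (Fin d) := ⟨⟨0, hd⟩⟩
  have hmeas : Measurable fun ξ => ‖fourierMeasure μ ξ‖ₑ ^ 2 :=
    ((continuous_fourierMeasure μ).measurable.enorm).pow_const 2
  set m := (volume : Measure (EuclideanSpace ℝ (Fin d))).withDensity
    fun ξ => ‖fourierMeasure μ ξ‖ₑ ^ 2 with hm
  have hG1 : Measurable fun ξ : EuclideanSpace ℝ (Fin d) => G (L * ‖ξ‖⁻¹) :=
    hG.measurable.comp (measurable_norm.inv.const_mul L)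
  have hG2 : Measurable fun ξ : EuclideanSpace ℝ (Fin d) => G ‖ξ‖⁻¹ :=
    hG.measurable.comp measurable_norm.inv
  have h1 := lintegral_withDensity_eq_lintegral_mul volume hmeas hG1.ennreal_ofReal
  have h2 := lintegral_withDensity_eq_lintegral_mul volume hmeas hG2.ennreal_ofReal
  simp only [Pi.mul_apply] at h1 h2
  rw [← h1, ← h2, ← hm, lintegral_eq_lintegral_meas_lt m (ae_of_all _ fun _ => hG0 _)
    hG1.aemeasurable, lintegral_eq_lintegral_meas_lt m (ae_of_all _ fun _ => hG0 _)
    hG2.aemeasurable, ← lintegral_const_mul' _ _ ENNReal.coe_ne_top]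
  refine lintegral_mono fun t => ?_
  -- By the layer-cake formula only superlevel sets matter, and these are balls up to the origin.
  -- There `‖0‖⁻¹ = 0` spoils the monotonicity, but the origin is null.
  have hm0 : m {0} = 0 := withDensity_absolutelyContinuous _ _ (by simp)
  let P : Set ℝ := {r | 0 < r ∧ t < G r⁻¹}
  have hdown : ∀ r ∈ P, ∀ r', 0 < r' → r' ≤ r → r' ∈ P := fun r hr r' h0 hle =>
    ⟨h0, hr.2.trans_le (hG (inv_anti₀ h0 hle))⟩
  have hS1 : ∀ ξ : EuclideanSpace ℝ (Fin d), ξ ≠ 0 → t < G (L * ‖ξ‖⁻¹) → ‖ξ‖ / L ∈ P := by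
    intro ξ hξ h
    refine ⟨div_pos (norm_pos_iff.2 hξ) (by linarith), ?_⟩
    rwa [inv_div, div_eq_mul_inv]
  by_cases hb : BddAbove P
  · by_cases hPe : P.Nonempty
    · obtain ⟨r0, hr0⟩ := hPe
      have hR : 0 < sSup P := hr0.1.trans_le (le_csSup hb hr0)
      have hsub1 : {ξ : EuclideanSpace ℝ (Fin d) | t < G (L * ‖ξ‖⁻¹)} ⊆
          Metric.ball 0 (2 * L * sSup P) := by
        intro ξ hξ
        rw [mem_ball_zero_iff]
        by_cases h0 : ξ = 0
        · rw [h0, norm_zero]; positivity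
        · have h3 := le_csSup hb (hS1 ξ h0 hξ)
          rw [div_le_iff₀ (by linarith)] at h3
          have : 0 < sSup P * L := by positivity
          linarith
      have hsub2 : Metric.ball (0 : EuclideanSpace ℝ (Fin d)) (sSup P) ⊆
          {0} ∪ {ξ : EuclideanSpace ℝ (Fin d) | t < G ‖ξ‖⁻¹} := by
        intro ξ hξ
        by_cases h0 : ξ = 0
        · exact Or.inl h0
        · right
          rw [mem_ball_zero_iff] at hξ
          obtain ⟨r, hr, hlt⟩ := exists_lt_of_lt_csSup ⟨r0, hr0⟩ hξ
          exact (hdown r hr _ (norm_pos_iff.2 h0) hlt.le).2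
      calc _ ≤ m (Metric.ball 0 (2 * L * sSup P)) := measure_mono hsub1
        _ ≤ N * m (Metric.ball 0 (sSup P)) := by
            rw [hm, withDensity_apply' , withDensity_apply']
            exact hN μ _ hR
        _ ≤ N * (m {0} + m {ξ : EuclideanSpace ℝ (Fin d) | t < G ‖ξ‖⁻¹}) := by
            gcongr
            exact (measure_mono hsub2).trans (measure_union_le _ _)
        _ = _ := by rw [hm0, zero_add]
    · refine le_trans (le_of_eq ?_) zero_le
      refine measure_mono_null (fun ξ hξ => ?_) hm0
      by_contra h0
      exact hPe ⟨_, hS1 ξ h0 hξ⟩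
  -- For unbounded `P` the undilated superlevel set is the whole space up to the origin, so `1 ≤ N`
  -- suffices.
  · have hsub : (univ : Set (EuclideanSpace ℝ (Fin d))) ⊆
        {0} ∪ {ξ : EuclideanSpace ℝ (Fin d) | t < G ‖ξ‖⁻¹} := by
      intro ξ _
      by_cases h0 : ξ = 0
      · exact Or.inl h0
      · right
        rw [not_bddAbove_iff] at hb
        obtain ⟨r, hr, hlt⟩ := hb ‖ξ‖
        exact (hdown r hr _ (norm_pos_iff.2 h0) hlt.le).2
    calc _ ≤ m ({0} ∪ {ξ : EuclideanSpace ℝ (Fin d) | t < G ‖ξ‖⁻¹}) :=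
          measure_mono ((subset_univ _).trans hsub)
      _ ≤ m {0} + m {ξ : EuclideanSpace ℝ (Fin d) | t < G ‖ξ‖⁻¹} := measure_union_le _ _
      _ ≤ _ := by
          rw [hm0, zero_add]
          exact le_mul_of_one_le_left' (by exact_mod_cast hN1)

end Doubling


/-! ### The norm of a convex body against the Euclidean norm. -/

section Gauge

open Filter Topology

variable {d : ℕ} {K : Set (EuclideanSpace ℝ (Fin d))}

theorem Convex.mem_nhds_zero_of_symm (hK : Convex ℝ K) (hs : ∀ x ∈ K, -x ∈ K)
    (hi : (interior K).Nonempty) : K ∈ 𝓝 (0 : EuclideanSpace ℝ (Fin d)) := by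
  obtain ⟨x, hx⟩ := hi
  have h1 := hK.openSegment_interior_self_subset_interior hx (hs x (interior_subset hx))
  refine mem_interior_iff_mem_nhds.1 (h1 ⟨1 / 2, 1 / 2, by norm_num, by norm_num, by norm_num, ?_⟩)
  simp

theorem exists_mul_gauge_le_norm (h0 : K ∈ 𝓝 (0 : EuclideanSpace ℝ (Fin d))) :
    ∃ ρ : ℝ, 0 < ρ ∧ ∀ x, ρ * gauge K x ≤ ‖x‖ := by
  obtain ⟨ρ, hρ, h⟩ := Metric.mem_nhds_iff.1 h0
  exact ⟨ρ, hρ, fun x => mul_gauge_le_norm h⟩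

theorem exists_norm_le_mul_gauge (h0 : K ∈ 𝓝 (0 : EuclideanSpace ℝ (Fin d)))
    (hb : Bornology.IsBounded K) : ∃ b : ℝ, 0 < b ∧ ∀ x, ‖x‖ ≤ b * gauge K x := by
  obtain ⟨b, hb, h⟩ := hb.subset_closedBall_lt 0 0
  refine ⟨b, hb, fun x => ?_⟩
  have := le_gauge_of_subset_closedBall (absorbent_nhds_zero h0) hb.le h (x := x)
  rwa [div_le_iff₀ hb, mul_comm] at this

/-- The radial projection onto the boundary is Lipschitz away from the origin because the gauge is
Lipschitz and comparable to the norm. It carries the faces of a cube onto pieces of the boundary. -/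
theorem lipschitzOnWith_inv_gauge_smul (hK : Convex ℝ K)
    (h0 : K ∈ 𝓝 (0 : EuclideanSpace ℝ (Fin d))) (hb : Bornology.IsBounded K) :
    ∃ C : NNReal, LipschitzOnWith C (fun x => (gauge K x)⁻¹ • x) {x | 1 ≤ ‖x‖} := by
  obtain ⟨b, hb0, hb⟩ := exists_norm_le_mul_gauge h0 hb
  obtain ⟨L, hL⟩ := hK.lipschitz_gauge h0
  refine ⟨(b * (1 + b * L)).toNNReal, LipschitzOnWith.of_dist_le_mul fun x hx y hy => ?_⟩
  rw [Real.coe_toNNReal _ (by positivity)]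
  have hpos : ∀ x : EuclideanSpace ℝ (Fin d), 1 ≤ ‖x‖ → 0 < gauge K x := fun x hx =>
    pos_of_mul_pos_right (lt_of_lt_of_le (by linarith) (hb x)) hb0.le
  have hgx := hpos x hx
  have hgy := hpos y hy
  have hinv : (gauge K x)⁻¹ ≤ b := by
    rw [inv_le_iff_one_le_mul₀ hgx]
    exact le_trans hx (hb x)
  have key : (gauge K x)⁻¹ • x - (gauge K y)⁻¹ • y =
      (gauge K x)⁻¹ • ((x - y) + ((gauge K y - gauge K x) * (gauge K y)⁻¹) • y) := by
    rw [sub_mul, mul_inv_cancel₀ hgy.ne', sub_smul, one_smul, sub_add_sub_cancel, smul_sub,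
      smul_smul, inv_mul_cancel_left₀ hgx.ne']
  have h1 : ‖((gauge K y - gauge K x) * (gauge K y)⁻¹) • y‖ ≤ b * L * dist x y := by
    rw [norm_smul, norm_mul, norm_inv, Real.norm_of_nonneg hgy.le]
    have h2 : ‖gauge K y - gauge K x‖ ≤ L * dist x y := by
      rw [← dist_eq_norm, dist_comm x]; exact hL.dist_le_mul y x
    have h3 : (gauge K y)⁻¹ * ‖y‖ ≤ b := by
      rw [inv_mul_le_iff₀ hgy, mul_comm]; exact hb y
    calc ‖gauge K y - gauge K x‖ * (gauge K y)⁻¹ * ‖y‖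
        = ‖gauge K y - gauge K x‖ * ((gauge K y)⁻¹ * ‖y‖) := by ring
      _ ≤ (L * dist x y) * b := by gcongr
      _ = _ := by ring
  rw [dist_eq_norm, key, norm_smul, norm_inv, Real.norm_of_nonneg hgx.le]
  calc (gauge K x)⁻¹ * ‖(x - y) + ((gauge K y - gauge K x) * (gauge K y)⁻¹) • y‖
      ≤ b * (dist x y + b * L * dist x y) := by
        gcongr
        exact (norm_add_le _ _).trans (add_le_add (dist_eq_norm x y).ge h1)
    _ = _ := by ring

end Gauge

/-! ### Finiteness and lower regularity of the surface measure. -/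

section SurfaceMeasure

open Filter Topology

theorem LipschitzOnWith.euclideanHausdorffMeasure_image_le {X Y : Type*} [EMetricSpace X]
    [MeasurableSpace X] [BorelSpace X] [EMetricSpace Y] [MeasurableSpace Y] [BorelSpace Y]
    {C : NNReal} {f : X → Y} {s : Set X} (h : LipschitzOnWith C f s) (m : ℕ) :
    Measure.euclideanHausdorffMeasure m (f '' s) ≤
      (C : ℝ≥0∞) ^ m * Measure.euclideanHausdorffMeasure m s := by
  have := h.hausdorffMeasure_image_le (d := m) (by positivity)
  simp only [Measure.euclideanHausdorffMeasure_def, Measure.smul_apply, ENNReal.smul_def,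
    smul_eq_mul]
  rw [mul_left_comm]
  gcongr
  simpa using this

/-- The face of a cube: insertion of a fixed coordinate. -/
noncomputable def insertCoord {m : ℕ} (i : Fin (m + 1)) (c : ℝ) (u : EuclideanSpace ℝ (Fin m)) :
    EuclideanSpace ℝ (Fin (m + 1)) :=
  WithLp.toLp 2 (i.insertNth c (fun j => u j))

theorem isometry_insertCoord {m : ℕ} (i : Fin (m + 1)) (c : ℝ) : Isometry (insertCoord i c) := by
  refine Isometry.of_dist_eq fun u v => ?_
  rw [EuclideanSpace.dist_eq, EuclideanSpace.dist_eq, Fin.sum_univ_succAbove _ i]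
  simp [insertCoord]

variable {d : ℕ} {K : Set (EuclideanSpace ℝ (Fin d))}

/-- Scaling a boundary point by its largest coordinate puts it on a face of $[-1,1]^d$. So the
boundary is covered by finitely many Lipschitz images of bounded pieces of $\mathbb R^{d-1}$; a ball
of radius `√m` contains each face. -/
theorem isFiniteMeasure_surfaceMeasure (hd : 1 ≤ d) (hK : Convex ℝ K)
    (h0 : K ∈ 𝓝 (0 : EuclideanSpace ℝ (Fin d))) (hb : Bornology.IsBounded K) :
    IsFiniteMeasure (surfaceMeasure K) := by
  obtain ⟨m, rfl⟩ := Nat.exists_eq_add_of_le' hd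
  obtain ⟨C, hC⟩ := lipschitzOnWith_inv_gauge_smul hK h0 hb
  obtain ⟨b, hb0, hb⟩ := exists_norm_le_mul_gauge h0 hb
  let B : Set (EuclideanSpace ℝ (Fin m)) := Metric.closedBall 0 (√m)
  have hone : ∀ (i : Fin (m + 1)) (c : ℝ) (u), |c| = 1 → 1 ≤ ‖insertCoord i c u‖ := by
    intro i c u hc
    have := PiLp.norm_apply_le (insertCoord i c u) i
    simpa [insertCoord, hc] using this
  have hcov : frontier K ⊆ ⋃ (i : Fin (m + 1)) (c ∈ ({1, -1} : Finset ℝ)),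
      (fun x => (gauge K x)⁻¹ • x) '' (insertCoord i c '' B) := by
    intro w hw
    have hgw : gauge K w = 1 := (gauge_eq_one_iff_mem_frontier hK h0).2 hw
    obtain ⟨i, hi⟩ := Finite.exists_max fun i => |w i|
    have hwi : w i ≠ 0 := by
      intro h
      have : w = 0 := by
        ext j
        have := hi j
        rw [h, abs_zero] at this
        simpa using this
      rw [this, gauge_zero] at hgw
      exact zero_ne_one hgw
    have habs : 0 < |w i| := abs_pos.2 hwi
    have hx : insertCoord i (|w i|⁻¹ * w i) (WithLp.toLp 2 fun j => |w i|⁻¹ * w (i.succAbove j)) =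
        |w i|⁻¹ • w := by
      ext j
      rcases Fin.eq_self_or_eq_succAbove i j with rfl | ⟨j, rfl⟩ <;> simp [insertCoord]
    refine mem_iUnion.2 ⟨i, mem_iUnion₂.2 ⟨|w i|⁻¹ * w i, ?_, |w i|⁻¹ • w,
      ⟨WithLp.toLp 2 fun j => |w i|⁻¹ * w (i.succAbove j), ?_, hx⟩, ?_⟩⟩
    · simp only [Finset.mem_insert, Finset.mem_singleton]
      rcases abs_choice (w i) with h | h <;> rw [h]
      · left; exact inv_mul_cancel₀ hwi
      · right; rw [← neg_inv, neg_mul, inv_mul_cancel₀ hwi]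
    · rw [mem_closedBall_zero_iff, EuclideanSpace.norm_eq]
      apply Real.sqrt_le_sqrt
      refine (Finset.sum_le_card_nsmul _ _ 1 fun j _ => ?_).trans (by simp)
      rw [sq_le_one_iff_abs_le_one, abs_norm, norm_mul, norm_inv, Real.norm_eq_abs, abs_abs,
        inv_mul_le_iff₀ habs, mul_one]
      exact hi _
    · simp only
      rw [gauge_smul_of_nonneg (by positivity), hgw, smul_smul, smul_eq_mul, mul_one, inv_inv,
        mul_inv_cancel₀ habs.ne', one_smul]
  refine ⟨?_⟩
  rw [surfaceMeasure, Measure.restrict_apply_univ, Nat.add_sub_cancel]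
  refine (measure_mono hcov).trans_lt ((measure_iUnion_le _).trans_lt ?_)
  rw [tsum_fintype]
  refine ENNReal.sum_lt_top.2 fun i _ => (measure_biUnion_finset_le _ _).trans_lt
    (ENNReal.sum_lt_top.2 fun c hc => ?_)
  have hc1 : |c| = 1 := by
    simp only [Finset.mem_insert, Finset.mem_singleton] at hc
    rcases hc with rfl | rfl <;> simp
  have hlip : LipschitzOnWith C (fun x => (gauge K x)⁻¹ • x) (insertCoord i c '' B) :=
    hC.mono (image_subset_iff.2 fun u _ => hone i c u hc1)
  refine (hlip.euclideanHausdorffMeasure_image_le m).trans_lt ?_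
  rw [(isometry_insertCoord i c).euclideanHausdorffMeasure_image,
    EuclideanSpace.euclideanHausdorffMeasure_eq_volume]
  exact ENNReal.mul_lt_top (ENNReal.pow_lt_top ENNReal.coe_lt_top) measure_closedBall_lt_top

/-- The surface measure of a convex body is lower regular. -/
theorem exists_le_surfaceMeasure_closedBall (hd : 1 ≤ d) (hK : Convex ℝ K)
    (h0 : K ∈ 𝓝 (0 : EuclideanSpace ℝ (Fin d))) (hb : Bornology.IsBounded K)
    (hs : ∀ x ∈ K, -x ∈ K) :
    ∃ c r₀ : ℝ, 0 < c ∧ 0 < r₀ ∧ ∀ w ∈ frontier K, ∀ r, 0 < r → r ≤ r₀ →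
      ENNReal.ofReal (c * r ^ (d - 1)) ≤ surfaceMeasure K (Metric.closedBall w r) := by
  obtain ⟨m, rfl⟩ := Nat.exists_eq_add_of_le' hd
  obtain ⟨b, hb0, hb⟩ := exists_norm_le_mul_gauge h0 hb
  obtain ⟨ρ, hρ0, hρ⟩ := exists_mul_gauge_le_norm h0
  set v := volume (Metric.closedBall (0 : EuclideanSpace ℝ (Fin m)) 1) with hv
  have hv0 : 0 < v := Metric.measure_closedBall_pos _ _ one_pos
  have hvt : v ≠ ∞ := measure_closedBall_lt_top.ne
  -- Orthogonal projection along `w` does not increase area, so it is enough that the boundary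
  -- within `r` of `w` projects onto a ball of radius `r / D`. The boundary point found above `u`
  -- lies within `‖u‖ + (‖u‖ / ρ) * b = ‖u‖ * D` of `w`.
  set D := 1 + b / ρ with hD
  have hD1 : 1 ≤ D := by rw [hD]; linarith [div_pos hb0 hρ0]
  refine ⟨v.toReal / D ^ m, ρ, div_pos (ENNReal.toReal_pos hv0.ne' hvt) (by positivity), hρ0,
    fun w hw r hr hrρ => ?_⟩
  have hgw : gauge K w = 1 := (gauge_eq_one_iff_mem_frontier hK h0).2 hw
  have hw0 : w ≠ 0 := by
    rintro rfl
    rw [gauge_zero] at hgw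
    exact zero_ne_one hgw
  have hfact : Fact (Module.finrank ℝ (EuclideanSpace ℝ (Fin (m + 1))) = m + 1) := ⟨by simp⟩
  have hfr : Module.finrank ℝ (Submodule.span ℝ {w})ᗮ = m :=
    Submodule.finrank_orthogonal_span_singleton hw0
  let e : (Submodule.span ℝ {w})ᗮ ≃ₗᵢ[ℝ] EuclideanSpace ℝ (Fin m) :=
    ((stdOrthonormalBasis ℝ _).reindex (finCongr hfr)).repr
  let P : EuclideanSpace ℝ (Fin (m + 1)) → EuclideanSpace ℝ (Fin m) :=
    fun x => e ((Submodule.span ℝ {w})ᗮ.orthogonalProjectionOnto x)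
  have hP : LipschitzWith 1 P := by
    have : LipschitzWith (1 * 1) P := e.lipschitz.comp
      (Submodule.lipschitzWith_orthogonalProjectionOnto (Submodule.span ℝ {w})ᗮ)
    rwa [one_mul] at this
  have hsub : Metric.closedBall (0 : EuclideanSpace ℝ (Fin m)) (r / D) ⊆
      P '' (Metric.closedBall w r ∩ frontier K) := by
    intro u' hu'
    set u := e.symm u' with hu
    have hnu : ‖u‖ ≤ r / D := by
      rw [hu, LinearIsometryEquiv.norm_map]
      exact mem_closedBall_zero_iff.1 hu'
    have hnu' : ‖u‖ ≤ ρ := hnu.trans ((div_le_self hr.le hD1).trans hrρ)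
    set δ := ‖u‖ / ρ with hδ
    have hδ0 : 0 ≤ δ := by positivity
    have hδ1 : δ ≤ 1 := (div_le_one hρ0).2 hnu'
    have hgu : gauge K (u : EuclideanSpace ℝ (Fin (m + 1))) ≤ δ := by
      rw [hδ, le_div_iff₀ hρ0, mul_comm]
      exact hρ _
    have habs := absorbent_nhds_zero (𝕜 := ℝ) h0
    let h : ℝ → ℝ := fun s => gauge K ((u : EuclideanSpace ℝ (Fin (m + 1))) + s • w)
    -- The triangle inequality for the gauge gives `h ≤ 1` at `1 - δ` and `h ≥ 1` at `1 + δ`, so the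
    -- line through `u` in direction `w` meets the boundary in between.
    have hcont : Continuous h := (continuous_gauge hK h0).comp (by fun_prop)
    have hlo : h (1 - δ) ≤ 1 := by
      refine (gauge_add_le hK habs _ _).trans ?_
      rw [gauge_smul_of_nonneg (by linarith), hgw, smul_eq_mul]
      linarith
    have hhi : 1 ≤ h (1 + δ) := by
      have h1 := gauge_add_le hK habs ((u : EuclideanSpace ℝ (Fin (m + 1))) + (1 + δ) • w) (-u)
      rw [add_neg_cancel_comm, gauge_smul_of_nonneg (by linarith), hgw, smul_eq_mul,
        gauge_neg hs] at h1
      have : h (1 + δ) = gauge K ((u : EuclideanSpace ℝ (Fin (m + 1))) + (1 + δ) • w) := rfl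
      linarith
    obtain ⟨s, hs1, hs2⟩ := intermediate_value_Icc (by linarith : 1 - δ ≤ 1 + δ)
      hcont.continuousOn ⟨hlo, hhi⟩
    refine ⟨(u : EuclideanSpace ℝ (Fin (m + 1))) + s • w, ⟨?_, ?_⟩, ?_⟩
    · rw [Metric.mem_closedBall, dist_eq_norm,
        show (u : EuclideanSpace ℝ (Fin (m + 1))) + s • w - w = u + (s - 1) • w by
          rw [sub_smul, one_smul]; abel]
      refine (norm_add_le _ _).trans ?_
      rw [norm_smul]
      have h1 : ‖s - 1‖ ≤ δ := by
        rw [Real.norm_eq_abs, abs_le]; constructor <;> linarith [hs1.1, hs1.2]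
      have h2 : ‖w‖ ≤ b := by simpa [hgw] using hb w
      have h3 : ‖(u : EuclideanSpace ℝ (Fin (m + 1)))‖ = ‖u‖ := rfl
      calc _ ≤ ‖u‖ + δ * b := by rw [h3]; gcongr
        _ = ‖u‖ * D := by rw [hδ, hD]; ring
        _ ≤ r / D * D := by gcongr
        _ = r := div_mul_cancel₀ _ (by positivity)
    · exact (gauge_eq_one_iff_mem_frontier hK h0).1 hs2
    · have h1 : (Submodule.span ℝ {w})ᗮ.orthogonalProjectionOnto w = 0 := by
        rw [Submodule.orthogonalProjectionOnto_eq_zero_iff]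
        exact Submodule.le_orthogonal_orthogonal _ (Submodule.mem_span_singleton_self w)
      simp only [P]
      rw [map_add, map_smul, h1, smul_zero, add_zero,
        Submodule.orthogonalProjectionOnto_mem_subspace_eq_self, hu]
      simp
  rw [surfaceMeasure, Measure.restrict_apply Metric.isClosed_closedBall.measurableSet,
    Nat.add_sub_cancel]
  calc ENNReal.ofReal (v.toReal / D ^ m * r ^ m)
      = volume (Metric.closedBall (0 : EuclideanSpace ℝ (Fin m)) (r / D)) := by
        rw [Measure.addHaar_closedBall' _ _ (by positivity), finrank_euclideanSpace_fin,
          ← hv, ← ENNReal.ofReal_toReal hvt, ← ENNReal.ofReal_mul (by positivity),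
          ENNReal.toReal_ofReal ENNReal.toReal_nonneg, div_pow]
        congr 1
        ring
    _ ≤ volume (P '' (Metric.closedBall w r ∩ frontier K)) := measure_mono hsub
    _ ≤ _ := by
        rw [← EuclideanSpace.euclideanHausdorffMeasure_eq_volume]
        simpa using (hP.lipschitzOnWith (s := Metric.closedBall w r ∩ frontier K)
          ).euclideanHausdorffMeasure_image_le m

end SurfaceMeasure


/-! ### From energy to absolute continuity of the distance measure. -/

section DistanceMeasure

open Filter Topology

variable {d : ℕ} {K : Set (EuclideanSpace ℝ (Fin d))}

/-- The energy integral `∫ |μ̂(ξ)|² |σ̂_K(tξ)| dξ` that bounds the density of the distance measure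
at `t`. -/
noncomputable def distEnergy (K : Set (EuclideanSpace ℝ (Fin d)))
    (μ : Measure (EuclideanSpace ℝ (Fin d))) (t : ℝ) : ℝ≥0∞ :=
  ∫⁻ ξ, ‖fourierMeasure μ ξ‖ₑ ^ 2 * ‖fourierMeasure (surfaceMeasure K) (t • ξ)‖ₑ

/-- The Gaussian bound applied to the convolution of `diffMeasure μ μ` with the surface measure
dilated by `-t`, whose transform is a product. -/
theorem lintegral_gaussKernel_diffMeasure_le [IsFiniteMeasure (surfaceMeasure K)]
    (μ : Measure (EuclideanSpace ℝ (Fin d))) [IsFiniteMeasure μ] (t : ℝ) {R : ℝ} (hR : 0 < R) :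
    ∫⁻ z, ∫⁻ w, ENNReal.ofReal (gaussKernel R (z - t • w)) ∂(surfaceMeasure K)
      ∂(diffMeasure μ μ) ≤ distEnergy K μ t := by
  have h := lintegral_gaussKernel_le (diffMeasure μ μ ∗ (surfaceMeasure K).map ((-t) • ·)) hR
  have hm := (continuous_gaussKernel (d := d) R).measurable.ennreal_ofReal
  rw [Measure.lintegral_conv hm] at h
  refine le_trans (le_of_eq (lintegral_congr fun z => ?_)) (h.trans (le_of_eq ?_))
  · rw [lintegral_map (f := fun y => ENNReal.ofReal (gaussKernel R (z + y)))
      (hm.comp (measurable_const.add measurable_id)) (by fun_prop)]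
    simp [sub_eq_add_neg]
  · refine lintegral_congr fun ξ => ?_
    rw [fourierMeasure_conv, fourierMeasure_map_smul, enorm_mul,
      enorm_fourierMeasure_diffMeasure_self, neg_smul, enorm_fourierMeasure_neg]

/-- The distance measure of an interval is bounded by its length and the energy at its centre. -/
theorem exists_diffMeasure_gauge_le (hd : 1 ≤ d) (hK : Convex ℝ K)
    (h0 : K ∈ 𝓝 (0 : EuclideanSpace ℝ (Fin d))) (hb : Bornology.IsBounded K)
    (hs : ∀ x ∈ K, -x ∈ K) {a b : ℝ} (ha : 0 < a) :
    ∃ C r₁ : ℝ, 0 < r₁ ∧ ∀ (μ : Measure (EuclideanSpace ℝ (Fin d))) [IsFiniteMeasure μ],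
      ∀ t ∈ Icc a b, ∀ r, 0 < r → r ≤ r₁ →
        diffMeasure μ μ {z | |gauge K z - t| ≤ r} ≤ ENNReal.ofReal (C * r) * distEnergy K μ t := by
  have hfin := isFiniteMeasure_surfaceMeasure hd hK h0 hb
  obtain ⟨c, r₀, hc, hr₀, hreg⟩ := exists_le_surfaceMeasure_closedBall hd hK h0 hb hs
  obtain ⟨B, hB0, hB⟩ := exists_norm_le_mul_gauge h0 hb
  by_cases hab : b < a
  · exact ⟨0, 1, one_pos, fun μ _ t ht => absurd (ht.1.trans ht.2) (not_le.2 hab)⟩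
  have hb0 : 0 < b := ha.trans_le (not_lt.1 hab)
  -- The exponential is the least Gaussian factor at distance at most `2 * ε` for scale `ε`; `c / b
  -- ^ (d - 1)` comes from lower regularity at radius `ε / t` with `t ≤ b`.
  set κ := Real.exp (-(4 * Real.pi)) * c / b ^ (d - 1) with hκ
  have hκ0 : 0 < κ := by positivity
  -- The first bound on `r` keeps the shell away from the origin; the second makes `ε / t ≤ r₀`, the
  -- range of lower regularity.
  refine ⟨B / κ, min (a / 2) (r₀ * a / B), by positivity, fun μ _ t ht r hr hrr => ?_⟩
  have ht0 : 0 < t := ha.trans_le ht.1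
  have hra : r < a := lt_of_le_of_lt (hrr.trans (min_le_left _ _)) (by linarith)
  have hrB : r * B ≤ r₀ * a := by
    have := hrr.trans (min_le_right _ _)
    rwa [le_div_iff₀ hB0] at this
  -- Each point of the shell is within Euclidean distance `ε` of its radial projection to
  -- $t\,\partial K$.
  set ε := r * B with hε
  have hε0 : 0 < ε := by positivity
  have hmeasg : Measurable (gauge K) := (continuous_gauge hK h0).measurable
  have hA : MeasurableSet {z : EuclideanSpace ℝ (Fin d) | |gauge K z - t| ≤ r} :=
    measurableSet_le ((hmeasg.sub_const t).abs) measurable_const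
  have hlow : ∀ z ∈ {z : EuclideanSpace ℝ (Fin d) | |gauge K z - t| ≤ r},
      ENNReal.ofReal (κ / ε) ≤
        ∫⁻ w, ENNReal.ofReal (gaussKernel ε⁻¹ (z - t • w)) ∂(surfaceMeasure K) := by
    intro z hz
    have hz' : |gauge K z - t| ≤ r := hz
    have hgz : 0 < gauge K z := by
      have := (abs_le.1 hz').1
      linarith [ht.1]
    set w₀ := (gauge K z)⁻¹ • z with hw₀
    have hw₀f : w₀ ∈ frontier K := by
      rw [← gauge_eq_one_iff_mem_frontier hK h0, hw₀, gauge_smul_of_nonneg (by positivity),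
        smul_eq_mul, inv_mul_cancel₀ hgz.ne']
    have hzw : ‖z - t • w₀‖ ≤ ε := by
      have h1 : z - t • w₀ = ((gauge K z - t) * (gauge K z)⁻¹) • z := by
        rw [hw₀, sub_mul, mul_inv_cancel₀ hgz.ne', sub_smul, one_smul, smul_smul]
      rw [h1, norm_smul, norm_mul, norm_inv, Real.norm_of_nonneg hgz.le, Real.norm_eq_abs,
        mul_assoc, hε]
      gcongr
      rw [inv_mul_le_iff₀ hgz, mul_comm]
      exact hB z
    have hsub : ∀ w ∈ Metric.closedBall w₀ (ε / t), ENNReal.ofReal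
        (ε⁻¹ ^ d * Real.exp (-(4 * Real.pi))) ≤
          ENNReal.ofReal (gaussKernel ε⁻¹ (z - t • w)) := by
      intro w hw
      apply ENNReal.ofReal_le_ofReal
      rw [gaussKernel]
      have h2 : ‖z - t • w‖ ≤ 2 * ε := by
        have h3 : z - t • w = (z - t • w₀) + t • (w₀ - w) := by
          rw [smul_sub]; abel
        rw [Metric.mem_closedBall, dist_comm, dist_eq_norm, le_div_iff₀ ht0] at hw
        rw [h3]
        refine (norm_add_le _ _).trans ?_
        rw [norm_smul, Real.norm_of_nonneg ht0.le]
        linarith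
      refine mul_le_mul_of_nonneg_left (Real.exp_le_exp.2 (neg_le_neg ?_)) (by positivity)
      calc Real.pi * ε⁻¹ ^ 2 * ‖z - t • w‖ ^ 2 ≤ Real.pi * ε⁻¹ ^ 2 * (2 * ε) ^ 2 := by gcongr
        _ = 4 * Real.pi := by field_simp; ring
    calc ENNReal.ofReal (κ / ε)
        ≤ ENNReal.ofReal (ε⁻¹ ^ d * Real.exp (-(4 * Real.pi))) *
            ENNReal.ofReal (c * (ε / t) ^ (d - 1)) := by
          rw [← ENNReal.ofReal_mul (by positivity)]
          apply ENNReal.ofReal_le_ofReal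
          have h4 : t ^ (d - 1) ≤ b ^ (d - 1) := pow_le_pow_left₀ ht0.le ht.2 _
          calc κ / ε ≤ Real.exp (-(4 * Real.pi)) * c / t ^ (d - 1) / ε := by
                rw [hκ]; gcongr
            _ = _ := by
                obtain ⟨m, rfl⟩ := Nat.exists_eq_add_of_le' hd
                rw [Nat.add_sub_cancel, div_pow, pow_succ, inv_pow]
                field_simp
      _ ≤ ENNReal.ofReal (ε⁻¹ ^ d * Real.exp (-(4 * Real.pi))) *
            surfaceMeasure K (Metric.closedBall w₀ (ε / t)) := by
          gcongr
          refine hreg w₀ hw₀f _ (by positivity) ?_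
          rw [div_le_iff₀ ht0]
          exact hrB.trans (by gcongr; exact ht.1)
      _ = ∫⁻ _ in Metric.closedBall w₀ (ε / t), ENNReal.ofReal
            (ε⁻¹ ^ d * Real.exp (-(4 * Real.pi))) ∂(surfaceMeasure K) := by
          rw [lintegral_const, Measure.restrict_apply_univ]
      _ ≤ ∫⁻ w in Metric.closedBall w₀ (ε / t),
            ENNReal.ofReal (gaussKernel ε⁻¹ (z - t • w)) ∂(surfaceMeasure K) :=
          setLIntegral_mono' Metric.isClosed_closedBall.measurableSet hsub
      _ ≤ _ := setLIntegral_le_lintegral _ _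
  have hmul : ENNReal.ofReal (κ / ε) * diffMeasure μ μ {z | |gauge K z - t| ≤ r} ≤
      distEnergy K μ t := by
    calc _ = ∫⁻ _ in {z | |gauge K z - t| ≤ r}, ENNReal.ofReal (κ / ε) ∂(diffMeasure μ μ) := by
          rw [lintegral_const, Measure.restrict_apply_univ]
      _ ≤ _ := setLIntegral_mono' hA hlow
      _ ≤ _ := setLIntegral_le_lintegral _ _
      _ ≤ _ := lintegral_gaussKernel_diffMeasure_le μ t (inv_pos.2 hε0)
  calc diffMeasure μ μ {z | |gauge K z - t| ≤ r}
      = ENNReal.ofReal (B / κ * r) * (ENNReal.ofReal (κ / ε) *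
          diffMeasure μ μ {z | |gauge K z - t| ≤ r}) := by
        rw [← mul_assoc, ← ENNReal.ofReal_mul (by positivity)]
        rw [show B / κ * r * (κ / ε) = 1 by rw [hε]; field_simp, ENNReal.ofReal_one, one_mul]
    _ ≤ _ := by gcongr

/-- A measure on the line is absolutely continuous on an interval where its mass on small balls is
controlled by an integrable function of the centre. -/
theorem measure_inter_Ioo_eq_zero_of_closedBall_le {ν : Measure ℝ} [IsFiniteMeasure ν]
    {Φ : ℝ → ℝ≥0∞} {a b C r₁ : ℝ} (hr₁ : 0 < r₁)
    (hΦ : ∫⁻ t in Icc a b, Φ t ≠ ∞)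
    (h : ∀ t ∈ Icc a b, ∀ r, 0 < r → r ≤ r₁ →
      ν (Metric.closedBall t r) ≤ ENNReal.ofReal (C * r) * Φ t)
    {N : Set ℝ} (hN : MeasurableSet N) (hN0 : volume N = 0) : ν (N ∩ Ioo a b) = 0 := by
  -- Inner regularity reduces to compact `L`, whose small closed thickenings remain in the interval.
  rw [(hN.inter measurableSet_Ioo).measure_eq_iSup_isCompact_of_ne_top (measure_ne_top _ _)]
  simp only [ENNReal.iSup_eq_zero]
  intro L hLN hL
  set m := (volume.restrict (Icc a b)).withDensity Φ with hm
  have hmfin : IsFiniteMeasure m := isFiniteMeasure_withDensity hΦ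
  have hmL : m L = 0 := by
    refine withDensity_absolutelyContinuous _ _ ?_
    exact measure_mono_null (hLN.trans inter_subset_left)
      (Measure.absolutelyContinuous_of_le Measure.restrict_le_self hN0)
  obtain ⟨δ, hδ0, hδ⟩ := hL.exists_cthickening_subset_open isOpen_Ioo
    (hLN.trans inter_subset_right)
  have hbound : ∀ r, 0 < r → r ≤ min r₁ δ →
      ν L ≤ ENNReal.ofReal (C / 2) * m (Metric.cthickening r L) := by
    intro r hr hrr
    have hsub : Metric.cthickening r L ⊆ Icc a b :=
      (Metric.cthickening_mono (hrr.trans (min_le_right _ _)) L).trans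
        (hδ.trans Ioo_subset_Icc_self)
    have hS : MeasurableSet {p : ℝ × ℝ | p.1 ∈ L ∧ p.2 ∈ Metric.closedBall p.1 r} := by
      refine (measurable_fst hL.measurableSet).inter ?_
      exact (isClosed_le (continuous_snd.dist continuous_fst) continuous_const).measurableSet
    -- Double counting of the pairs with `s ∈ L` and `|t - s| ≤ r`: integrating in `t` first gives
    -- `2 * r * ν L`, and in `s` first the masses of balls centred in the thickening.
    have h1 : ENNReal.ofReal (2 * r) * ν L = ∫⁻ s, (∫⁻ t,
        {p : ℝ × ℝ | p.1 ∈ L ∧ p.2 ∈ Metric.closedBall p.1 r}.indicator 1 (s, t)) ∂ν := by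
      calc _ = ∫⁻ s, L.indicator (fun _ => ENNReal.ofReal (2 * r)) s ∂ν := by
            rw [lintegral_indicator_const hL.measurableSet]
        _ = _ := by
            refine lintegral_congr fun s => ?_
            by_cases hs : s ∈ L
            · rw [indicator_of_mem hs, ← Real.volume_closedBall s r,
                ← lintegral_indicator_one Metric.isClosed_closedBall.measurableSet]
              refine lintegral_congr fun t => ?_
              by_cases ht : t ∈ Metric.closedBall s r
              · rw [indicator_of_mem ht, indicator_of_mem (by exact ⟨hs, ht⟩)]; rfl
              · rw [indicator_of_notMem ht, indicator_of_notMem fun h => ht h.2]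
            · rw [indicator_of_notMem hs, eq_comm, ← lintegral_zero (μ := (volume : Measure ℝ))]
              exact lintegral_congr fun t => indicator_of_notMem (fun h => hs h.1) _
    have h2 : ENNReal.ofReal (2 * r) * ν L ≤
        ENNReal.ofReal (C * r) * m (Metric.cthickening r L) := by
      rw [h1, lintegral_lintegral_swap (f := fun s t =>
        {p : ℝ × ℝ | p.1 ∈ L ∧ p.2 ∈ Metric.closedBall p.1 r}.indicator 1 (s, t))
        ((measurable_one.indicator hS).aemeasurable)]
      calc _ ≤ ∫⁻ t, (Metric.cthickening r L).indicator
            (fun t => ENNReal.ofReal (C * r) * Φ t) t := by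
            refine lintegral_mono fun t => ?_
            by_cases ht : t ∈ Metric.cthickening r L
            · rw [indicator_of_mem ht]
              refine le_trans ?_ (h t (hsub ht) r hr (hrr.trans (min_le_left _ _)))
              rw [← lintegral_indicator_one Metric.isClosed_closedBall.measurableSet]
              refine lintegral_mono fun s => ?_
              by_cases hst : s ∈ L ∧ t ∈ Metric.closedBall s r
              · rw [indicator_of_mem (by exact hst),
                  indicator_of_mem (by exact Metric.mem_closedBall_comm.1 hst.2)]
                exact le_rfl
              · rw [indicator_of_notMem (by exact hst)]
                exact zero_le
            · rw [indicator_of_notMem ht]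
              refine le_of_eq ?_
              rw [← lintegral_zero (μ := ν)]
              refine lintegral_congr fun s => indicator_of_notMem (fun h => ht ?_) _
              exact Metric.mem_cthickening_of_dist_le t s r L h.1 h.2
        _ = _ := by
            rw [lintegral_indicator Metric.isClosed_cthickening.measurableSet,
              lintegral_const_mul' _ _ ENNReal.ofReal_ne_top, hm,
              withDensity_apply' , Measure.restrict_restrict
                Metric.isClosed_cthickening.measurableSet, inter_eq_left.2 hsub]
    have h3 : ENNReal.ofReal (C * r) = ENNReal.ofReal (2 * r) * ENNReal.ofReal (C / 2) := by
      rw [← ENNReal.ofReal_mul (by positivity)]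
      congr 1
      ring
    rw [h3, mul_assoc] at h2
    exact (ENNReal.mul_le_mul_iff_right (by simpa using hr) ENNReal.ofReal_ne_top).1 h2
  -- The closed thickenings shrink to `L`, which is null for the finite measure `m` as it has a
  -- density.
  have hlim : Tendsto (fun r => ENNReal.ofReal (C / 2) * m (Metric.cthickening r L)) (𝓝[>] 0)
      (𝓝 0) := by
    have h4 := tendsto_measure_cthickening_of_isClosed (μ := m)
      ⟨1, one_pos, measure_ne_top _ _⟩ hL.isClosed
    rw [hmL] at h4
    have h5 := ENNReal.Tendsto.const_mul (h4.mono_left (nhdsWithin_le_nhds (s := Ioi (0 : ℝ))))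
      (Or.inr (ENNReal.ofReal_ne_top (r := C / 2)))
    rwa [mul_zero] at h5
  refine le_antisymm (ge_of_tendsto hlim ?_) bot_le
  have : Ioc 0 (min r₁ δ) ∈ 𝓝[>] (0 : ℝ) := Ioc_mem_nhdsGT (by positivity)
  filter_upwards [this] with r hr
  exact hbound r hr.1 hr.2

end DistanceMeasure


/-! ### The criterion for positive length, and non-integrability of the surface transform. -/

section Criterion

open Filter Topology

variable {d : ℕ} {K : Set (EuclideanSpace ℝ (Fin d))}

theorem diffMeasure_apply (μ ν : Measure (EuclideanSpace ℝ (Fin d))) [IsFiniteMeasure μ]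
    [IsFiniteMeasure ν] {S : Set (EuclideanSpace ℝ (Fin d))} (hS : MeasurableSet S) :
    diffMeasure μ ν S = ∫⁻ x, ν {y | x - y ∈ S} ∂μ := by
  rw [← lintegral_indicator_one hS, lintegral_diffMeasure _ _ (measurable_one.indicator hS)]
  refine lintegral_congr fun x => ?_
  have hm : MeasurableSet {y | x - y ∈ S} := (measurable_const.sub measurable_id) hS
  rw [← lintegral_indicator_one hm]
  rfl

theorem diffMeasure_apply_eq_zero_iff (μ ν : Measure (EuclideanSpace ℝ (Fin d)))
    [IsFiniteMeasure μ] [IsFiniteMeasure ν] {S : Set (EuclideanSpace ℝ (Fin d))}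
    (hS : MeasurableSet S) :
    diffMeasure μ ν S = 0 ↔ ∀ᵐ x ∂μ, ν {y | x - y ∈ S} = 0 := by
  rw [diffMeasure_apply μ ν hS, lintegral_eq_zero_iff]
  · rfl
  · exact measurable_measure_prodMk_left ((measurable_fst.sub measurable_snd) hS)

/-- The distance set of a carrier of a measure of locally integrable distance energy has positive
length, unless the measure is a point mass. -/
theorem volume_kDistSet_pos (hd : 1 ≤ d) (hK : Convex ℝ K)
    (h0 : K ∈ 𝓝 (0 : EuclideanSpace ℝ (Fin d))) (hb : Bornology.IsBounded K)
    (hs : ∀ x ∈ K, -x ∈ K) {E : Set (EuclideanSpace ℝ (Fin d))}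
    {μ : Measure (EuclideanSpace ℝ (Fin d))} [IsFiniteMeasure μ] (hμE : μ Eᶜ = 0)
    (hpt : ∀ x, μ {x}ᶜ ≠ 0)
    (hen : ∀ a b : ℝ, 0 < a → ∫⁻ t in Icc a b, distEnergy K μ t ≠ ∞) :
    0 < volume (kDistSet K E) := by
  refine pos_iff_ne_zero.2 fun hv => ?_
  have hmeasg : Measurable (gauge K) := (continuous_gauge hK h0).measurable
  set N := toMeasurable volume (kDistSet K E) with hNdef
  have hN : MeasurableSet N := measurableSet_toMeasurable _ _
  have hN0 : volume N = 0 := by rw [measure_toMeasurable, hv]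
  have hout : diffMeasure μ μ (gauge K ⁻¹' Nᶜ) = 0 := by
    rw [diffMeasure_apply_eq_zero_iff _ _ (hmeasg hN.compl)]
    have hE : ∀ᵐ x ∂μ, x ∈ E := hμE
    filter_upwards [hE] with x hx
    refine measure_mono_null (t := Eᶜ) (fun y hy (hyE : y ∈ E) => hy ?_) hμE
    exact subset_toMeasurable _ _ ⟨x, hx, y, hyE, rfl⟩
  have hin : ∀ a b : ℝ, 0 < a → diffMeasure μ μ (gauge K ⁻¹' (N ∩ Ioo a b)) = 0 := by
    intro a b ha
    obtain ⟨C, r₁, hr₁, hC⟩ := exists_diffMeasure_gauge_le hd hK h0 hb hs (b := b) ha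
    rw [← Measure.map_apply hmeasg (hN.inter measurableSet_Ioo)]
    refine measure_inter_Ioo_eq_zero_of_closedBall_le (C := C) hr₁ (hen a b ha)
      (fun t ht r hr hrr => ?_) hN hN0
    rw [Measure.map_apply hmeasg Metric.isClosed_closedBall.measurableSet]
    exact hC μ t ht r hr hrr
  -- Nonzero differences have positive gauge, and countably many intervals exhaust the half-line.
  -- Hence almost all differences vanish, so `μ` is concentrated at one point.
  have hne : diffMeasure μ μ {0}ᶜ = 0 := by
    refine measure_mono_null (t := gauge K ⁻¹' Nᶜ ∪
      ⋃ n : ℕ, gauge K ⁻¹' (N ∩ Ioo (1 / ((n : ℝ) + 1)) (n + 1))) (fun z hz => ?_)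
      (measure_union_null hout (measure_iUnion_null fun n => hin _ _ (by positivity)))
    by_cases hzN : gauge K z ∈ N
    · refine Or.inr (mem_iUnion.2 ?_)
      have hgz : 0 < gauge K z := (gauge_pos (absorbent_nhds_zero h0)
        ((NormedSpace.isVonNBounded_iff ℝ).2 hb)).2 hz
      obtain ⟨n, hn⟩ := exists_nat_one_div_lt hgz
      obtain ⟨m, hm⟩ := exists_nat_gt (gauge K z)
      refine ⟨max n m, hzN, lt_of_le_of_lt ?_ hn, ?_⟩
      · gcongr
        exact le_max_left _ _
      · have : (m : ℝ) ≤ (max n m : ℕ) := by exact_mod_cast le_max_right _ _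
        linarith
    · exact Or.inl hzN
  rw [diffMeasure_apply_eq_zero_iff _ _ (measurableSet_singleton 0).compl] at hne
  have hex : ∃ x, μ {y | x - y ∈ ({0} : Set (EuclideanSpace ℝ (Fin d)))ᶜ} = 0 := by
    by_cases hμ : μ = 0
    · exact ⟨0, by simp [hμ]⟩
    · have : NeZero μ := ⟨hμ⟩
      exact hne.exists
  obtain ⟨x, hx⟩ := hex
  refine hpt x (measure_mono_null (fun y hy => ?_) hx)
  intro h
  exact hy (sub_eq_zero.1 h).symm

/-- The Fourier transform of the surface measure is not integrable. -/
theorem lintegral_fourierMeasure_surfaceMeasure_eq_top (hd : 1 ≤ d) (hK : Convex ℝ K)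
    (h0 : K ∈ 𝓝 (0 : EuclideanSpace ℝ (Fin d))) (hb : Bornology.IsBounded K)
    (hs : ∀ x ∈ K, -x ∈ K) :
    ∫⁻ ξ, ‖fourierMeasure (surfaceMeasure K) ξ‖ₑ = ∞ := by
  by_contra hfin
  have hsf := isFiniteMeasure_surfaceMeasure hd hK h0 hb
  obtain ⟨C, r₁, hr₁, hC⟩ := exists_diffMeasure_gauge_le hd hK h0 hb hs (a := 1) (b := 1) one_pos
  have : NeZero d := ⟨by omega⟩
  obtain ⟨v, hv⟩ := exists_ne (0 : EuclideanSpace ℝ (Fin d))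
  have hgv : 0 < gauge K v := (gauge_pos (absorbent_nhds_zero h0)
    ((NormedSpace.isVonNBounded_iff ℝ).2 hb)).2 hv
  set z := (gauge K v)⁻¹ • v with hz
  have hgz : gauge K z = 1 := by
    rw [hz, gauge_smul_of_nonneg (by positivity), smul_eq_mul, inv_mul_cancel₀ hgv.ne']
  -- This measure has the distance `1` with positive mass. An integrable transform would make its
  -- energy at `1` finite, and thin shells around the unit sphere of the gauge would have mass
  -- tending to zero.
  set μ := Measure.dirac (0 : EuclideanSpace ℝ (Fin d)) + Measure.dirac z with hμ
  have hmeasg : Measurable (gauge K) := (continuous_gauge hK h0).measurable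
  have hlow : ∀ r, 0 < r → 1 ≤ diffMeasure μ μ {w | |gauge K w - 1| ≤ r} := by
    intro r hr
    have hA : MeasurableSet {w : EuclideanSpace ℝ (Fin d) | |gauge K w - 1| ≤ r} :=
      measurableSet_le ((hmeasg.sub_const 1).abs) measurable_const
    rw [diffMeasure_apply _ _ hA]
    calc (1 : ℝ≥0∞) ≤ μ {y | z - y ∈ {w | |gauge K w - 1| ≤ r}} := by
          rw [hμ, Measure.add_apply]
          refine le_add_right ?_
          rw [Measure.dirac_apply_of_mem]
          simp [hgz, hr.le]
      _ = ∫⁻ x, μ {y | x - y ∈ {w | |gauge K w - 1| ≤ r}} ∂(Measure.dirac z) := by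
          rw [lintegral_dirac]
      _ ≤ _ := lintegral_mono' (Measure.le_add_left le_rfl) le_rfl
  have hen : distEnergy K μ 1 ≠ ∞ := by
    refine ne_top_of_le_ne_top (ENNReal.mul_ne_top (a := (μ univ) ^ 2) (by finiteness) hfin) ?_
    rw [distEnergy, ← lintegral_const_mul' _ _ (by finiteness)]
    refine lintegral_mono fun ξ => ?_
    rw [one_smul]
    gcongr
    exact enorm_fourierMeasure_le μ ξ
  have hlim : Tendsto (fun r => ENNReal.ofReal (C * r) * distEnergy K μ 1) (𝓝[>] 0) (𝓝 0) := by
    have h1 : Tendsto (fun r : ℝ => ENNReal.ofReal (C * r)) (𝓝[>] 0) (𝓝 0) := by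
      have : Continuous fun r : ℝ => ENNReal.ofReal (C * r) :=
        ENNReal.continuous_ofReal.comp (continuous_const_mul C)
      have h2 := this.tendsto 0
      simp only [mul_zero, ENNReal.ofReal_zero] at h2
      exact h2.mono_left nhdsWithin_le_nhds
    have h3 := ENNReal.Tendsto.mul_const h1 (Or.inr hen)
    rwa [zero_mul] at h3
  have : (1 : ℝ≥0∞) ≤ 0 := by
    refine ge_of_tendsto hlim ?_
    filter_upwards [Ioc_mem_nhdsGT hr₁] with r hr
    exact (hlow r hr.1).trans (hC μ 1 ⟨le_rfl, le_rfl⟩ r hr.1 hr.2)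
  exact absurd this (by simp)

end Criterion


/-! ### Energy bounds from pointwise decay and from convex decay. -/

section DecayBounds

open Filter Topology

variable {d : ℕ} {K : Set (EuclideanSpace ℝ (Fin d))}

theorem enorm_fourierMeasure_of_compl_singleton {μ : Measure (EuclideanSpace ℝ (Fin d))}
    [IsFiniteMeasure μ] {x : EuclideanSpace ℝ (Fin d)} (hx : μ {x}ᶜ = 0)
    (ξ : EuclideanSpace ℝ (Fin d)) : ‖fourierMeasure μ ξ‖ₑ = μ univ := by
  have hae : ∀ᵐ y ∂μ, y = x := hx
  have h : fourierMeasure μ ξ =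
      ∫ _, Complex.exp ((-2 * Real.pi * inner ℝ x ξ : ℝ) * Complex.I) ∂μ := by
    refine integral_congr_ae ?_
    filter_upwards [hae] with y hy
    rw [hy]
    push_cast
    ring_nf
  rw [h, integral_const, enorm_smul, ← ofReal_norm, ← ofReal_norm, Complex.norm_exp_ofReal_mul_I,
    ENNReal.ofReal_one, mul_one, Real.norm_of_nonneg measureReal_nonneg, ofReal_measureReal]

theorem ae_ne_zero_euclideanSpace (hd : 1 ≤ d) :
    ∀ᵐ ξ : EuclideanSpace ℝ (Fin d), ξ ≠ 0 := by
  have : NeZero d := ⟨by omega⟩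
  exact compl_mem_ae_iff.2 (measure_singleton 0)

/-- A criterion for distance sets of positive length in terms of bounded distance energies. -/
theorem volume_kDistSet_pos_of_le (hd : 1 ≤ d) (hK : Convex ℝ K)
    (h0 : K ∈ 𝓝 (0 : EuclideanSpace ℝ (Fin d))) (hb : Bornology.IsBounded K)
    (hs : ∀ x ∈ K, -x ∈ K) {E : Set (EuclideanSpace ℝ (Fin d))}
    {μ : Measure (EuclideanSpace ℝ (Fin d))} [IsFiniteMeasure μ] (hμE : μ Eᶜ = 0) (hμ : μ ≠ 0)
    (hen : ∀ a : ℝ, 0 < a → ∃ M : ℝ≥0∞, M ≠ ∞ ∧ ∀ t, a ≤ t → distEnergy K μ t ≤ M) :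
    0 < volume (kDistSet K E) := by
  refine volume_kDistSet_pos hd hK h0 hb hs hμE (fun x hx => ?_) fun a b ha => ?_
  -- The transform of a point mass has constant modulus, so its energy is a multiple of the
  -- divergent integral of the surface transform.
  · obtain ⟨M, hM, h⟩ := hen 1 one_pos
    have h1 : distEnergy K μ 1 = ∞ := by
      have hu : μ univ ≠ 0 := by simpa using hμ
      have : distEnergy K μ 1 =
          ∫⁻ ξ, μ univ ^ 2 * ‖fourierMeasure (surfaceMeasure K) ξ‖ₑ :=
        lintegral_congr fun ξ => by rw [enorm_fourierMeasure_of_compl_singleton hx, one_smul]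
      rw [this, lintegral_const_mul' _ _ (by finiteness),
        lintegral_fourierMeasure_surfaceMeasure_eq_top hd hK h0 hb hs,
        ENNReal.mul_top (pow_ne_zero 2 hu)]
    exact hM (top_le_iff.1 (h1 ▸ h 1 le_rfl))
  · obtain ⟨M, hM, h⟩ := hen a ha
    refine ne_top_of_le_ne_top (b := M * volume (Icc a b)) (ENNReal.mul_ne_top hM ?_) ?_
    · rw [Real.volume_Icc]; exact ENNReal.ofReal_ne_top
    · rw [← setLIntegral_const]
      exact setLIntegral_mono' measurableSet_Icc fun t ht => h t ht.1

/-- The trivial bound `A` serves small frequencies and the decay large ones. As `γ > 0`, `t ≥ a`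
makes the constant uniform in `t`. -/
theorem exists_le_mul_min_rpow {h : EuclideanSpace ℝ (Fin d) → ℝ≥0∞} {A : ℝ≥0∞} (hA : A ≠ ∞)
    (hhA : ∀ ξ, h ξ ≤ A) {C γ : ℝ} (hγ : 0 < γ)
    (hh : ∀ ξ, ξ ≠ 0 → h ξ ≤ ENNReal.ofReal (C * ‖ξ‖ ^ (-γ))) {a : ℝ} (ha : 0 < a) :
    ∃ M : ℝ≥0∞, M ≠ ∞ ∧ ∀ t, a ≤ t → ∀ ξ, ξ ≠ 0 →
      h (t • ξ) ≤ M * ENNReal.ofReal (min 1 (‖ξ‖ ^ (-γ))) := by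
  refine ⟨A + ENNReal.ofReal (C * a ^ (-γ)), by finiteness, fun t hat ξ hξ => ?_⟩
  have ht : 0 < t := ha.trans_le hat
  have hξ' : 0 < ‖ξ‖ := norm_pos_iff.2 hξ
  rcases le_total 1 (‖ξ‖ ^ (-γ)) with h1 | h1
  · rw [min_eq_left h1, ENNReal.ofReal_one, mul_one]
    exact (hhA _).trans le_self_add
  · rw [min_eq_right h1, add_mul]
    refine le_trans ?_ le_add_self
    refine (hh _ (smul_ne_zero ht.ne' hξ)).trans ?_
    rw [norm_smul, Real.norm_of_nonneg ht.le, Real.mul_rpow ht.le hξ'.le, ← mul_assoc,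
      ENNReal.ofReal_mul' (by positivity)]
    gcongr ?_ * _
    rcases le_total C 0 with hC | hC
    · rw [ENNReal.ofReal_of_nonpos (mul_nonpos_of_nonpos_of_nonneg hC (by positivity))]
      exact zero_le
    · exact ENNReal.ofReal_le_ofReal (mul_le_mul_of_nonneg_left
        (Real.rpow_le_rpow_of_nonpos ha hat (by linarith)) hC)

theorem le_of_lintegral_eq_top_of_decay (hd : 1 ≤ d) {h : EuclideanSpace ℝ (Fin d) → ℝ≥0∞}
    {A : ℝ≥0∞} (hA : A ≠ ∞) (hhA : ∀ ξ, h ξ ≤ A) {C γ : ℝ} (hγ : 0 < γ)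
    (hh : ∀ ξ, ξ ≠ 0 → h ξ ≤ ENNReal.ofReal (C * ‖ξ‖ ^ (-γ))) (htop : ∫⁻ ξ, h ξ = ∞) :
    γ ≤ d := by
  by_contra! hlt
  obtain ⟨M, hM, hle⟩ := exists_le_mul_min_rpow hA hhA hγ hh one_pos
  have hfin := lintegral_sq_fourierMeasure_mul_lt_top
    (μ := Measure.dirac (0 : EuclideanSpace ℝ (Fin d))) (s := 0) (C := 1) zero_le_one hγ
    (by simpa using hlt) (fun x r _ => by
      rw [Real.rpow_zero, mul_one, ENNReal.ofReal_one]; exact prob_le_one)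
  have hone : ∀ ξ, ‖fourierMeasure (Measure.dirac (0 : EuclideanSpace ℝ (Fin d))) ξ‖ₑ = 1 :=
    fun ξ => by
      rw [enorm_fourierMeasure_of_compl_singleton (x := 0) (by simp), measure_univ]
  simp only [hone, one_pow, one_mul] at hfin
  refine absurd htop (ne_top_of_le_ne_top (ENNReal.mul_ne_top hM hfin.ne) ?_)
  rw [← lintegral_const_mul' _ _ hM]
  refine lintegral_mono_ae ?_
  filter_upwards [ae_ne_zero_euclideanSpace hd] with ξ hξ
  simpa using hle 1 le_rfl ξ hξ

/-- A Borel set of large dimension carries a measure without point masses and of finite energy. -/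
theorem exists_measure_energy_lt_top {E : Set (EuclideanSpace ℝ (Fin d))}
    (hEm : MeasurableSet E) (hE : ∀ x ∈ E, ∀ i, x i ∈ Icc (0 : ℝ) 1) {γ : ℝ} (hγ : 0 < γ)
    (hγd : γ ≤ d) (hdim : (d : ℝ≥0∞) < dimH E + ENNReal.ofReal γ) :
    ∃ μ : Measure (EuclideanSpace ℝ (Fin d)), IsProbabilityMeasure μ ∧ μ Eᶜ = 0 ∧
      (∀ x, μ {x}ᶜ ≠ 0) ∧
      ∫⁻ ξ, ‖fourierMeasure μ ξ‖ₑ ^ 2 * ENNReal.ofReal (min 1 (‖ξ‖ ^ (-γ))) ≠ ∞ := by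
  have h1 : ENNReal.ofReal (d - γ) < dimH E := by
    refine lt_of_add_lt_add_right (a := ENNReal.ofReal γ) (lt_of_eq_of_lt ?_ hdim)
    rw [← ENNReal.ofReal_add (by linarith) hγ.le, sub_add_cancel, ENNReal.ofReal_natCast]
  obtain ⟨s, hs1, hs2⟩ := ENNReal.lt_iff_exists_nnreal_btwn.1 h1
  rw [← ENNReal.ofReal_coe_nnreal] at hs1 hs2
  have hs0 : (0 : ℝ) < s := by
    rw [← ENNReal.ofReal_pos]; exact lt_of_le_of_lt zero_le hs1
  obtain ⟨μ, hμ, hμE, C, hC, hball⟩ := exists_frostman_measure hEm hE hs0 hs2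
  refine ⟨μ, hμ, hμE, fun x hx => ?_, (lintegral_sq_fourierMeasure_mul_lt_top hC hγ ?_ hball).ne⟩
  -- A point mass contradicts the ball condition as the radius tends to zero, since `s > 0`.
  · have hone : μ {x} = 1 := (prob_compl_eq_zero_iff (measurableSet_singleton x)).1 hx
    have hlim : Tendsto (fun r : ℝ => ENNReal.ofReal (C * r ^ (s : ℝ))) (𝓝[>] 0) (𝓝 0) := by
      have hc : Continuous fun r : ℝ => ENNReal.ofReal (C * r ^ (s : ℝ)) :=
        ENNReal.continuous_ofReal.comp
          (continuous_const.mul (Real.continuous_rpow_const hs0.le))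
      have h2 := hc.tendsto 0
      rw [Real.zero_rpow hs0.ne', mul_zero, ENNReal.ofReal_zero] at h2
      exact h2.mono_left nhdsWithin_le_nhds
    have : (1 : ℝ≥0∞) ≤ 0 := by
      refine ge_of_tendsto hlim ?_
      filter_upwards [self_mem_nhdsWithin] with r hr
      rw [← hone]
      exact (measure_mono (singleton_subset_iff.2 (Metric.mem_closedBall_self hr.le))).trans
        (hball x r hr)
    exact absurd this (by simp)
  · have := (ENNReal.ofReal_lt_ofReal_iff hs0).1 hs1
    linarith

/-- Distance sets under pointwise decay of the Fourier transform of the surface measure. -/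
theorem volume_kDistSet_pos_of_pointwise_decay (hd : 1 ≤ d) (hK : Convex ℝ K)
    (h0 : K ∈ 𝓝 (0 : EuclideanSpace ℝ (Fin d))) (hb : Bornology.IsBounded K)
    (hs : ∀ x ∈ K, -x ∈ K) {E : Set (EuclideanSpace ℝ (Fin d))}
    (hEm : MeasurableSet E) (hE : ∀ x ∈ E, ∀ i, x i ∈ Icc (0 : ℝ) 1) {γ C : ℝ} (hγ : 0 < γ)
    (hC : ∀ ξ : EuclideanSpace ℝ (Fin d), ξ ≠ 0 →
      ‖fourierMeasure (surfaceMeasure K) ξ‖ ≤ C * ‖ξ‖ ^ (-γ))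
    (hdim : (d : ℝ≥0∞) < dimH E + ENNReal.ofReal γ) : 0 < volume (kDistSet K E) := by
  have hsf := isFiniteMeasure_surfaceMeasure hd hK h0 hb
  have hle : ∀ ξ : EuclideanSpace ℝ (Fin d), ξ ≠ 0 →
      ‖fourierMeasure (surfaceMeasure K) ξ‖ₑ ≤ ENNReal.ofReal (C * ‖ξ‖ ^ (-γ)) := fun ξ hξ => by
    rw [← ofReal_norm]; exact ENNReal.ofReal_le_ofReal (hC ξ hξ)
  have hA := enorm_fourierMeasure_le (surfaceMeasure K)
  have hγd := le_of_lintegral_eq_top_of_decay hd (measure_ne_top _ _) hA hγ hle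
    (lintegral_fourierMeasure_surfaceMeasure_eq_top hd hK h0 hb hs)
  obtain ⟨μ, hμ, hμE, -, hfin⟩ := exists_measure_energy_lt_top hEm hE hγ hγd hdim
  refine volume_kDistSet_pos_of_le hd hK h0 hb hs hμE (IsProbabilityMeasure.ne_zero μ)
    fun a ha => ?_
  obtain ⟨M, hM, h⟩ := exists_le_mul_min_rpow (measure_ne_top _ _) hA hγ hle ha
  refine ⟨_, ENNReal.mul_ne_top hM hfin, fun t ht => ?_⟩
  rw [← lintegral_const_mul' _ _ hM, distEnergy]
  refine lintegral_mono_ae ?_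
  filter_upwards [ae_ne_zero_euclideanSpace hd] with ξ hξ
  rw [mul_left_comm]
  gcongr
  exact h t ht ξ hξ

/-- Distance sets under decay of the Fourier transform of the surface measure that is governed by a
convex function. -/
theorem volume_kDistSet_pos_of_convex_decay (hd : 1 ≤ d) (hK : Convex ℝ K)
    (h0 : K ∈ 𝓝 (0 : EuclideanSpace ℝ (Fin d))) (hb : Bornology.IsBounded K)
    (hs : ∀ x ∈ K, -x ∈ K) {E : Set (EuclideanSpace ℝ (Fin d))} {γ : ℝ → ℝ} {C : ℝ} (hC0 : 0 < C)
    (hγ : ConvexOn ℝ (Ici 0) γ) (hγ0 : γ 0 = 0)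
    (hC : ∀ ξ : EuclideanSpace ℝ (Fin d), ξ ≠ 0 →
      ‖fourierMeasure (surfaceMeasure K) ξ‖ ≤ C * γ (‖ξ‖⁻¹))
    {μ : Measure (EuclideanSpace ℝ (Fin d))} [IsFiniteMeasure μ] (hμ : μ ≠ 0) (hμE : μ Eᶜ = 0)
    (hfin : ∫⁻ ξ, ENNReal.ofReal (‖fourierMeasure μ ξ‖ ^ 2 * γ (‖ξ‖⁻¹)) < ∞) :
    0 < volume (kDistSet K E) := by
  have : NeZero d := ⟨by omega⟩
  -- Every positive `r` is `‖ξ‖⁻¹` for some frequency, where a norm is bounded by `C * γ r`.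
  have hnn : ∀ r, 0 ≤ r → 0 ≤ γ r := by
    intro r hr
    rcases hr.eq_or_lt with rfl | hr
    · exact hγ0.ge
    obtain ⟨ξ, hξ⟩ := exists_norm_eq (EuclideanSpace ℝ (Fin d)) (inv_nonneg.2 hr.le)
    have h1 := hC ξ (norm_pos_iff.1 (hξ ▸ inv_pos.2 hr))
    rw [hξ, inv_inv] at h1
    exact nonneg_of_mul_nonneg_right ((norm_nonneg _).trans h1) hC0
  -- The graph lies below its chord from the origin: `γ x ≤ (x / y) * γ y ≤ γ y`.
  have hmono : ∀ x y, 0 ≤ x → x ≤ y → γ x ≤ γ y := by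
    intro x y hx hxy
    rcases (hx.trans hxy).eq_or_lt with rfl | hy
    · rw [le_antisymm hxy hx]
    have h1 := hγ.2 (mem_Ici.2 le_rfl) (mem_Ici.2 hy.le)
      (sub_nonneg.2 ((div_le_one hy).2 hxy)) (div_nonneg hx hy.le) (sub_add_cancel _ _)
    simp only [smul_eq_mul, mul_zero, hγ0, zero_add] at h1
    rw [div_mul_cancel₀ _ hy.ne'] at h1
    exact h1.trans (mul_le_of_le_one_left (hnn y hy.le) ((div_le_one hy).2 hxy))
  set G : ℝ → ℝ := fun r => γ (max r 0) with hG
  have hGmono : Monotone G := fun x y hxy => hmono _ _ (le_max_right _ _) (max_le_max_right 0 hxy)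
  have hGnn : ∀ r, 0 ≤ G r := fun r => hnn _ (le_max_right _ _)
  have hGeq : ∀ r, 0 ≤ r → G r = γ r := fun r hr => by rw [hG]; simp only [max_eq_left hr]
  have hfin' : ∫⁻ ξ, ‖fourierMeasure μ ξ‖ₑ ^ 2 * ENNReal.ofReal (G ‖ξ‖⁻¹) ≠ ∞ := by
    refine ne_of_eq_of_ne (lintegral_congr fun ξ => ?_) hfin.ne
    rw [hGeq _ (by positivity), ENNReal.ofReal_mul (by positivity),
      ENNReal.ofReal_pow (norm_nonneg _), ofReal_norm]
  refine volume_kDistSet_pos_of_le hd hK h0 hb hs hμE hμ fun a ha => ?_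
  -- For `t ≥ a` one has `‖t • ξ‖⁻¹ ≤ a⁻¹ * ‖ξ‖⁻¹`, so one dilation factor serves all `t`.
  obtain ⟨N, hN⟩ := exists_lintegral_sq_fourierMeasure_mul_le hd (le_max_left 1 a⁻¹)
  refine ⟨ENNReal.ofReal C * (N * _), ENNReal.mul_ne_top ENNReal.ofReal_ne_top
    (ENNReal.mul_ne_top ENNReal.coe_ne_top hfin'), fun t ht => ?_⟩
  have ht0 : 0 < t := ha.trans_le ht
  refine le_trans ?_ (mul_le_mul_right (hN μ G hGmono hGnn) _)
  rw [← lintegral_const_mul' _ _ ENNReal.ofReal_ne_top, distEnergy]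
  refine lintegral_mono_ae ?_
  filter_upwards [ae_ne_zero_euclideanSpace hd] with ξ hξ
  rw [mul_left_comm, ← ENNReal.ofReal_mul hC0.le,
    ← ofReal_norm (fourierMeasure (surfaceMeasure K) _)]
  gcongr
  refine (hC _ (smul_ne_zero ht0.ne' hξ)).trans ?_
  rw [norm_smul, Real.norm_of_nonneg ht0.le, mul_inv, ← hGeq _ (by positivity)]
  refine mul_le_mul_of_nonneg_left (hGmono ?_) hC0.le
  gcongr
  exact le_trans (by gcongr) (le_max_right _ _)

end DecayBounds


/-! ### The rotation group: invariance and transitivity on spheres. -/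

section Rotations

open Filter Topology Matrix

variable {d : ℕ}

instance RotationGroup.instSecondCountableTopology (d : ℕ) :
    SecondCountableTopology (RotationGroup d) :=
  have : SecondCountableTopology (Matrix (Fin d) (Fin d) ℝ) :=
    inferInstanceAs (SecondCountableTopology (Fin d → Fin d → ℝ))
  TopologicalSpace.Subtype.secondCountableTopology _

theorem rotate_mul (ρ τ : RotationGroup d) (x : EuclideanSpace ℝ (Fin d)) :
    rotate (ρ * τ) x = rotate ρ (rotate τ x) := by
  simp only [rotate, Matrix.mulVec_mulVec]
  rfl

theorem rotate_one (x : EuclideanSpace ℝ (Fin d)) : rotate 1 x = x := by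
  simp only [rotate]
  rw [show ((1 : RotationGroup d) : Matrix (Fin d) (Fin d) ℝ) = 1 from rfl, Matrix.one_mulVec]

theorem rotate_add (ρ : RotationGroup d) (x y : EuclideanSpace ℝ (Fin d)) :
    rotate ρ (x + y) = rotate ρ x + rotate ρ y := by
  simp [rotate, Matrix.mulVec_add]

theorem rotate_smul (ρ : RotationGroup d) (c : ℝ) (x : EuclideanSpace ℝ (Fin d)) :
    rotate ρ (c • x) = c • rotate ρ x := by
  simp [rotate, Matrix.mulVec_smul]

theorem inner_rotate (ρ : RotationGroup d) (x y : EuclideanSpace ℝ (Fin d)) :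
    inner ℝ (rotate ρ x) (rotate ρ y) = inner ℝ x y := by
  have h : (ρ : Matrix (Fin d) (Fin d) ℝ)ᵀ * ρ = 1 := by
    have := (Matrix.mem_specialOrthogonalGroup_iff.1 ρ.2).1
    exact (Matrix.mem_orthogonalGroup_iff' _ _).1 this
  simp only [rotate, EuclideanSpace.inner_eq_star_dotProduct, star_trivial]
  rw [Matrix.dotProduct_mulVec, Matrix.vecMul_mulVec, h, Matrix.vecMul_one]

/-- The action of a rotation as a linear isometric equivalence. -/
noncomputable def rotateIsometry (ρ : RotationGroup d) :
    EuclideanSpace ℝ (Fin d) ≃ₗᵢ[ℝ] EuclideanSpace ℝ (Fin d) where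
  toFun := rotate ρ
  map_add' := rotate_add ρ
  map_smul' := rotate_smul ρ
  invFun := rotate ρ⁻¹
  left_inv x := by rw [← rotate_mul, inv_mul_cancel, rotate_one]
  right_inv x := by rw [← rotate_mul, mul_inv_cancel, rotate_one]
  norm_map' x := by
    change ‖rotate ρ x‖ = ‖x‖
    rw [@norm_eq_sqrt_real_inner _ _ _ (rotate ρ x), inner_rotate, ← norm_eq_sqrt_real_inner]

theorem norm_rotate (ρ : RotationGroup d) (x : EuclideanSpace ℝ (Fin d)) :
    ‖rotate ρ x‖ = ‖x‖ := (rotateIsometry ρ).norm_map x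

theorem continuous_rotate (ρ : RotationGroup d) : Continuous (rotate ρ) :=
  (rotateIsometry ρ).continuous

theorem continuous_rotate_prod :
    Continuous fun p : RotationGroup d × EuclideanSpace ℝ (Fin d) => rotate p.1 p.2 := by
  refine (PiLp.continuous_toLp 2 _).comp ?_
  exact (continuous_subtype_val.comp continuous_fst).matrix_mulVec
    ((PiLp.continuous_ofLp 2 _).comp continuous_snd)

theorem measurePreserving_rotate (ρ : RotationGroup d) :
    MeasurePreserving (rotate ρ) (volume : Measure (EuclideanSpace ℝ (Fin d))) volume :=
  (rotateIsometry ρ).measurePreserving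

theorem fourierMeasure_map_rotate (μ : Measure (EuclideanSpace ℝ (Fin d)))
    (ρ : RotationGroup d) (ξ : EuclideanSpace ℝ (Fin d)) :
    fourierMeasure (μ.map (rotate ρ)) (rotate ρ ξ) = fourierMeasure μ ξ := by
  rw [fourierMeasure, integral_map (continuous_rotate ρ).aemeasurable]
  · simp only [inner_rotate, fourierMeasure]
  · exact Continuous.aestronglyMeasurable (by fun_prop)

/-- Compact groups are unimodular: a right translate of Haar measure is again left invariant, so it
is a multiple, and comparing total masses makes the factor one. -/
theorem map_mul_right_haar_rotationGroup (τ : RotationGroup d) :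
    (Measure.haar : Measure (RotationGroup d)).map (· * τ) = Measure.haar := by
  have h := Measure.isMulInvariant_eq_smul_of_compactSpace
    ((Measure.haar : Measure (RotationGroup d)).map (· * τ)) Measure.haar
  set c := Measure.haarScalarFactor
    ((Measure.haar : Measure (RotationGroup d)).map (· * τ)) Measure.haar
  have hu := congrArg (fun m : Measure (RotationGroup d) => m univ) h
  simp only [Measure.map_apply (measurable_mul_const τ) MeasurableSet.univ, preimage_univ,
    Measure.smul_apply] at hu
  have hc : c = 1 := by
    have h0 : (Measure.haar : Measure (RotationGroup d)) univ ≠ 0 :=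
      (isOpen_univ.measure_pos _ univ_nonempty).ne'
    have hu' : (1 : ℝ≥0∞) * (Measure.haar : Measure (RotationGroup d)) univ =
        c * (Measure.haar : Measure (RotationGroup d)) univ := by rw [one_mul]; exact hu
    exact_mod_cast ((ENNReal.mul_left_inj h0 (measure_ne_top _ _)).1 hu').symm
  rw [h, hc, one_smul]

theorem lintegral_mul_right_haar_rotationGroup {f : RotationGroup d → ℝ≥0∞} (hf : Measurable f)
    (τ : RotationGroup d) : ∫⁻ ρ, f (ρ * τ) ∂Measure.haar = ∫⁻ ρ, f ρ ∂Measure.haar := by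
  conv_rhs => rw [← map_mul_right_haar_rotationGroup τ]
  rw [lintegral_map hf (measurable_mul_const τ)]

/-- The Householder matrix `1 + u vᵀ` with `u = -2 v / |v|²`. -/
noncomputable def householder (v : Fin d → ℝ) : Matrix (Fin d) (Fin d) ℝ :=
  1 + vecMulVec ((-2 / (v ⬝ᵥ v)) • v) v

theorem det_householder {v : Fin d → ℝ} (hv : v ≠ 0) : (householder v).det = -1 := by
  have hvv : v ⬝ᵥ v ≠ 0 := fun h => hv (dotProduct_self_eq_zero.1 h)
  rw [householder, vecMulVec_eq Unit, det_one_add_replicateCol_mul_replicateRow, dotProduct_smul,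
    smul_eq_mul, div_mul_cancel₀ _ hvv]
  norm_num

theorem householder_mul_transpose {v : Fin d → ℝ} (hv : v ≠ 0) :
    householder v * (householder v)ᵀ = 1 := by
  have hvv : v ⬝ᵥ v ≠ 0 := fun h => hv (dotProduct_self_eq_zero.1 h)
  have h1 : (householder v)ᵀ = householder v := by
    rw [householder, transpose_add, transpose_one, transpose_vecMulVec, vecMulVec_smul,
      smul_vecMulVec]
  rw [h1, householder, smul_vecMulVec, mul_add, add_mul, add_mul, one_mul, one_mul, mul_one,
    smul_mul_assoc, mul_smul_comm, vecMulVec_mul_vecMulVec, vecMulVec_smul, smul_smul, smul_smul,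
    add_assoc, ← add_smul, ← add_smul]
  convert add_zero _
  convert zero_smul ℝ _
  field_simp
  norm_num

theorem householder_mulVec (v x : Fin d → ℝ) :
    householder v *ᵥ x = x + (-2 / (v ⬝ᵥ v) * (v ⬝ᵥ x)) • v := by
  rw [householder, add_mulVec, one_mulVec, smul_vecMulVec, smul_mulVec, vecMulVec_mulVec,
    op_smul_eq_smul, smul_smul]

/-- Two vectors of the same norm are conjugate, up to sign, under the rotation group. -/
theorem exists_rotate_eq_or_eq_neg {x y : EuclideanSpace ℝ (Fin d)} (hxy : ‖x‖ = ‖y‖) :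
    ∃ ρ : RotationGroup d, rotate ρ x = y ∨ rotate ρ x = -y := by
  by_cases hne : x = y
  · exact ⟨1, Or.inl (by rw [rotate_one, hne])⟩
  have hdot : x.ofLp ⬝ᵥ x.ofLp = y.ofLp ⬝ᵥ y.ofLp := by
    have h := congrArg (· ^ 2) hxy
    simp only [← real_inner_self_eq_norm_sq, EuclideanSpace.inner_eq_star_dotProduct,
      star_trivial] at h
    exact h
  have hx : x.ofLp ⬝ᵥ x.ofLp ≠ 0 := by
    intro h
    refine hne ?_
    have h1 : x.ofLp = 0 := dotProduct_self_eq_zero.1 h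
    have h2 : y.ofLp = 0 := dotProduct_self_eq_zero.1 (hdot ▸ h)
    exact WithLp.ofLp_injective 2 (h1.trans h2.symm)
  -- The reflection along `x - y` takes `x` to `y` but has determinant `-1`; a preceding reflection
  -- along `w ⊥ x` fixes `x` and corrects the determinant.
  by_cases hw : ∃ w : Fin d → ℝ, w ≠ 0 ∧ w ⬝ᵥ x.ofLp = 0
  · obtain ⟨w, hw0, hwx⟩ := hw
    set v := x.ofLp - y.ofLp with hv
    have hv0 : v ≠ 0 := sub_ne_zero.2 fun h => hne (WithLp.ofLp_injective 2 h)
    have hmem : householder v * householder w ∈ Matrix.specialOrthogonalGroup (Fin d) ℝ := by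
      rw [Matrix.mem_specialOrthogonalGroup_iff, Matrix.mem_orthogonalGroup_iff, det_mul,
        det_householder hv0, det_householder hw0]
      refine ⟨?_, by norm_num⟩
      change householder v * householder w * (householder v * householder w)ᵀ = 1
      rw [transpose_mul, mul_assoc, ← mul_assoc (householder w), householder_mul_transpose hw0,
        one_mul, householder_mul_transpose hv0]
    refine ⟨⟨_, hmem⟩, Or.inl ?_⟩
    simp only [rotate]
    rw [← mulVec_mulVec, householder_mulVec w, hwx, mul_zero, zero_smul, add_zero,
      householder_mulVec v]
    have hvv : v ⬝ᵥ v = 2 * (v ⬝ᵥ x.ofLp) := by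
      rw [hv, sub_dotProduct, dotProduct_sub, dotProduct_sub, sub_dotProduct, ← hdot,
        dotProduct_comm y.ofLp x.ofLp]
      ring
    have hvx : v ⬝ᵥ x.ofLp ≠ 0 := fun h =>
      hv0 (dotProduct_self_eq_zero.1 (by rw [hvv, h, mul_zero]))
    have hc : -2 / (v ⬝ᵥ v) * (v ⬝ᵥ x.ofLp) = -1 := by
      rw [hvv]; field_simp
    rw [hc, neg_one_smul, hv, neg_sub, add_sub_cancel]
  -- Here `x` spans the space, so `y = -x`, and the sign cannot be avoided: in dimension one the
  -- rotation group is trivial.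
  · push Not at hw
    have hy : y.ofLp - ((y.ofLp ⬝ᵥ x.ofLp) / (x.ofLp ⬝ᵥ x.ofLp)) • x.ofLp = 0 := by
      by_contra h
      refine hw _ h ?_
      rw [sub_dotProduct, smul_dotProduct, smul_eq_mul, div_mul_cancel₀ _ hx, sub_self]
    set c := (y.ofLp ⬝ᵥ x.ofLp) / (x.ofLp ⬝ᵥ x.ofLp)
    have hyc : y.ofLp = c • x.ofLp := sub_eq_zero.1 hy
    have hc : c * c = 1 := by
      rw [hyc, smul_dotProduct, dotProduct_smul, smul_eq_mul, smul_eq_mul, ← mul_assoc] at hdot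
      exact mul_right_cancel₀ hx (by rw [one_mul, ← hdot])
    refine ⟨1, Or.inr ?_⟩
    rw [rotate_one]
    rcases mul_self_eq_one_iff.1 hc with h | h
    · exact absurd (WithLp.ofLp_injective 2 (by rw [hyc, h, one_smul])) hne
    · refine WithLp.ofLp_injective 2 ?_
      rw [WithLp.ofLp_neg, hyc, h, neg_one_smul, neg_neg]

end Rotations


/-! ### Averaging the energy over rotations. -/

section RotatedDistanceSets

open Filter Topology
open scoped Pointwise

variable {d : ℕ} {K : Set (EuclideanSpace ℝ (Fin d))}

/-- The spherical measure of a set is given by the volume of the cone over it, and rotations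
preserve volume and cones. -/
theorem lintegral_toSphere_rotate (ρ : RotationGroup d) {f : EuclideanSpace ℝ (Fin d) → ℝ≥0∞}
    (hf : Measurable f) :
    ∫⁻ ω : Metric.sphere (0 : EuclideanSpace ℝ (Fin d)) 1, f (rotate ρ ω)
      ∂(volume : Measure (EuclideanSpace ℝ (Fin d))).toSphere =
    ∫⁻ ω : Metric.sphere (0 : EuclideanSpace ℝ (Fin d)) 1, f ω
      ∂(volume : Measure (EuclideanSpace ℝ (Fin d))).toSphere := by
  set T : Metric.sphere (0 : EuclideanSpace ℝ (Fin d)) 1 →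
    Metric.sphere (0 : EuclideanSpace ℝ (Fin d)) 1 :=
      fun ω => ⟨rotate ρ ω, by
        rw [mem_sphere_zero_iff_norm, norm_rotate]; exact norm_eq_of_mem_sphere ω⟩
    with hT
  have hTc : Continuous T := ((continuous_rotate ρ).comp continuous_subtype_val).subtype_mk _
  have hmap : (volume : Measure (EuclideanSpace ℝ (Fin d))).toSphere.map T =
      (volume : Measure (EuclideanSpace ℝ (Fin d))).toSphere := by
    ext s hs
    rw [Measure.map_apply hTc.measurable hs, Measure.toSphere_apply' _ (hTc.measurable hs),
      Measure.toSphere_apply' _ hs]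
    congr 1
    refine Eq.trans (congrArg volume ?_) ((measurePreserving_rotate ρ).measure_preimage_emb
      (rotateIsometry ρ).toHomeomorph.measurableEmbedding (Ioo (0 : ℝ) 1 • (Subtype.val '' s)))
    ext x
    rw [mem_preimage, Set.mem_smul, Set.mem_smul]
    constructor
    · rintro ⟨r, hr, _, ⟨ω, hω, rfl⟩, rfl⟩
      exact ⟨r, hr, _, ⟨T ω, hω, rfl⟩, (rotate_smul ρ r _).symm⟩
    · rintro ⟨r, hr, _, ⟨ω, hω, rfl⟩, hx⟩
      have hωn : rotate ρ⁻¹ (ω : EuclideanSpace ℝ (Fin d)) ∈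
          Metric.sphere (0 : EuclideanSpace ℝ (Fin d)) 1 := by
        rw [mem_sphere_zero_iff_norm, norm_rotate]; exact norm_eq_of_mem_sphere ω
      refine ⟨r, hr, _, ⟨⟨_, hωn⟩, ?_, rfl⟩, ?_⟩
      · have hTω : T ⟨_, hωn⟩ = ω := by
          ext1
          simp only [hT]
          rw [← rotate_mul, mul_inv_cancel, rotate_one]
        rwa [mem_preimage, hTω]
      · change r • rotate ρ⁻¹ (ω : EuclideanSpace ℝ (Fin d)) = x
        rw [← rotate_smul, hx, ← rotate_mul, inv_mul_cancel, rotate_one]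
  conv_rhs => rw [← hmap]
  exact (lintegral_map (hf.comp measurable_subtype_coe) hTc.measurable).symm

/-- The average of `|σ̂_K|` over the rotates of a frequency. -/
noncomputable def rotationAverage (K : Set (EuclideanSpace ℝ (Fin d)))
    (ξ : EuclideanSpace ℝ (Fin d)) : ℝ≥0∞ :=
  ∫⁻ ρ : RotationGroup d, ‖fourierMeasure (surfaceMeasure K) (rotate ρ ξ)‖ₑ ∂Measure.haar

theorem measurable_enorm_fourierMeasure_rotate [IsFiniteMeasure (surfaceMeasure K)] {X : Type*}
    [TopologicalSpace X] [MeasurableSpace X] [OpensMeasurableSpace X] {f : X → RotationGroup d}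
    {g : X → EuclideanSpace ℝ (Fin d)} (hf : Continuous f) (hg : Continuous g) :
    Measurable fun x => ‖fourierMeasure (surfaceMeasure K) (rotate (f x) (g x))‖ₑ := by
  have h : Continuous fun x => fourierMeasure (surfaceMeasure K) (rotate (f x) (g x)) :=
    (continuous_fourierMeasure (surfaceMeasure K)).comp
      (continuous_rotate_prod.comp (hf.prodMk hg))
  exact h.measurable.enorm

theorem rotationAverage_le [IsFiniteMeasure (surfaceMeasure K)] (ξ : EuclideanSpace ℝ (Fin d)) :
    rotationAverage K ξ ≤
      surfaceMeasure K univ * (Measure.haar : Measure (RotationGroup d)) univ := by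
  rw [← lintegral_const]
  exact lintegral_mono fun ρ => enorm_fourierMeasure_le _ _

/-- A rotation between the two frequencies is absorbed by right invariance, and the possible sign by
evenness of the modulus of the transform. -/
theorem rotationAverage_eq_of_norm_eq [IsFiniteMeasure (surfaceMeasure K)]
    {ξ η : EuclideanSpace ℝ (Fin d)} (h : ‖ξ‖ = ‖η‖) :
    rotationAverage K ξ = rotationAverage K η := by
  obtain ⟨τ, hτ⟩ := exists_rotate_eq_or_eq_neg h
  have hm : Measurable fun ρ : RotationGroup d =>
      ‖fourierMeasure (surfaceMeasure K) (rotate ρ ξ)‖ₑ :=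
    measurable_enorm_fourierMeasure_rotate continuous_id continuous_const
  refine (lintegral_mul_right_haar_rotationGroup hm τ).symm.trans ?_
  refine lintegral_congr fun ρ => ?_
  rw [rotate_mul]
  rcases hτ with hτ | hτ
  · rw [hτ]
  · rw [hτ, ← neg_one_smul ℝ η, rotate_smul, neg_one_smul, enorm_fourierMeasure_neg]

/-- By Tonelli's theorem, as every rotate has infinite integral. This forces `γ ≤ d` under spherical
decay too. -/
theorem lintegral_rotationAverage_eq_top (hd : 1 ≤ d) (hK : Convex ℝ K)
    (h0 : K ∈ 𝓝 (0 : EuclideanSpace ℝ (Fin d))) (hb : Bornology.IsBounded K)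
    (hs : ∀ x ∈ K, -x ∈ K) : ∫⁻ ξ, rotationAverage K ξ = ∞ := by
  have hsf := isFiniteMeasure_surfaceMeasure hd hK h0 hb
  unfold rotationAverage
  rw [lintegral_lintegral_swap
    (f := fun ξ (ρ : RotationGroup d) => ‖fourierMeasure (surfaceMeasure K) (rotate ρ ξ)‖ₑ)
    (measurable_enorm_fourierMeasure_rotate continuous_snd continuous_fst).aemeasurable]
  have h : ∀ ρ : RotationGroup d,
      ∫⁻ ξ, ‖fourierMeasure (surfaceMeasure K) (rotate ρ ξ)‖ₑ = ∞ := fun ρ => by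
    rw [(measurePreserving_rotate ρ).lintegral_comp
      (continuous_fourierMeasure (surfaceMeasure K)).measurable.enorm]
    exact lintegral_fourierMeasure_surfaceMeasure_eq_top hd hK h0 hb hs
  simp only [h]
  rw [lintegral_const, ENNReal.top_mul]
  exact (isOpen_univ.measure_pos _ univ_nonempty).ne'

/-- The rotation average is constant on spheres, so it may be averaged over the sphere as well.
After exchanging the integrals, the inner one is the spherical mean, by rotation invariance. -/
theorem exists_rotationAverage_le (hd : 1 ≤ d) [IsFiniteMeasure (surfaceMeasure K)] {C γ : ℝ}
    (hC : ∀ R : ℝ, 0 < R → ∫ ω : Metric.sphere (0 : EuclideanSpace ℝ (Fin d)) 1,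
      ‖fourierMeasure (surfaceMeasure K) (R • (ω : EuclideanSpace ℝ (Fin d)))‖
        ∂(volume : Measure (EuclideanSpace ℝ (Fin d))).toSphere ≤ C * R ^ (-γ)) :
    ∃ C' : ℝ, ∀ ξ : EuclideanSpace ℝ (Fin d), ξ ≠ 0 →
      rotationAverage K ξ ≤ ENNReal.ofReal (C' * ‖ξ‖ ^ (-γ)) := by
  have : NeZero d := ⟨by omega⟩
  set S := (volume : Measure (EuclideanSpace ℝ (Fin d))).toSphere with hS
  set c := S univ with hc
  have hc0 : c ≠ 0 := by
    rw [hc, Ne, Measure.measure_univ_eq_zero]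
    exact Measure.toSphere_ne_zero _
  have hct : c ≠ ∞ := measure_ne_top _ _
  set h := (Measure.haar : Measure (RotationGroup d)) univ with hh
  have hht : h ≠ ∞ := measure_ne_top _ _
  refine ⟨(h / c).toReal * C, fun ξ hξ => ?_⟩
  have hR : 0 < ‖ξ‖ := norm_pos_iff.2 hξ
  set R := ‖ξ‖ with hRdef
  have hcont := continuous_fourierMeasure (surfaceMeasure K)
  have hlin : ∫⁻ ω : Metric.sphere (0 : EuclideanSpace ℝ (Fin d)) 1,
      ‖fourierMeasure (surfaceMeasure K) (R • (ω : EuclideanSpace ℝ (Fin d)))‖ₑ ∂S ≤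
        ENNReal.ofReal (C * R ^ (-γ)) := by
    have hcω : Continuous fun ω : Metric.sphere (0 : EuclideanSpace ℝ (Fin d)) 1 =>
        fourierMeasure (surfaceMeasure K) (R • (ω : EuclideanSpace ℝ (Fin d))) :=
      hcont.comp (continuous_subtype_val.const_smul R)
    have hint : Integrable (fun ω : Metric.sphere (0 : EuclideanSpace ℝ (Fin d)) 1 =>
        ‖fourierMeasure (surfaceMeasure K) (R • (ω : EuclideanSpace ℝ (Fin d)))‖) S := by
      refine Integrable.of_bound hcω.norm.aestronglyMeasurable (surfaceMeasure K univ).toReal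
        (ae_of_all _ fun ω => ?_)
      rw [norm_norm, ← toReal_enorm]
      exact ENNReal.toReal_mono (measure_ne_top _ _) (enorm_fourierMeasure_le _ _)
    calc _ = ENNReal.ofReal (∫ ω : Metric.sphere (0 : EuclideanSpace ℝ (Fin d)) 1,
          ‖fourierMeasure (surfaceMeasure K) (R • (ω : EuclideanSpace ℝ (Fin d)))‖ ∂S) := by
          rw [ofReal_integral_eq_lintegral_ofReal hint (ae_of_all _ fun ω => norm_nonneg _)]
          exact lintegral_congr fun ω => (ofReal_norm _).symm
      _ ≤ _ := ENNReal.ofReal_le_ofReal (hC R hR)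
  have hav : rotationAverage K ξ * c ≤ ENNReal.ofReal (C * R ^ (-γ)) * h := by
    calc rotationAverage K ξ * c
        = ∫⁻ ω : Metric.sphere (0 : EuclideanSpace ℝ (Fin d)) 1,
            rotationAverage K (R • (ω : EuclideanSpace ℝ (Fin d))) ∂S := by
          rw [hc, ← lintegral_const]
          refine lintegral_congr fun ω => rotationAverage_eq_of_norm_eq ?_
          rw [norm_smul, norm_eq_of_mem_sphere ω, mul_one, Real.norm_of_nonneg hR.le]
      _ = ∫⁻ ρ : RotationGroup d, (∫⁻ ω : Metric.sphere (0 : EuclideanSpace ℝ (Fin d)) 1,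
            ‖fourierMeasure (surfaceMeasure K)
              (rotate ρ (R • (ω : EuclideanSpace ℝ (Fin d))))‖ₑ ∂S) ∂Measure.haar := by
          unfold rotationAverage
          exact lintegral_lintegral_swap
            (f := fun (ω : Metric.sphere (0 : EuclideanSpace ℝ (Fin d)) 1)
            (ρ : RotationGroup d) => ‖fourierMeasure (surfaceMeasure K)
              (rotate ρ (R • (ω : EuclideanSpace ℝ (Fin d))))‖ₑ)
            (measurable_enorm_fourierMeasure_rotate continuous_snd
              ((continuous_subtype_val.comp continuous_fst).const_smul R)).aemeasurable
      _ ≤ ∫⁻ _ : RotationGroup d, ENNReal.ofReal (C * R ^ (-γ)) ∂Measure.haar := by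
          refine lintegral_mono fun ρ => le_trans (le_of_eq ?_) hlin
          simp only [rotate_smul]
          exact lintegral_toSphere_rotate ρ
            (f := fun x => ‖fourierMeasure (surfaceMeasure K) (R • x)‖ₑ)
            (hcont.comp (continuous_const_smul R)).measurable.enorm
      _ = _ := lintegral_const _
  rw [← ENNReal.le_div_iff_mul_le (Or.inl hc0) (Or.inl hct)] at hav
  refine hav.trans (le_of_eq ?_)
  rw [mul_assoc, ENNReal.ofReal_mul ENNReal.toReal_nonneg,
    ENNReal.ofReal_toReal (ENNReal.div_ne_top hht hc0), mul_div_assoc, mul_comm]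

theorem distEnergy_map_rotate [IsFiniteMeasure (surfaceMeasure K)]
    (μ : Measure (EuclideanSpace ℝ (Fin d))) [IsFiniteMeasure μ] (ρ : RotationGroup d) (t : ℝ) :
    distEnergy K (μ.map (rotate ρ)) t = ∫⁻ ξ, ‖fourierMeasure μ ξ‖ₑ ^ 2 *
      ‖fourierMeasure (surfaceMeasure K) (rotate ρ (t • ξ))‖ₑ := by
  have : IsFiniteMeasure (μ.map (rotate ρ)) := Measure.isFiniteMeasure_map _ _
  have hm : Measurable fun ξ => ‖fourierMeasure (μ.map (rotate ρ)) ξ‖ₑ ^ 2 *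
      ‖fourierMeasure (surfaceMeasure K) (t • ξ)‖ₑ :=
    ((continuous_fourierMeasure _).measurable.enorm.pow_const 2).mul
      ((continuous_fourierMeasure _).comp (continuous_const_smul t)).measurable.enorm
  rw [distEnergy, ← (measurePreserving_rotate ρ).lintegral_comp hm]
  simp only [fourierMeasure_map_rotate, rotate_smul]

theorem measurable_distEnergy_map_rotate [IsFiniteMeasure (surfaceMeasure K)]
    (μ : Measure (EuclideanSpace ℝ (Fin d))) [IsFiniteMeasure μ] :
    Measurable fun p : RotationGroup d × ℝ => distEnergy K (μ.map (rotate p.1)) p.2 := by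
  simp only [distEnergy_map_rotate]
  refine Measurable.lintegral_prod_right' (f := fun q : (RotationGroup d × ℝ) ×
    EuclideanSpace ℝ (Fin d) => ‖fourierMeasure μ q.2‖ₑ ^ 2 *
      ‖fourierMeasure (surfaceMeasure K) (rotate q.1.1 (q.1.2 • q.2))‖ₑ) ?_
  exact (((continuous_fourierMeasure μ).measurable.comp measurable_snd).enorm.pow_const 2).mul
    (measurable_enorm_fourierMeasure_rotate (continuous_fst.comp continuous_fst)
      ((continuous_snd.comp continuous_fst).smul continuous_snd))

theorem lintegral_distEnergy_map_rotate [IsFiniteMeasure (surfaceMeasure K)]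
    (μ : Measure (EuclideanSpace ℝ (Fin d))) [IsFiniteMeasure μ] (t : ℝ) :
    ∫⁻ ρ : RotationGroup d, distEnergy K (μ.map (rotate ρ)) t ∂Measure.haar =
      ∫⁻ ξ, ‖fourierMeasure μ ξ‖ₑ ^ 2 * rotationAverage K (t • ξ) := by
  simp only [distEnergy_map_rotate]
  rw [lintegral_lintegral_swap (f := fun (ρ : RotationGroup d) ξ => ‖fourierMeasure μ ξ‖ₑ ^ 2 *
      ‖fourierMeasure (surfaceMeasure K) (rotate ρ (t • ξ))‖ₑ)]
  · refine lintegral_congr fun ξ => ?_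
    rw [lintegral_const_mul' _ _ (by finiteness), rotationAverage]
  · exact ((((continuous_fourierMeasure μ).comp continuous_snd).measurable.enorm.pow_const 2).mul
      (measurable_enorm_fourierMeasure_rotate continuous_fst
        (continuous_snd.const_smul t))).aemeasurable

/-- Distance sets of rotates under decay of the spherical averages of the Fourier transform of the
surface measure. -/
theorem ae_volume_kDistSet_rotate_pos (hd : 1 ≤ d) (hK : Convex ℝ K)
    (h0 : K ∈ 𝓝 (0 : EuclideanSpace ℝ (Fin d))) (hb : Bornology.IsBounded K)
    (hs : ∀ x ∈ K, -x ∈ K) {E : Set (EuclideanSpace ℝ (Fin d))}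
    (hEm : MeasurableSet E) (hE : ∀ x ∈ E, ∀ i, x i ∈ Icc (0 : ℝ) 1) {γ C : ℝ} (hγ : 0 < γ)
    (hC : ∀ R : ℝ, 0 < R → ∫ ω : Metric.sphere (0 : EuclideanSpace ℝ (Fin d)) 1,
      ‖fourierMeasure (surfaceMeasure K) (R • (ω : EuclideanSpace ℝ (Fin d)))‖
        ∂(volume : Measure (EuclideanSpace ℝ (Fin d))).toSphere ≤ C * R ^ (-γ))
    (hdim : (d : ℝ≥0∞) < dimH E + ENNReal.ofReal γ) :
    ∀ᵐ ρ ∂(Measure.haar : Measure (RotationGroup d)), 0 < volume (kDistSet K (rotate ρ '' E)) := by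
  have hsf := isFiniteMeasure_surfaceMeasure hd hK h0 hb
  obtain ⟨C', hC'⟩ := exists_rotationAverage_le hd hC
  have hA : surfaceMeasure K univ * (Measure.haar : Measure (RotationGroup d)) univ ≠ ∞ := by
    finiteness
  have hγd := le_of_lintegral_eq_top_of_decay hd hA rotationAverage_le hγ hC'
    (lintegral_rotationAverage_eq_top hd hK h0 hb hs)
  obtain ⟨μ, hμ, hμE, hpt, hfin⟩ := exists_measure_energy_lt_top hEm hE hγ hγd hdim
  -- Countably many intervals exhaust the half-line, so a single null set of rotations is discarded.
  -- On each interval the energy has finite integral jointly in the rotation and `t`.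
  have hae : ∀ n : ℕ, ∀ᵐ ρ ∂(Measure.haar : Measure (RotationGroup d)),
      ∫⁻ t in Icc (1 / ((n : ℝ) + 1)) (n + 1), distEnergy K (μ.map (rotate ρ)) t < ∞ := by
    intro n
    obtain ⟨M, hM, h⟩ := exists_le_mul_min_rpow hA rotationAverage_le hγ hC'
      (show 0 < 1 / ((n : ℝ) + 1) by positivity)
    refine ae_lt_top (measurable_distEnergy_map_rotate μ).lintegral_prod_right' ?_
    rw [lintegral_lintegral_swap (measurable_distEnergy_map_rotate μ).aemeasurable]
    refine ne_top_of_le_ne_top (b := M * (∫⁻ ξ, ‖fourierMeasure μ ξ‖ₑ ^ 2 *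
      ENNReal.ofReal (min 1 (‖ξ‖ ^ (-γ)))) * volume (Icc (1 / ((n : ℝ) + 1)) (n + 1)))
      (ENNReal.mul_ne_top (ENNReal.mul_ne_top hM hfin) ?_) ?_
    · rw [Real.volume_Icc]; exact ENNReal.ofReal_ne_top
    rw [← setLIntegral_const]
    refine setLIntegral_mono' measurableSet_Icc fun t ht => ?_
    rw [lintegral_distEnergy_map_rotate, ← lintegral_const_mul' _ _ hM]
    refine lintegral_mono_ae ?_
    filter_upwards [ae_ne_zero_euclideanSpace hd] with ξ hξ
    rw [mul_left_comm]
    gcongr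
    exact h t ht.1 ξ hξ
  filter_upwards [ae_all_iff.2 hae] with ρ hρ
  have : IsFiniteMeasure (μ.map (rotate ρ)) := Measure.isFiniteMeasure_map _ _
  have hemb : MeasurableEmbedding (rotate ρ) :=
    (rotateIsometry ρ).toHomeomorph.measurableEmbedding
  have hinj : Function.Injective (rotate ρ) := (rotateIsometry ρ).injective
  refine volume_kDistSet_pos (μ := μ.map (rotate ρ)) hd hK h0 hb hs ?_ (fun x => ?_)
    fun a b ha => ?_
  · rw [hemb.map_apply, preimage_compl, hinj.preimage_image]
    exact hμE
  · rw [hemb.map_apply, preimage_compl]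
    have hx : rotate ρ ⁻¹' {x} = {rotate ρ⁻¹ x} := by
      ext y
      rw [mem_preimage, mem_singleton_iff, mem_singleton_iff]
      constructor
      · rintro rfl; rw [← rotate_mul, inv_mul_cancel, rotate_one]
      · rintro rfl; rw [← rotate_mul, mul_inv_cancel, rotate_one]
    rw [hx]
    exact hpt _
  · obtain ⟨n, hn⟩ := exists_nat_one_div_lt ha
    obtain ⟨m, hm⟩ := exists_nat_gt b
    refine ne_top_of_le_ne_top (hρ (max n m)).ne (lintegral_mono_set (Icc_subset_Icc ?_ ?_))
    · refine le_trans ?_ hn.le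
      gcongr
      exact le_max_left _ _
    · have : (m : ℝ) ≤ (max n m : ℕ) := by exact_mod_cast le_max_right _ _
      linarith

end RotatedDistanceSets

theorem theorem0p1 (d : ℕ) (hd : 1 ≤ d)
    (E : Set (EuclideanSpace ℝ (Fin d))) (hE : ∀ x ∈ E, ∀ i, x i ∈ Icc (0 : ℝ) 1)
    (K : Set (EuclideanSpace ℝ (Fin d))) (hKconv : Convex ℝ K) (hKbdd : Bornology.IsBounded K)
    (hKsymm : ∀ x ∈ K, -x ∈ K) (hKint : (interior K).Nonempty) :
    -- (i) pointwise decay; the condition `dim_H E > d - γ` is written without subtraction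
    (∀ γ : ℝ, 0 < γ → MeasurableSet E →
      (∃ C : ℝ, ∀ ξ : EuclideanSpace ℝ (Fin d), ξ ≠ 0 →
        ‖fourierMeasure (surfaceMeasure K) ξ‖ ≤ C * ‖ξ‖ ^ (-γ)) →
      (d : ℝ≥0∞) < dimH E + ENNReal.ofReal γ →
      0 < volume (kDistSet K E)) ∧
    -- (ii) decay of spherical averages
    (∀ γ : ℝ, 0 < γ → MeasurableSet E →
      (∃ C : ℝ, ∀ R : ℝ, 0 < R →
        ∫ ω : Metric.sphere (0 : EuclideanSpace ℝ (Fin d)) 1,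
          ‖fourierMeasure (surfaceMeasure K) (R • (ω : EuclideanSpace ℝ (Fin d)))‖
            ∂(volume : Measure (EuclideanSpace ℝ (Fin d))).toSphere ≤ C * R ^ (-γ)) →
      (d : ℝ≥0∞) < dimH E + ENNReal.ofReal γ →
      ∀ᵐ ρ ∂(Measure.haar : Measure (RotationGroup d)),
        0 < volume (kDistSet K (rotate ρ '' E))) ∧
    -- (iii) decay governed by a convex function
    (∀ γ : ℝ → ℝ, ConvexOn ℝ (Ici 0) γ → γ 0 = 0 →
      (∃ C : ℝ, 0 < C ∧ ∀ ξ : EuclideanSpace ℝ (Fin d), ξ ≠ 0 →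
        ‖fourierMeasure (surfaceMeasure K) ξ‖ ≤ C * γ (‖ξ‖⁻¹)) →
      (∃ μ : Measure (EuclideanSpace ℝ (Fin d)), IsFiniteMeasure μ ∧ μ ≠ 0 ∧ μ Eᶜ = 0 ∧
        ∫⁻ ξ, ENNReal.ofReal (‖fourierMeasure μ ξ‖ ^ 2 * γ (‖ξ‖⁻¹)) < ∞) →
      0 < volume (kDistSet K E)) := by
  have h0 := hKconv.mem_nhds_zero_of_symm hKsymm hKint
  refine ⟨?_, ?_, ?_⟩
  · rintro γ hγ hEm ⟨C, hC⟩ hdim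
    exact volume_kDistSet_pos_of_pointwise_decay hd hKconv h0 hKbdd hKsymm hEm hE hγ hC hdim
  · rintro γ hγ hEm ⟨C, hC⟩ hdim
    exact ae_volume_kDistSet_rotate_pos hd hKconv h0 hKbdd hKsymm hEm hE hγ hC hdim
  · rintro γ hγ hγ0 ⟨C, hC0, hC⟩ ⟨μ, hμ, hμ0, hμE, hfin⟩
    exact volume_kDistSet_pos_of_convex_decay hd hKconv h0 hKbdd hKsymm hC0 hγ hγ0 hC hμ0 hμE hfin
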